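/- **Setting.** Let $z=(z_1,\dots,z_P)$, $z_i\in\mathbb R^{n_i}$, $n_z=\sum_i n_i$, and consider the parametric program $$\min_z f(z)\quad\text{s.t. } g(z,s)=0,\ z\in\mathcal Z:=\mathcal Z_1\times\dots\times\mathcal Z_P,\qquad s\in\mathcal S\subset\mathbb R^p,$$ where $f:\mathbb R^{n_z}\to\mathbb R$ is $C^2$, semi-algebraic and convex in each block $z_i$, $g(\cdot,s):\mathbb R^{n_z}\to\mathbb R^m$ is multi-affine (affine in each block) for $s\in\mathcal S$, and the $\mathcal Z_i\subset\mathbb R^{n_i}$ are compact and convex. All norms are Euclidean, $\mathcal B(x,r)$ is the open ball, and $\mathcal N_C(x)=\{v:\langle v,y-x\rangle\le 0\ \forall y\in C\}$ for $x\in C$, $\mathcal N_C(x)=\emptyset$ for $x\notin C$. For $w=(z,\mu)\in\mathbb R^{n_z}\times\mathbb R^m$ put $$F(w,s)=\begin{pmatrix}\nabla f(z)+\nabla_zg(z,s)^\top\mu\\ g(z,s)\end{pmatrix},\qquad L_\rho(z,\mu,s)=f(z)+\Big(\mu+\tfrac{\rho}{2}g(z,s)\Big)^{\!\top}g(z,s).$$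 A *KKT point* at $s$ is a $w$ with $0\in F(w,s)+\mathcal N_{\mathcal Z\times\mathbb R^m}(w)$. A generalised equation $0\in\Phi(w)+\mathcal N_C(w)$ is *strongly regular* at a solution $w^*$ with constants $\eta,\kappa>0$ and $l$ if for each $r\in\mathcal B(0,\eta)$ there is a unique $w\in\mathcal B(w^*,\kappa)$ with $r\in\Phi(w^*)+\nabla\Phi(w^*)(w-w^*)+\mathcal N_C(w)$, and $r\mapsto w$ is $l$-Lipschitz on $\mathcal B(0,\eta)$. **Algorithm** (one time step, parameters $\alpha_i>0$, $\rho>0$, $M\ge1$). Given $\bar w_k=(\bar z_k,\bar\mu_k)$ with $\bar z_k\in\mathcal Z$ and $s_{k+1}$, set $z^{(0)}=\bar z_k$; for $l=0,\dots,M-1$ and $i=1,\dots,P$ let $$z_i^{(l+1)}=\arg\min_{z_i\in\mathcal Z_i}L_\rho\big(z_1^{(l+1)},\dots,z_{i-1}^{(l+1)},z_i,z_{i+1}^{(l)},\dots,z_P^{(l)},\bar\mu_k,s_{k+1}\big)+\tfrac{\alpha_i}{2}\|z_i-z_i^{(l)}\|^2;$$ then $\bar z_{k+1}=z^{(M)}$,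 $\bar\mu_{k+1}=\bar\mu_k+\rho g(\bar z_{k+1},s_{k+1})$, $\bar w_{k+1}=(\bar z_{k+1},\bar\mu_{k+1})$. **Assumptions.** Let $(s_k)_{k\in\mathbb N}\subset\mathcal S$ and $w_k^*=(z_k^*,\mu_k^*)$ be such that, with constants $\eta,\kappa>0$, $l$ and $\varepsilon>0$ independent of $k$: * $w_k^*$ is a KKT point at $s_k$ at which the KKT generalised equation is strongly regular with constants $\eta,\kappa,l$; * $z_k^*$ is a local optimum: $f(z_k^*)\le f(z)$ for all $z\in\mathcal Z$ with $g(z,s_k)=0$ and $\|z-z_k^*\|<\varepsilon$. Let $\lambda_F,\lambda_g>0$ satisfy $\|F(w,s)-F(w,s')\|\le\lambda_F\|s-s'\|$ for $w\in\mathcal Z\times\mathbb R^m$, $s,s'\in\mathcal S$, and $\|g(z,s)-g(z',s)\|\le\lambda_g\|z-z'\|$ for $z,z'\in\mathcal Z$, $s\in\mathcal S$. Put $\lambda_G=\sqrt{\max\{\lambda_F^2,1\}+\lambda_F}$. **Theorem (Contraction).** 1. There are $\delta_A,r_A>0$ such that for all $k$ and all $s\in\mathcal S\cap\mathcal B(s_k,r_A)$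 there is a unique KKT point $w^*(s)$ at $s$ in $\mathcal B(w_k^*,\delta_A)$, and there is $\lambda_A>0$ such that for all $k$ and all $s,s'\in\mathcal S\cap\mathcal B(s_k,r_A)$ $$\|w^*(s)-w^*(s')\|\le\lambda_A\|F(w^*(s'),s)-F(w^*(s'),s')\|.\tag{A}$$ 2. There is moreover $\tilde\rho>0$ such that for every $\rho>\tilde\rho$ the following holds, with $$G_\rho(w,d,s)=\begin{pmatrix}\nabla f(z)+\nabla_zg(z,s)^\top\mu\\ g(z,s)+d+(\mu_k^*-\mu)/\rho\end{pmatrix}.$$ For all $k$, $0\in G_\rho(w,0,s_k)+\mathcal N_{\mathcal Z\times\mathbb R^m}(w)$ is strongly regular at $w_k^*$, and there are $\delta_B,r_B,q_B>0$ such that for all $k$, $d\in\mathcal B(0,q_B)$ and $s\in\mathcal S\cap\mathcal B(s_k,r_B)$ there is a unique $w^*(d,s)\in\mathcal B(w_k^*,\delta_B)$ with $0\in G_\rho(w^*(d,s),d,s)+\mathcal N_{\mathcal Z\times\mathbb R^m}(w^*(d,s))$; and there is $\lambda_B>0$ such that for all such $k$, $d,d'$, $s,s'$ $$\|w^*(d,s)-w^*(d',s')\|\le\lambda_B\|G_\rho(w^*(d',s'),d,s)-G_\rho(w^*(d',s'),d',s')\|.\tag{B}$$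 3. Let further $\alpha_i>0$, $\delta>0$, $\hat\theta\in(\tfrac12,1)$ be such that for all $\mu\in\mathbb R^m$, $s\in\mathcal S$ there is an exponent $\theta(\mu,s)\in(\tfrac12,1)$, $\theta(\mu,s)\le\hat\theta$, for which $L_\rho(\cdot,\mu,s)+\iota_{\mathcal Z}$ satisfies the Kurdyka–Łojasiewicz inequality with radius $\delta$ at each of its critical points $x^*$ (the points with $0\in\nabla L(x^*)+\mathcal N_{\mathcal Z}(x^*)$, where $L=L_\rho(\cdot,\mu,s)$): for some $c>0$, $$d\big(0,\nabla L(x)+\mathcal N_{\mathcal Z}(x)\big)\ge c\,(L(x)-L(x^*))^{\theta(\mu,s)}\quad\text{for all }x\in\mathcal Z\cap\mathcal B(x^*,\delta)\text{ with }L(x)>L(x^*).$$ Then there is $C>0$ such that for all $\lambda_A,\lambda_B>0$ satisfying (A) and (B), all $M\ge1$, all $k$, and all $\bar w_k$ with $\bar z_k\in\mathcal Z$: if $\bar w_{k+1}$ is produced by the algorithm and $$\|s_{k+1}-s_k\|<\min\Big\{r_A,r_B,\frac{q_B\rho}{\lambda_A\lambda_F}\Big\},\qquad\|\bar w_k-w_k^*\|<q_B\rho,$$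 $$\Big(1+\frac{\lambda_G\lambda_B}{\rho}\Big)\|\bar w_k-w_k^*\|+\lambda_G\lambda_B\|s_{k+1}-s_k\|<\delta,$$ then, with $w_{k+1}^*$ the unique KKT point at $s_{k+1}$ in $\mathcal B(w_k^*,\delta_A)$, $$\|\bar w_{k+1}-w_{k+1}^*\|\le\beta_w(\rho,M)\|\bar w_k-w_k^*\|+\beta_s(\rho,M)\|s_{k+1}-s_k\|,$$ where, with $\psi(\theta)=\frac{1-\theta}{2\theta-1}$, $$\beta_w(\rho,M)=C(1+\rho\lambda_g)\Big(1+\frac{\lambda_B\lambda_G}{\rho}\Big)M^{-\psi(\hat\theta)}+\frac{\lambda_B\lambda_G}{\rho},$$ $$\beta_s(\rho,M)=C(1+\rho\lambda_g)\lambda_B\lambda_GM^{-\psi(\hat\theta)}+\frac{\lambda_B\lambda_G\lambda_A\lambda_F}{\rho}.$$ -/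

import Mathlib

open scoped InnerProductSpace

noncomputable section

/-- The primal space `ℝ^{n_1} × ⋯ × ℝ^{n_P}` with its Euclidean norm. -/
abbrev PrimalSpace {P : ℕ} (n : Fin P → ℕ) : Type :=
  PiLp 2 (fun i : Fin P => EuclideanSpace ℝ (Fin (n i)))

/-- The primal-dual space `ℝ^{n_z} × ℝ^m` with its Euclidean norm. -/
abbrev PrimalDualSpace {P : ℕ} (n : Fin P → ℕ) (m : ℕ) : Type :=
  WithLp 2 (PrimalSpace n × EuclideanSpace ℝ (Fin m))

section General

/-- Semi-algebraic subsets of `ℝ^ι`: the smallest family that contains the sets `{p = 0}` and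
`{p > 0}`, `p` a polynomial, and is closed under finite Boolean operations. -/
inductive IsSemialgebraic {ι : Type} : Set (ι → ℝ) → Prop
  | eq_zero (p : MvPolynomial ι ℝ) : IsSemialgebraic {x | MvPolynomial.eval x p = 0}
  | pos (p : MvPolynomial ι ℝ) : IsSemialgebraic {x | 0 < MvPolynomial.eval x p}
  | inter {A B : Set (ι → ℝ)} : IsSemialgebraic A → IsSemialgebraic B → IsSemialgebraic (A ∩ B)
  | union {A B : Set (ι → ℝ)} : IsSemialgebraic A → IsSemialgebraic B → IsSemialgebraic (A ∪ B)
  | compl {A : Set (ι → ℝ)} : IsSemialgebraic A → IsSemialgebraic Aᶜ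

variable {H : Type} [NormedAddCommGroup H] [InnerProductSpace ℝ H]

/-- The normal cone to `C` at `x` (empty when `x ∉ C`). -/
def normalCone (C : Set H) (x : H) : Set H :=
  {v | x ∈ C ∧ ∀ y ∈ C, ⟪v, y - x⟫_ℝ ≤ 0}

/-- `r ∈ Φ(x) + N_C(x)`. -/
def SolvesGE (Φ : H → H) (C : Set H) (r x : H) : Prop :=
  r - Φ x ∈ normalCone C x

/-- The linearisation of `Φ` at `x₀`. -/
def linearization (Φ : H → H) (x₀ : H) (x : H) : H :=
  Φ x₀ + fderiv ℝ Φ x₀ (x - x₀)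

/-- `x₀` is a solution of `0 ∈ Φ(x) + N_C(x)` at which this generalised equation is strongly
regular (in the sense of Robinson) with radii `η`, `κ` and Lipschitz constant `l` of the inverse
of the linearised generalised equation. -/
structure IsStronglyRegularWith (Φ : H → H) (C : Set H) (x₀ : H) (η κ l : ℝ) : Prop where
  solves : SolvesGE Φ C 0 x₀
  existsUnique : ∀ r : H, ‖r‖ < η →
    ∃! x : H, x ∈ Metric.ball x₀ κ ∧ SolvesGE (linearization Φ x₀) C r x
  lipschitz : ∀ r r' x x' : H, ‖r‖ < η → ‖r'‖ < η →
    x ∈ Metric.ball x₀ κ → x' ∈ Metric.ball x₀ κ →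
    SolvesGE (linearization Φ x₀) C r x → SolvesGE (linearization Φ x₀) C r' x' →
    ‖x - x'‖ ≤ l * ‖r - r'‖

/-- Strong regularity of `0 ∈ Φ(x) + N_C(x)` at the solution `x₀`. -/
def IsStronglyRegular (Φ : H → H) (C : Set H) (x₀ : H) : Prop :=
  ∃ η > 0, ∃ κ > 0, ∃ l : ℝ, IsStronglyRegularWith Φ C x₀ η κ l

variable [CompleteSpace H]

/-- The sub-differential `∇L(x) + N_Z(x)` of `L + ι_Z` at `x`, for `L` smooth and `Z` convex. -/
def constrainedSubdiff (L : H → ℝ) (Z : Set H) (x : H) : Set H :=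
  {u | u - gradient L x ∈ normalCone Z x}

/-- Critical points of `L + ι_Z`. -/
def IsCriticalPt (L : H → ℝ) (Z : Set H) (x : H) : Prop :=
  (0 : H) ∈ constrainedSubdiff L Z x

/-- The Kurdyka-Lojasiewicz inequality for `L + ι_Z` at `x₀`, with exponent `θ`, on the ball of
radius `δ`. -/
def SatisfiesKL (L : H → ℝ) (Z : Set H) (x₀ : H) (δ θ : ℝ) : Prop :=
  ∃ c > 0, ∀ x ∈ Z, dist x x₀ < δ → L x₀ < L x →
    c * (L x - L x₀) ^ θ ≤ Metric.infDist 0 (constrainedSubdiff L Z x)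

end General

section Program

variable {P : ℕ} {n : Fin P → ℕ} {m p : ℕ}

/-- The point `z` with its `i`-th block replaced by `x`. -/
def replaceBlock (z : PrimalSpace n) (i : Fin P) (x : EuclideanSpace ℝ (Fin (n i))) :
    PrimalSpace n :=
  WithLp.toLp 2 (Function.update (WithLp.ofLp z) i x)

/-- Convexity in each block, the other blocks being fixed. -/
def IsMultiConvex (f : PrimalSpace n → ℝ) : Prop :=
  ∀ (z : PrimalSpace n) (i : Fin P), ConvexOn ℝ Set.univ (fun x => f (replaceBlock z i x))

/-- Affinity in each block, the other blocks being fixed. -/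
def IsMultiAffine (g : PrimalSpace n → EuclideanSpace ℝ (Fin m)) : Prop :=
  ∀ (z : PrimalSpace n) (i : Fin P),
    ∃ A : EuclideanSpace ℝ (Fin (n i)) →ᵃ[ℝ] EuclideanSpace ℝ (Fin m),
      ∀ x, g (replaceBlock z i x) = A x

/-- A function is semi-algebraic if its graph (a subset of `ℝ^{n_z} × ℝ`) is. -/
def IsSemialgebraicFun (f : PrimalSpace n → ℝ) : Prop :=
  IsSemialgebraic {x : Option (Σ i : Fin P, Fin (n i)) → ℝ |
    x none = f (WithLp.toLp 2 fun i => WithLp.toLp 2 fun j => x (some ⟨i, j⟩))}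

/-- `𝒵 = 𝒵_1 × ⋯ × 𝒵_P`. -/
def productSet (Z : ∀ i : Fin P, Set (EuclideanSpace ℝ (Fin (n i)))) : Set (PrimalSpace n) :=
  {z | ∀ i, z i ∈ Z i}

/-- `𝒵 × ℝ^m`. -/
def primalDualSet (m : ℕ) (Z : ∀ i : Fin P, Set (EuclideanSpace ℝ (Fin (n i)))) :
    Set (PrimalDualSpace n m) :=
  {w | w.fst ∈ productSet Z}

/-- The primal-dual point `w = (z, μ)`. -/
def pdPoint (z : PrimalSpace n) (μ : EuclideanSpace ℝ (Fin m)) : PrimalDualSpace n m :=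
  WithLp.toLp 2 (z, μ)

variable (f : PrimalSpace n → ℝ)
  (g : PrimalSpace n → EuclideanSpace ℝ (Fin p) → EuclideanSpace ℝ (Fin m))
  (Z : ∀ i : Fin P, Set (EuclideanSpace ℝ (Fin (n i))))

/-- `F(w, s) = (∇f(z) + ∇_z g(z, s)ᵀ μ, g(z, s))`. -/
def kktMap (s : EuclideanSpace ℝ (Fin p)) (w : PrimalDualSpace n m) : PrimalDualSpace n m :=
  pdPoint
    (gradient f w.fst + (fderiv ℝ (fun z => g z s) w.fst).adjoint w.snd)
    (g w.fst s)

/-- `G_ρ(w, d, s) = (∇f(z) + ∇_z g(z, s)ᵀ μ, g(z, s) + d + (μ⋆ - μ) / ρ)`, where `μ⋆` is the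
reference multiplier. -/
def auxMap (ρ : ℝ) (μstar d : EuclideanSpace ℝ (Fin m)) (s : EuclideanSpace ℝ (Fin p))
    (w : PrimalDualSpace n m) : PrimalDualSpace n m :=
  pdPoint
    (gradient f w.fst + (fderiv ℝ (fun z => g z s) w.fst).adjoint w.snd)
    (g w.fst s + d + ρ⁻¹ • (μstar - w.snd))

/-- `w` is a critical (KKT) point of the program at the parameter `s`:
`0 ∈ F(w, s) + N_{𝒵 × ℝ^m}(w)`. -/
def IsKKT (s : EuclideanSpace ℝ (Fin p)) (w : PrimalDualSpace n m) : Prop :=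
  SolvesGE (kktMap f g s) (primalDualSet m Z) 0 w

/-- `0 ∈ G_ρ(w, d, s) + N_{𝒵 × ℝ^m}(w)`. -/
def SolvesAux (ρ : ℝ) (μstar d : EuclideanSpace ℝ (Fin m)) (s : EuclideanSpace ℝ (Fin p))
    (w : PrimalDualSpace n m) : Prop :=
  SolvesGE (auxMap f g ρ μstar d s) (primalDualSet m Z) 0 w

/-- `z₀` minimises `f` over the feasible points of the program at `s` at distance `< ε`. -/
def IsOptimalWithin (s : EuclideanSpace ℝ (Fin p)) (ε : ℝ) (z₀ : PrimalSpace n) : Prop :=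
  ∀ z ∈ productSet Z, g z s = 0 → dist z z₀ < ε → f z₀ ≤ f z

/-- The augmented Lagrangian `L_ρ(z, μ, s)`. -/
def augLagrangian (ρ : ℝ) (μ : EuclideanSpace ℝ (Fin m)) (s : EuclideanSpace ℝ (Fin p))
    (z : PrimalSpace n) : ℝ :=
  f z + ⟪μ + (ρ / 2) • g z s, g z s⟫_ℝ

/-- The point `(z'_1, …, z'_{i-1}, x, z_{i+1}, …, z_P)`. -/
def gaussSeidelPoint (z' z : PrimalSpace n) (i : Fin P) (x : EuclideanSpace ℝ (Fin (n i))) :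
    PrimalSpace n :=
  replaceBlock (WithLp.toLp 2 fun j => if j < i then z' j else z j) i x

/-- `z'` results from `z` by one sweep of proximal alternating minimisations of
`L_ρ(·, μ, s)` over `𝒵_1, …, 𝒵_P`, with regularisation parameters `α_i`. -/
def IsProxSweep (α : Fin P → ℝ) (ρ : ℝ) (μ : EuclideanSpace ℝ (Fin m))
    (s : EuclideanSpace ℝ (Fin p)) (z z' : PrimalSpace n) : Prop :=
  ∀ i, z' i ∈ Z i ∧
    IsMinOn (fun x => augLagrangian f g ρ μ s (gaussSeidelPoint z' z i x)
      + α i / 2 * ‖x - z i‖ ^ 2) (Z i) (z' i)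

/-- One time step of the algorithm: `M` sweeps started at `z`, then one dual update; the output
is `(z', μ')`. -/
def IsAlgorithmStep (α : Fin P → ℝ) (ρ : ℝ) (M : ℕ) (s : EuclideanSpace ℝ (Fin p))
    (z : PrimalSpace n) (μ : EuclideanSpace ℝ (Fin m))
    (z' : PrimalSpace n) (μ' : EuclideanSpace ℝ (Fin m)) : Prop :=
  ∃ ζ : ℕ → PrimalSpace n, ζ 0 = z ∧
    (∀ l < M, IsProxSweep f g Z α ρ μ s (ζ l) (ζ (l + 1))) ∧
    z' = ζ M ∧ μ' = μ + ρ • g z' s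

/-- For all `μ` and all `s ∈ S`, the function `L_ρ(·, μ, s) + ι_𝒵` satisfies the
Kurdyka-Lojasiewicz inequality with radius `δ` at each of its critical points, with an exponent
`θ(μ, s) ∈ (1/2, 1)`, and these exponents are bounded by `θhat`. -/
def UniformKL (S : Set (EuclideanSpace ℝ (Fin p))) (ρ δ θhat : ℝ) : Prop :=
  ∃ θ : EuclideanSpace ℝ (Fin m) → EuclideanSpace ℝ (Fin p) → ℝ, ∀ μ, ∀ s ∈ S,
    1 / 2 < θ μ s ∧ θ μ s < 1 ∧ θ μ s ≤ θhat ∧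
    ∀ z : PrimalSpace n, IsCriticalPt (augLagrangian f g ρ μ s) (productSet Z) z →
      SatisfiesKL (augLagrangian f g ρ μ s) (productSet Z) z δ (θ μ s)

/-- Local existence and uniqueness of KKT points: for every parameter at distance `< r` of
`s_k` there is exactly one KKT point at distance `< δ` of `w⋆_k`. -/
def KKTUnique (S : Set (EuclideanSpace ℝ (Fin p))) (s : ℕ → EuclideanSpace ℝ (Fin p))
    (wstar : ℕ → PrimalDualSpace n m) (δ r : ℝ) : Prop :=
  ∀ k, ∀ s₁ ∈ S, dist s₁ (s k) < r →
    ∃! w, w ∈ Metric.ball (wstar k) δ ∧ IsKKT f g Z s₁ w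

/-- `lam` is a Lipschitz constant associated with the localised KKT points. -/
def KKTLipschitz (S : Set (EuclideanSpace ℝ (Fin p))) (s : ℕ → EuclideanSpace ℝ (Fin p))
    (wstar : ℕ → PrimalDualSpace n m) (δ r lam : ℝ) : Prop :=
  ∀ k, ∀ s₁ ∈ S, ∀ s₂ ∈ S, dist s₁ (s k) < r → dist s₂ (s k) < r →
    ∀ w₁ ∈ Metric.ball (wstar k) δ, ∀ w₂ ∈ Metric.ball (wstar k) δ,
      IsKKT f g Z s₁ w₁ → IsKKT f g Z s₂ w₂ →
      ‖w₁ - w₂‖ ≤ lam * ‖kktMap f g s₁ w₂ - kktMap f g s₂ w₂‖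

/-- Local existence and uniqueness for the auxiliary generalised equation, for perturbations
`‖d‖ < q` and parameters at distance `< r` of `s_k`. -/
def AuxUnique (S : Set (EuclideanSpace ℝ (Fin p))) (s : ℕ → EuclideanSpace ℝ (Fin p))
    (wstar : ℕ → PrimalDualSpace n m) (ρ δ r q : ℝ) : Prop :=
  ∀ k, ∀ d : EuclideanSpace ℝ (Fin m), ‖d‖ < q → ∀ s₁ ∈ S, dist s₁ (s k) < r →
    ∃! w, w ∈ Metric.ball (wstar k) δ ∧ SolvesAux f g Z ρ (wstar k).snd d s₁ w

/-- `lam` is a Lipschitz constant associated with the auxiliary generalised equation. -/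
def AuxLipschitz (S : Set (EuclideanSpace ℝ (Fin p))) (s : ℕ → EuclideanSpace ℝ (Fin p))
    (wstar : ℕ → PrimalDualSpace n m) (ρ δ r q lam : ℝ) : Prop :=
  ∀ k, ∀ d₁ d₂ : EuclideanSpace ℝ (Fin m), ‖d₁‖ < q → ‖d₂‖ < q →
    ∀ s₁ ∈ S, ∀ s₂ ∈ S, dist s₁ (s k) < r → dist s₂ (s k) < r →
    ∀ w₁ ∈ Metric.ball (wstar k) δ, ∀ w₂ ∈ Metric.ball (wstar k) δ,
      SolvesAux f g Z ρ (wstar k).snd d₁ s₁ w₁ → SolvesAux f g Z ρ (wstar k).snd d₂ s₂ w₂ →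
      ‖w₁ - w₂‖ ≤ lam *
        ‖auxMap f g ρ (wstar k).snd d₁ s₁ w₂ - auxMap f g ρ (wstar k).snd d₂ s₂ w₂‖

end Program

/-- `ψ(θ) = (1 - θ) / (2θ - 1)`. -/
def rateExponent (θ : ℝ) : ℝ := (1 - θ) / (2 * θ - 1)

/-- `λ_G = √(max{λ_F², 1} + λ_F)`. -/
def lamG (lamF : ℝ) : ℝ := Real.sqrt (max (lamF ^ 2) 1 + lamF)

/-- `β_w(ρ, M)`. -/
def betaW (C lamg lamB lamF θhat ρ : ℝ) (M : ℕ) : ℝ :=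
  C * (1 + ρ * lamg) * (1 + lamB * lamG lamF / ρ) * (M : ℝ) ^ (-rateExponent θhat)
    + lamB * lamG lamF / ρ

/-- `β_s(ρ, M)`. -/
def betaS (C lamg lamA lamB lamF θhat ρ : ℝ) (M : ℕ) : ℝ :=
  C * (1 + ρ * lamg) * (lamB * lamG lamF) * (M : ℝ) ^ (-rateExponent θhat)
    + lamB * lamG lamF * lamA * lamF / ρ

end

/-! ### Perturbation of strongly regular generalised equations -/

section Robinson

variable {H : Type} [NormedAddCommGroup H] [InnerProductSpace ℝ H]

/-! The Lipschitz bound on `F` in the parameter is required for all multipliers in the unbounded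
space `ℝ^m`, and this is rigid. The first component of `F(w,s) - F(w,s')` is linear in `μ` and
bounded, so `∇_z g(z,s)` does not depend on `s` for `z ∈ 𝒵`, and `g(z,s) - g(z,s')` is constant in
`z ∈ 𝒵` (`IsParametricProgram.fderiv_eq`, `constraint_sub_eq`, `kktMap_eq`). Changing `s`, like
changing `d`, thus only shifts the right-hand side of the generalised equation, while the term
`(μ_k* - μ)/ρ` is a `1/ρ`-Lipschitz perturbation that vanishes at `w_k*`. Robinson's fixed-point
argument handles both and yields (A), (B) and strong regularity for large `ρ`. Its constants are
uniform in `k` because all KKT maps differ by constants from a single `C¹` map, and the `w_k*` stay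
bounded: strong regularity implies a constraint qualification, which bounds the multipliers
(`exists_uniform_stability`).

For the contraction, let `w_i` solve the auxiliary equation at `s_{k+1}` with `d = (μ̄_k - μ_k*)/ρ`.
Its second component says `μ_i = μ̄_k + ρ g(z_i, s_{k+1})`, so `z_i` is critical for the augmented
Lagrangian minimised by the sweeps, and `μ_i` is its dual update. The KKT point `w_{k+1}*` solves
the same equation with `d' = (μ_{k+1}* - μ_k*)/ρ`. The distance from `w̄_{k+1}` to `w_i` is governed
by the inner iteration, and that from `w_i` to `w_{k+1}*` by (B), with the factor `1/ρ` coming from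
`d - d'`.

The inner iteration converges linearly, uniformly in `k`. Strong regularity gives an error bound:
near `z_k*` the distance to `z_i` is at most a constant times the norm of any subgradient
(`exists_error_bound`). This needs the multiplier `μ̄_k + ρ g(z, s_{k+1})` to be close to `μ_k*`,
which follows from near stationarity of `z` (`exists_multiplier_stability`). Local optimality of
`z_k*` gives, for large `ρ`, a sphere on which the augmented Lagrangian is strictly higher than at
`z_k*` (`exists_barrier`); convexity in each block prevents a descending sweep from crossing it.
Sufficient decrease and the error bound then give a geometric rate (`exists_sweep_rate`), which
dominates `M^{-ψ}`. -/

theorem SolvesGE.mem {Φ : H → H} {C : Set H} {r x : H} (h : SolvesGE Φ C r x) : x ∈ C := h.1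

/-- A map that is close, in the Lipschitz sense, to the linearisation shifts the right-hand side
of the linearised generalised equation. -/
theorem SolvesGE.to_linearization {Φ Ψ : H → H} {C : Set H} {x₀ r x : H}
    (h : SolvesGE Ψ C r x) :
    SolvesGE (linearization Φ x₀) C (r - (Ψ x - linearization Φ x₀ x)) x := by
  unfold SolvesGE at *
  convert h using 1
  abel

theorem SolvesGE.of_linearization {Φ Ψ : H → H} {C : Set H} {x₀ r x : H}
    (h : SolvesGE (linearization Φ x₀) C (r - (Ψ x - linearization Φ x₀ x)) x) :
    SolvesGE Ψ C r x := by
  unfold SolvesGE at *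
  convert h using 1
  abel

theorem linearization_self (Φ : H → H) (x₀ : H) : linearization Φ x₀ x₀ = Φ x₀ := by
  simp [linearization]

theorem IsStronglyRegularWith.solves_linearization {Φ : H → H} {C : Set H} {x₀ : H} {η κ l : ℝ}
    (h : IsStronglyRegularWith Φ C x₀ η κ l) : SolvesGE (linearization Φ x₀) C 0 x₀ := by
  have := h.solves
  unfold SolvesGE at *
  rwa [linearization_self]

/-- `Ψ` differs from the linearisation of `Φ` at `x₀` by an `ε`-Lipschitz map near `x₀`. -/
structure IsCloseToLinearization (Φ Ψ : H → H) (C : Set H) (x₀ : H) (ε δ : ℝ) : Prop where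
  apply_self : Ψ x₀ = Φ x₀
  lipschitz : ∀ x ∈ C, ∀ x' ∈ C, ‖x - x₀‖ < δ → ‖x' - x₀‖ < δ →
    ‖(Ψ x - linearization Φ x₀ x) - (Ψ x' - linearization Φ x₀ x')‖ ≤ ε * ‖x - x'‖

variable {Φ Ψ : H → H} {C : Set H} {x₀ : H} {η κ l ε δ σ L : ℝ}

theorem IsCloseToLinearization.norm_le (hΨ : IsCloseToLinearization Φ Ψ C x₀ ε δ)
    (hx₀ : x₀ ∈ C) (hδ : 0 < δ) {x : H} (hx : x ∈ C) (hxδ : ‖x - x₀‖ < δ) :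
    ‖Ψ x - linearization Φ x₀ x‖ ≤ ε * ‖x - x₀‖ := by
  have := hΨ.lipschitz x hx x₀ hx₀ hxδ (by simpa using hδ)
  rwa [linearization_self, hΨ.apply_self, sub_self, sub_zero] at this

/-- Lipschitz dependence of the localised solutions on the right-hand side. -/
theorem IsStronglyRegularWith.lipschitz_of_close (h : IsStronglyRegularWith Φ C x₀ η κ l)
    (hΨ : IsCloseToLinearization Φ Ψ C x₀ ε δ) (hL : 0 < L) (hlL : l ≤ L) (hε : 0 ≤ ε)
    (hLε : L * ε ≤ 1 / 2) (hδ : 0 < δ) (hδκ : δ ≤ κ) (hση : ε * δ + σ ≤ η)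
    {r r' x x' : H} (hr : ‖r‖ < σ) (hr' : ‖r'‖ < σ) (hx : ‖x - x₀‖ < δ) (hx' : ‖x' - x₀‖ < δ)
    (hs : SolvesGE Ψ C r x) (hs' : SolvesGE Ψ C r' x') : ‖x - x'‖ ≤ 2 * L * ‖r - r'‖ := by
  have key : ∀ {r x : H}, ‖r‖ < σ → ‖x - x₀‖ < δ → SolvesGE Ψ C r x →
      ‖r - (Ψ x - linearization Φ x₀ x)‖ < η := by
    intro r x hr hx hs
    have h1 := hΨ.norm_le h.solves.mem hδ hs.mem hx
    have h2 : ε * ‖x - x₀‖ ≤ ε * δ := by gcongr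
    linarith [norm_sub_le r (Ψ x - linearization Φ x₀ x)]
  have h1 := h.lipschitz _ _ x x' (key hr hx hs) (key hr' hx' hs')
    (by rw [mem_ball_iff_norm]; linarith) (by rw [mem_ball_iff_norm]; linarith)
    hs.to_linearization hs'.to_linearization
  have h2 := hΨ.lipschitz x hs.mem x' hs'.mem hx hx'
  have h3 : ‖(r - (Ψ x - linearization Φ x₀ x)) - (r' - (Ψ x' - linearization Φ x₀ x'))‖
      ≤ ‖r - r'‖ + ε * ‖x - x'‖ := by
    calc _ = ‖(r - r') - ((Ψ x - linearization Φ x₀ x) - (Ψ x' - linearization Φ x₀ x'))‖ := by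
          congr 1; abel
      _ ≤ _ := (norm_sub_le _ _).trans (by gcongr)
  -- Since `L * ε ≤ 1 / 2`, half of the left-hand side absorbs the second term; hence the constant
  -- `2 * L`.
  have h4 : ‖x - x'‖ ≤ L * (‖r - r'‖ + ε * ‖x - x'‖) :=
    h1.trans ((mul_le_mul_of_nonneg_right hlL (norm_nonneg _)).trans (by gcongr))
  nlinarith [norm_nonneg (x - x')]

/-- Existence of localised solutions. -/
theorem IsStronglyRegularWith.exists_of_close [CompleteSpace H]
    (h : IsStronglyRegularWith Φ C x₀ η κ l) (hC : IsClosed C)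
    (hΨ : IsCloseToLinearization Φ Ψ C x₀ ε δ) (hL : 0 < L) (hlL : l ≤ L) (hε : 0 ≤ ε)
    (hLε : L * ε ≤ 1 / 2) (hδ : 0 < δ) (hδκ : δ ≤ κ) (hση : ε * δ + σ ≤ η)
    (hLσ : L * σ ≤ δ / 4) {r : H} (hr : ‖r‖ < σ) :
    ∃ x, ‖x - x₀‖ < δ ∧ SolvesGE Ψ C r x := by
  -- The closed ball of half the radius makes `K` complete and keeps the fixed point in the open
  -- ball of radius `δ`.
  set K : Set H := C ∩ Metric.closedBall x₀ (δ / 2) with hK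
  have hlt : ∀ x ∈ K, ‖x - x₀‖ < δ := fun x hx => by
    have := mem_closedBall_iff_norm.1 hx.2; linarith
  have hsmall : ∀ x ∈ K, ‖r - (Ψ x - linearization Φ x₀ x)‖ < η := by
    intro x hx
    have h1 := hΨ.norm_le h.solves.mem hδ hx.1 (hlt x hx)
    have h2 : ε * ‖x - x₀‖ ≤ ε * δ := mul_le_mul_of_nonneg_left (hlt x hx).le hε
    linarith [norm_sub_le r (Ψ x - linearization Φ x₀ x)]
  have hη : 0 < η := by nlinarith [norm_nonneg r]
  -- `T x` solves the linearised equation with right-hand side `r - (Ψ x - linearization Φ x₀ x)`,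
  -- so a fixed point of `T` solves the equation for `Ψ`. It is a self-map of `K` because `L‖r‖ ≤
  -- δ/4` and `L ε δ/2 ≤ δ/4`.
  choose! T hT using fun x (hx : x ∈ K) => (h.existsUnique _ (hsmall x hx)).exists
  have hTmaps : Set.MapsTo T K K := by
    intro x hx
    refine ⟨(hT x hx).2.mem, ?_⟩
    have h1 := h.lipschitz _ 0 (T x) x₀ (hsmall x hx) (by simpa using hη) (hT x hx).1
      (Metric.mem_ball_self (hδ.trans_le hδκ)) (hT x hx).2 h.solves_linearization
    have h2 := hΨ.norm_le h.solves.mem hδ hx.1 (hlt x hx)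
    have h3 := mem_closedBall_iff_norm.1 hx.2
    have h4 : ‖r - (Ψ x - linearization Φ x₀ x) - 0‖ ≤ ‖r‖ + ε * (δ / 2) := by
      rw [sub_zero]
      refine (norm_sub_le _ _).trans ?_
      gcongr
      exact h2.trans (by gcongr)
    rw [mem_closedBall_iff_norm]
    have h5 : ‖T x - x₀‖ ≤ L * (‖r‖ + ε * (δ / 2)) :=
      h1.trans ((mul_le_mul_of_nonneg_right hlL (norm_nonneg _)).trans (by gcongr))
    nlinarith
  have hcontr : ContractingWith (1 / 2) (hTmaps.restrict T K K) := by
    refine ⟨by norm_num, LipschitzWith.of_dist_le_mul fun x y => ?_⟩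
    rw [Subtype.dist_eq, Subtype.dist_eq, dist_eq_norm, dist_eq_norm]
    simp only [Set.MapsTo.val_restrict_apply]
    have h1 := h.lipschitz _ _ _ _ (hsmall x x.2) (hsmall y y.2) (hT x x.2).1 (hT y y.2).1
      (hT x x.2).2 (hT y y.2).2
    have h2 := hΨ.lipschitz y y.2.1 x x.2.1 (hlt y y.2) (hlt x x.2)
    have h3 : (r - (Ψ x - linearization Φ x₀ x)) - (r - (Ψ y - linearization Φ x₀ y))
        = (Ψ y - linearization Φ x₀ y) - (Ψ x - linearization Φ x₀ x) := by abel
    rw [h3] at h1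
    rw [norm_sub_rev (y : H)] at h2
    have h4 : ‖T x - T y‖ ≤ L * (ε * ‖(x : H) - y‖) :=
      h1.trans ((mul_le_mul_of_nonneg_right hlL (norm_nonneg _)).trans (by gcongr))
    push_cast
    nlinarith [norm_nonneg ((x : H) - y)]
  have hKc : IsComplete K := (hC.inter Metric.isClosed_closedBall).isComplete
  have hx₀K : x₀ ∈ K := ⟨h.solves.mem, Metric.mem_closedBall_self (by linarith)⟩
  obtain ⟨x, hxK, hfix, -⟩ := ContractingWith.exists_fixedPoint' hKc hTmaps hcontr hx₀K
    (edist_ne_top _ _)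
  refine ⟨x, hlt x hxK, SolvesGE.of_linearization (Φ := Φ) (x₀ := x₀) ?_⟩
  have := (hT x hxK).2
  rwa [hfix] at this

theorem IsStronglyRegularWith.existsUnique_of_close [CompleteSpace H]
    (h : IsStronglyRegularWith Φ C x₀ η κ l) (hC : IsClosed C)
    (hΨ : IsCloseToLinearization Φ Ψ C x₀ ε δ) (hL : 0 < L) (hlL : l ≤ L) (hε : 0 ≤ ε)
    (hLε : L * ε ≤ 1 / 2) (hδ : 0 < δ) (hδκ : δ ≤ κ) (hση : ε * δ + σ ≤ η)
    (hLσ : L * σ ≤ δ / 4) {r : H} (hr : ‖r‖ < σ) :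
    ∃! x, x ∈ Metric.ball x₀ δ ∧ SolvesGE Ψ C r x := by
  obtain ⟨x, hx, hs⟩ := h.exists_of_close hC hΨ hL hlL hε hLε hδ hδκ hση hLσ hr
  refine ⟨x, ⟨mem_ball_iff_norm.2 hx, hs⟩, fun y hy => ?_⟩
  have := h.lipschitz_of_close hΨ hL hlL hε hLε hδ hδκ hση hr hr (mem_ball_iff_norm.1 hy.1) hx
    hy.2 hs
  simpa [sub_eq_zero] using this

end Robinson

/-! ### Normal cones and norms of the product space -/

section ProductCone

variable {E V : Type} [NormedAddCommGroup E] [InnerProductSpace ℝ E]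
  [NormedAddCommGroup V] [InnerProductSpace ℝ V]

/-- The multiplier is unconstrained, so only the zero vector is normal in its direction; the second
component of a generalised equation thereby becomes an equation. -/
theorem mem_normalCone_prod_iff {Z : Set E} {w v : WithLp 2 (E × V)} :
    v ∈ normalCone {w : WithLp 2 (E × V) | w.fst ∈ Z} w ↔
      v.fst ∈ normalCone Z w.fst ∧ v.snd = 0 := by
  simp only [normalCone, Set.mem_ofPred_eq, WithLp.prod_inner_apply]
  constructor
  · rintro ⟨hw, h⟩
    refine ⟨⟨hw, fun y hy => ?_⟩, ?_⟩
    · simpa using h (WithLp.toLp 2 (y, w.snd)) hy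
    · have := h (WithLp.toLp 2 (w.fst, w.snd + v.snd)) hw
      simpa using this
  · rintro ⟨⟨hw, h⟩, hv⟩
    refine ⟨hw, fun y hy => ?_⟩
    have h1 := h _ hy
    change ⟪v.fst, y.fst - w.fst⟫_ℝ + ⟪v.snd, y.snd - w.snd⟫_ℝ ≤ 0
    rw [hv, inner_zero_left, add_zero]
    exact h1

end ProductCone

section ProductNorm

variable {E V : Type} [NormedAddCommGroup E] [NormedAddCommGroup V]

theorem WithLp.norm_fst_le_norm (w : WithLp 2 (E × V)) : ‖w.fst‖ ≤ ‖w‖ := by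
  rw [WithLp.prod_norm_eq_of_L2]
  exact Real.le_sqrt_of_sq_le (by nlinarith [sq_nonneg ‖w.snd‖])

theorem WithLp.norm_snd_le_norm (w : WithLp 2 (E × V)) : ‖w.snd‖ ≤ ‖w‖ := by
  rw [WithLp.prod_norm_eq_of_L2]
  exact Real.le_sqrt_of_sq_le (by nlinarith [sq_nonneg ‖w.fst‖])

theorem WithLp.norm_le_norm_fst_add_norm_snd (w : WithLp 2 (E × V)) :
    ‖w‖ ≤ ‖w.fst‖ + ‖w.snd‖ := by
  rw [WithLp.prod_norm_eq_of_L2]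
  exact Real.sqrt_le_iff.2 ⟨by positivity, by
    nlinarith [mul_nonneg (norm_nonneg w.fst) (norm_nonneg w.snd)]⟩

theorem WithLp.norm_toLp_zero_left (v : V) : ‖(WithLp.toLp 2 ((0 : E), v))‖ = ‖v‖ := by
  rw [WithLp.prod_norm_eq_of_L2]; simp

end ProductNorm

/-! ### First-order estimates on convex sets -/

section QuadraticRemainder

variable {E W : Type} [NormedAddCommGroup E] [NormedSpace ℝ E] [NormedAddCommGroup W]
  [NormedSpace ℝ W]

theorem norm_image_sub_le_of_hasFDerivAt_bound {𝒵 : Set E} (hconv : Convex ℝ 𝒵) {F : E → W}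
    {A : E → E →L[ℝ] W} {K : ℝ} (hF : ∀ z ∈ 𝒵, HasFDerivAt F (A z) z)
    (hA : ∀ z ∈ 𝒵, ‖A z‖ ≤ K) {z z' : E} (hz : z ∈ 𝒵) (hz' : z' ∈ 𝒵) :
    ‖F z - F z'‖ ≤ K * ‖z - z'‖ :=
  hconv.norm_image_sub_le_of_norm_hasFDerivWithin_le
    (fun x hx => (hF x hx).hasFDerivWithinAt) hA hz' hz

theorem norm_image_sub_sub_le_of_hasFDerivAt_lipschitz {𝒵 : Set E} (hconv : Convex ℝ 𝒵)
    {F : E → W} {A : E → E →L[ℝ] W} {K : ℝ} (hK : 0 ≤ K)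
    (hF : ∀ z ∈ 𝒵, HasFDerivAt F (A z) z)
    (hA : ∀ z ∈ 𝒵, ∀ z' ∈ 𝒵, ‖A z - A z'‖ ≤ K * ‖z - z'‖) {z z' : E} (hz : z ∈ 𝒵)
    (hz' : z' ∈ 𝒵) : ‖F z' - F z - A z (z' - z)‖ ≤ K * ‖z' - z‖ ^ 2 := by
  have hseg : segment ℝ z z' ⊆ 𝒵 := hconv.segment_subset hz hz'
  have := (convex_segment z z').norm_image_sub_le_of_norm_hasFDerivWithin_le'
    (f := F) (f' := A) (φ := A z) (C := K * ‖z' - z‖)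
    (fun x hx => (hF x (hseg hx)).hasFDerivWithinAt)
    (fun x hx => (hA x (hseg hx) z hz).trans (by
      gcongr
      obtain ⟨a, b, ha, hb, hab, rfl⟩ := hx
      have : a • z + b • z' - z = b • (z' - z) := by
        rw [← eq_sub_iff_add_eq] at hab
        rw [hab]; module
      rw [this, norm_smul, Real.norm_eq_abs, abs_of_nonneg hb]
      exact mul_le_of_le_one_left (norm_nonneg _) (by linarith)))
    (left_mem_segment ℝ z z') (right_mem_segment ℝ z z')
  rwa [mul_assoc, ← pow_two] at this

end QuadraticRemainder

section GradientFacts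

variable {E : Type} [NormedAddCommGroup E] [InnerProductSpace ℝ E] [CompleteSpace E]

theorem abs_sub_sub_inner_le_of_gradient_lipschitz {𝒵 : Set E} (hconv : Convex ℝ 𝒵)
    {f : E → ℝ} {G : E → E} {K : ℝ} (hK : 0 ≤ K) (hf : ∀ z ∈ 𝒵, HasGradientAt f (G z) z)
    (hG : ∀ z ∈ 𝒵, ∀ z' ∈ 𝒵, ‖G z - G z'‖ ≤ K * ‖z - z'‖) {z z' : E} (hz : z ∈ 𝒵)
    (hz' : z' ∈ 𝒵) : |f z' - f z - ⟪G z, z' - z⟫_ℝ| ≤ K * ‖z' - z‖ ^ 2 := by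
  have := norm_image_sub_sub_le_of_hasFDerivAt_lipschitz hconv hK
    (F := f) (A := fun z => InnerProductSpace.toDual ℝ E (G z))
    (fun z hz => (hf z hz).hasFDerivAt)
    (fun z hz z' hz' => by
      rw [← map_sub, LinearIsometryEquiv.norm_map]; exact hG z hz z' hz') hz hz'
  simpa using this

theorem abs_sub_le_of_gradient_bound {𝒵 : Set E} (hconv : Convex ℝ 𝒵)
    {f : E → ℝ} {G : E → E} {K : ℝ} (hf : ∀ z ∈ 𝒵, HasGradientAt f (G z) z)
    (hG : ∀ z ∈ 𝒵, ‖G z‖ ≤ K) {z z' : E} (hz : z ∈ 𝒵)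
    (hz' : z' ∈ 𝒵) : |f z - f z'| ≤ K * ‖z - z'‖ := by
  have := norm_image_sub_le_of_hasFDerivAt_bound hconv
    (F := f) (A := fun z => InnerProductSpace.toDual ℝ E (G z))
    (fun z hz => (hf z hz).hasFDerivAt)
    (fun z hz => by rw [LinearIsometryEquiv.norm_map]; exact hG z hz) hz hz'
  simpa using this

/-- First-order optimality at a minimiser over the part of a convex set in a ball, if it lies in
the interior of the ball. -/
theorem neg_gradient_mem_normalCone {𝒵 : Set E} (hconv : Convex ℝ 𝒵) {φ : E → ℝ} {G x zs : E}
    {R : ℝ} (hφ : HasGradientAt φ G x) (hx : x ∈ 𝒵) (hxR : ‖x - zs‖ < R)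
    (hmin : IsMinOn φ (𝒵 ∩ Metric.closedBall zs R) x) : -G ∈ normalCone 𝒵 x := by
  refine ⟨hx, fun y hy => ?_⟩
  have hloc : IsLocalMinOn φ 𝒵 x := by
    have hb : Metric.ball zs R ∈ nhds x :=
      Metric.isOpen_ball.mem_nhds (mem_ball_iff_norm.2 hxR)
    filter_upwards [self_mem_nhdsWithin, mem_nhdsWithin_of_mem_nhds hb] with y hy hyb
    exact hmin ⟨hy, Metric.ball_subset_closedBall hyb⟩
  have h := hloc.hasFDerivWithinAt_nonneg hφ.hasFDerivAt.hasFDerivWithinAt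
    (sub_mem_posTangentConeAt_of_segment_subset (hconv.segment_subset hx hy))
  rw [InnerProductSpace.toDual_apply_apply] at h
  rw [inner_neg_left]
  linarith

end GradientFacts

/-! ### Projections of interpolated normals -/

section Projection

variable {E : Type} [NormedAddCommGroup E] [InnerProductSpace ℝ E] {𝒵 : Set E}

/-- The projection `x` of the point `(1 - t) (z + n) + t (z' + n')`, for normals `n` at `z` and
`n'` at `z'`, is close to `z` when `z'` is. -/
theorem exists_interpolated_normal (hconv : Convex ℝ 𝒵) (hcomp : IsCompact 𝒵) {z z' n n' : E}
    (hn : n ∈ normalCone 𝒵 z) (hn' : n' ∈ normalCone 𝒵 z') {t : ℝ} (ht : 0 < t) (ht1 : t < 1) :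
    ∃ x ∈ 𝒵, ((1 - t) • (z + n) + t • (z' + n')) - x ∈ normalCone 𝒵 x ∧
      ‖x - z‖ ^ 2 ≤ t * (‖z' - z‖ + ‖n' - n‖) * ‖z' - z‖ := by
  set p : E := (1 - t) • (z + n) + t • (z' + n') with hp
  obtain ⟨x, hx, hxp⟩ := exists_norm_eq_iInf_of_complete_convex ⟨z, hn.1⟩
    hcomp.isComplete hconv p
  have hN := (norm_eq_iInf_iff_real_inner_le_zero hconv hx).1 hxp
  refine ⟨x, hx, ⟨hx, hN⟩, ?_⟩
  set D : E := (z' + n') - (z + n) with hD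
  -- `z` is the projection of `z + n` and `x` that of `z + n + t • D`; this is firm
  -- nonexpansiveness.
  have h1 : ‖x - z‖ ^ 2 ≤ t * ⟪D, x - z⟫_ℝ := by
    have a1 := hN z hn.1
    have a2 := hn.2 x hx
    have e : p - x = t • D + n - (x - z) := by rw [hp, hD]; module
    rw [e, ← neg_sub x z, inner_neg_right, inner_sub_left, inner_add_left, inner_smul_left,
      real_inner_self_eq_norm_sq] at a1
    simp only [conj_trivial] at a1
    linarith
  -- `z'` is the projection of `p + (1 - t) • D`, so monotonicity of the projection gives the sign.
  -- It lets `z' - z` replace `x - z` below: the final bound contains `n' - n` only through `t * ‖n'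
  -- - n‖`, which stays moderate for large `n'` and small `t`.
  have h2 : 0 ≤ ⟪D, z' - x⟫_ℝ := by
    have a1 := hN z' hn'.1
    have a2 := hn'.2 x hx
    have e : p - x = (z' - x) + n' - (1 - t) • D := by rw [hp, hD]; module
    rw [e, inner_sub_left, inner_add_left, inner_smul_left, real_inner_self_eq_norm_sq] at a1
    simp only [conj_trivial] at a1
    rw [← neg_sub z' x, inner_neg_right] at a2
    have : 0 ≤ (1 - t) * ⟪D, z' - x⟫_ℝ := by nlinarith [sq_nonneg ‖z' - x‖]
    exact nonneg_of_mul_nonneg_right this (by linarith)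
  have h3 : ⟪D, x - z⟫_ℝ ≤ ⟪D, z' - z⟫_ℝ := by
    have : z' - z = (z' - x) + (x - z) := by abel
    rw [this, inner_add_right]; linarith
  have h4 : ‖D‖ ≤ ‖z' - z‖ + ‖n' - n‖ := by
    have : D = (z' - z) + (n' - n) := by rw [hD]; abel
    rw [this]; exact norm_add_le _ _
  calc ‖x - z‖ ^ 2 ≤ t * ⟪D, x - z⟫_ℝ := h1
    _ ≤ t * (‖D‖ * ‖z' - z‖) := by
        gcongr; exact h3.trans (real_inner_le_norm _ _)
    _ ≤ t * ((‖z' - z‖ + ‖n' - n‖) * ‖z' - z‖) := by gcongr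
    _ = _ := by ring

end Projection

/-! ### Abstract problem data and stable points -/

section Tracking

variable {E V : Type} [NormedAddCommGroup E] [InnerProductSpace ℝ E] [CompleteSpace E]
  [NormedAddCommGroup V] [InnerProductSpace ℝ V] [CompleteSpace V]

/-- Uniform bounds on the gradient `Gf` of the objective `f` and on the derivative `A` of the
constraint map over the constraint set `𝒵`. -/
structure ProblemBounds (𝒵 : Set E) (f : E → ℝ) (Gf : E → E) (A : E → E →L[ℝ] V) (K : ℝ) :
    Prop where
  convex : Convex ℝ 𝒵
  compact : IsCompact 𝒵
  one_le : 1 ≤ K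
  diam : ∀ z ∈ 𝒵, ∀ z' ∈ 𝒵, ‖z - z'‖ ≤ K
  hasGradient : ∀ z ∈ 𝒵, HasGradientAt f (Gf z) z
  gradient_le : ∀ z ∈ 𝒵, ‖Gf z‖ ≤ K
  gradient_lip : ∀ z ∈ 𝒵, ∀ z' ∈ 𝒵, ‖Gf z - Gf z'‖ ≤ K * ‖z - z'‖
  deriv_le : ∀ z ∈ 𝒵, ‖A z‖ ≤ K
  deriv_lip : ∀ z ∈ 𝒵, ∀ z' ∈ 𝒵, ‖A z - A z'‖ ≤ K * ‖z - z'‖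

/-- `u ∈ ∇f(z) + A(z)ᵀ μ + N_𝒵(z)`. -/
def IsLagrangeStationary (𝒵 : Set E) (Gf : E → E) (A : E → E →L[ℝ] V) (z : E) (μ : V) (u : E) : Prop :=
  u - (Gf z + (A z).adjoint μ) ∈ normalCone 𝒵 z

/-- The primal-dual pair `(zs, μs)` is stationary for the constraint `g = 0`, satisfies a
constraint qualification with radius `η`, and the (regularised) stationarity system is Lipschitz
stable near it. -/
structure IsStablePoint (𝒵 : Set E) (Gf : E → E) (A : E → E →L[ℝ] V) (K η L δ σ τ₀ : ℝ)
    (g : E → V) (zs : E) (μs : V) : Prop where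
  hasFDeriv : ∀ z ∈ 𝒵, HasFDerivAt g (A z) z
  feasible : g zs = 0
  stationary : IsLagrangeStationary 𝒵 Gf A zs μs 0
  multiplier_le : ‖μs‖ ≤ K
  qualification : ∀ r : V, ‖r‖ < η → ∃ z ∈ 𝒵, A zs (z - zs) = r
  stable : ∀ τ, 0 ≤ τ → τ ≤ τ₀ → ∀ (z z' : E) (μ μ' : V) (u u' : E),
    ‖z - zs‖ < δ → ‖μ - μs‖ < δ → ‖z' - zs‖ < δ → ‖μ' - μs‖ < δ →
    IsLagrangeStationary 𝒵 Gf A z μ u → IsLagrangeStationary 𝒵 Gf A z' μ' u' →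
    ‖u‖ < σ → ‖u'‖ < σ → ‖g z + τ • (μs - μ)‖ < σ → ‖g z' + τ • (μs - μ')‖ < σ →
    ‖z - z'‖ ≤ L * (‖u - u'‖ + ‖(g z + τ • (μs - μ)) - (g z' + τ • (μs - μ'))‖) ∧
    ‖μ - μ'‖ ≤ L * (‖u - u'‖ + ‖(g z + τ • (μs - μ)) - (g z' + τ • (μs - μ'))‖)

variable {𝒵 : Set E} {f : E → ℝ} {Gf : E → E} {A : E → E →L[ℝ] V} {K η L δ σ τ₀ : ℝ}
  {g : E → V} {zs : E} {μs : V}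

theorem IsLagrangeStationary.mem {z : E} {μ : V} {u : E} (h : IsLagrangeStationary 𝒵 Gf A z μ u) : z ∈ 𝒵 := h.1

theorem IsStablePoint.mem (h : IsStablePoint 𝒵 Gf A K η L δ σ τ₀ g zs μs) : zs ∈ 𝒵 :=
  h.stationary.mem

theorem IsStablePoint.norm_image_sub_le (h : IsStablePoint 𝒵 Gf A K η L δ σ τ₀ g zs μs)
    (hB : ProblemBounds 𝒵 f Gf A K) {z z' : E} (hz : z ∈ 𝒵) (hz' : z' ∈ 𝒵) :
    ‖g z - g z'‖ ≤ K * ‖z - z'‖ :=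
  norm_image_sub_le_of_hasFDerivAt_bound hB.convex h.hasFDeriv hB.deriv_le hz hz'

theorem IsStablePoint.norm_image_le (h : IsStablePoint 𝒵 Gf A K η L δ σ τ₀ g zs μs)
    (hB : ProblemBounds 𝒵 f Gf A K) {z : E} (hz : z ∈ 𝒵) : ‖g z‖ ≤ K * ‖z - zs‖ := by
  have := h.norm_image_sub_le hB hz h.mem
  rwa [h.feasible, sub_zero] at this

end Tracking

/-! ### Multipliers of nearly stationary points -/

section MultiplierStability

variable {E V : Type} [NormedAddCommGroup E] [InnerProductSpace ℝ E] [CompleteSpace E]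
  [NormedAddCommGroup V] [InnerProductSpace ℝ V] [CompleteSpace V]

set_option maxHeartbeats 600000 in
/-- The multiplier of a stationary pair whose primal part and residual are small enough is at
distance at most `δ'` of `μs`. -/
theorem IsStablePoint.norm_multiplier_sub_le {𝒵 : Set E} {f : E → ℝ} {Gf : E → E}
    {A : E → E →L[ℝ] V} {K η L δ σ τ₀ : ℝ} {g : E → V} {zs : E} {μs : V}
    (h : IsStablePoint 𝒵 Gf A K η L δ σ τ₀ g zs μs)
    (hB : ProblemBounds 𝒵 f Gf A K) (hτ₀ : 0 ≤ τ₀) {δ' d e u₀ : ℝ} (hδ' : 0 < δ') (hδ1 : δ' ≤ 1)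
    (hδ'δ : δ' < δ) (hL : 0 ≤ L) (hde : d ≤ e) (hd1 : d ≤ 1) (hu1 : u₀ ≤ 1)
    (he2 : 6 * K ^ 2 * d ≤ e ^ 2) (heδ : e < δ) (hσ : 9 * K ^ 2 * e + u₀ < σ)
    (hL' : L * (10 * K ^ 2 * e + u₀) < δ') {z u : E} {μ : V}
    (hzd : ‖z - zs‖ ≤ d) (hu : ‖u‖ ≤ u₀) (hst : IsLagrangeStationary 𝒵 Gf A z μ u) :
    ‖μ - μs‖ ≤ δ' := by
  by_contra! hcon
  have hK := hB.one_le
  have hz := hst.mem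
  have hzs := h.mem
  have hd0 : 0 ≤ d := (norm_nonneg _).trans hzd
  have he0 : 0 ≤ e := hd0.trans hde
  have hu0 : 0 ≤ u₀ := (norm_nonneg _).trans hu
  have hμpos : 0 < ‖μ - μs‖ := hδ'.trans hcon
  -- A distant multiplier is pulled back along the segment to distance exactly `δ'` from `μs`, where
  -- the stability estimate applies; the primal point has to be moved along by a projection.
  set t : ℝ := δ' / ‖μ - μs‖ with ht
  have ht0 : 0 < t := by positivity
  have ht1 : t < 1 := (div_lt_one hμpos).2 hcon
  have htμ : t * ‖μ - μs‖ = δ' := by rw [ht]; field_simp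
  have hKK : K ≤ K ^ 2 := by nlinarith
  have hadj : ∀ (B : E →L[ℝ] V) (ν : V) (b c : ℝ), ‖B‖ ≤ b → ‖ν‖ ≤ c → 0 ≤ c →
      ‖B.adjoint ν‖ ≤ b * c := by
    intro B ν b c hb hc hc0
    calc ‖B.adjoint ν‖ ≤ ‖B.adjoint‖ * ‖ν‖ := B.adjoint.le_opNorm ν
      _ = ‖B‖ * ‖ν‖ := by rw [LinearIsometryEquiv.norm_map]
      _ ≤ b * c := by gcongr; exact (norm_nonneg _).trans hb
  set ns : E := 0 - (Gf zs + (A zs).adjoint μs) with hns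
  set n : E := u - (Gf z + (A z).adjoint μ) with hn
  obtain ⟨x, hx, hxN, hxd⟩ := exists_interpolated_normal hB.convex hB.compact h.stationary hst
    ht0 ht1
  -- the interpolated normals stay bounded
  have hnn : t * ‖n - ns‖ ≤ 4 * K ^ 2 := by
    have e1 : n - ns = u - (Gf z - Gf zs) - (A z).adjoint (μ - μs)
        - (A z - A zs).adjoint μs := by
      rw [hn, hns]; simp only [map_sub, sub_apply]; abel
    have b1 : ‖Gf z - Gf zs‖ ≤ K := (hB.gradient_lip z hz zs hzs).trans (by nlinarith)
    have b2 : ‖(A z).adjoint (μ - μs)‖ ≤ K * ‖μ - μs‖ :=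
      hadj _ _ _ _ (hB.deriv_le z hz) le_rfl (norm_nonneg _)
    have b3 : ‖(A z - A zs).adjoint μs‖ ≤ K * K :=
      hadj _ _ _ _ ((hB.deriv_lip z hz zs hzs).trans (by nlinarith)) h.multiplier_le (by linarith)
    have b4 : ‖n - ns‖ ≤ 1 + K + K * ‖μ - μs‖ + K * K := by
      rw [e1]
      refine (norm_sub_le _ _).trans (add_le_add ((norm_sub_le _ _).trans
        (add_le_add ((norm_sub_le _ _).trans (add_le_add (hu.trans hu1) b1)) b2)) b3)
    calc t * ‖n - ns‖ ≤ t * (1 + K + K * ‖μ - μs‖ + K * K) := by gcongr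
      _ = t * (1 + K + K * K) + K * (t * ‖μ - μs‖) := by ring
      _ ≤ 1 * (1 + K + K * K) + K * 1 := by rw [htμ]; gcongr
      _ ≤ 4 * K ^ 2 := by nlinarith
  -- The projection estimate is quadratic on the left and linear in `d` on the right, so the primal
  -- displacement is of order `√d`.
  have hxe : ‖x - zs‖ ≤ e := by
    apply le_of_sq_le_sq _ he0
    calc ‖x - zs‖ ^ 2 ≤ t * (‖z - zs‖ + ‖n - ns‖) * ‖z - zs‖ := hxd
      _ = (t * ‖z - zs‖ + t * ‖n - ns‖) * ‖z - zs‖ := by ring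
      _ ≤ (1 * 1 + 4 * K ^ 2) * d := by gcongr; linarith
      _ ≤ 6 * K ^ 2 * d := by nlinarith
      _ ≤ e ^ 2 := he2
  -- the interpolated multiplier
  set ν : V := μs + t • (μ - μs) with hν
  have hνμ : ‖ν - μs‖ = δ' := by
    rw [hν, add_sub_cancel_left, norm_smul, Real.norm_eq_abs, abs_of_pos ht0, htμ]
  -- The residual that makes `(x, ν)` stationary: the projection leaves the interpolated point minus
  -- `x` as a normal at `x`.
  set r : E := ((1 - t) • (zs + ns) + t • (z + n)) - x + (Gf x + (A x).adjoint ν) with hr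
  have hstx : IsLagrangeStationary 𝒵 Gf A x ν r := by
    unfold IsLagrangeStationary
    rw [hr, add_sub_cancel_right]; exact hxN
  -- In this splitting `μ` occurs only as `t • (μ - μs)`, of norm `δ'`, and up to `t • u` all terms
  -- are controlled by distances between `x`, `z` and `zs`.
  have hre : r = (t • (z - zs) - (x - zs)) + ((1 - t) • (Gf x - Gf zs) + t • (Gf x - Gf z))
      + ((1 - t) • (A x - A zs).adjoint μs + (A x - A z).adjoint (t • μs + t • (μ - μs)))
      + t • u := by
    rw [hr, hns, hn, hν]
    simp only [map_sub, map_add, map_smul, sub_apply]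
    module
  have hxz : ‖x - z‖ ≤ 2 * e := by
    have : x - z = (x - zs) - (z - zs) := by abel
    rw [this]; refine (norm_sub_le _ _).trans ?_; linarith
  have hrn : ‖r‖ ≤ 9 * K ^ 2 * e + u₀ := by
    have c1 : ‖t • (z - zs) - (x - zs)‖ ≤ 1 * e + e := by
      refine (norm_sub_le _ _).trans (add_le_add ?_ hxe)
      rw [norm_smul, Real.norm_eq_abs, abs_of_pos ht0]
      gcongr; linarith
    have c2 : ‖(1 - t) • (Gf x - Gf zs) + t • (Gf x - Gf z)‖ ≤ K * (2 * e) := by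
      refine (norm_add_le _ _).trans ?_
      rw [norm_smul, norm_smul, Real.norm_of_nonneg ht0.le, Real.norm_of_nonneg (by linarith)]
      have a1 : ‖Gf x - Gf zs‖ ≤ K * (2 * e) := (hB.gradient_lip x hx zs hzs).trans
        (by gcongr; linarith)
      have a2 : ‖Gf x - Gf z‖ ≤ K * (2 * e) := (hB.gradient_lip x hx z hz).trans (by gcongr)
      calc _ ≤ (1 - t) * (K * (2 * e)) + t * (K * (2 * e)) := by gcongr
        _ = _ := by ring
    have c3 : ‖(1 - t) • (A x - A zs).adjoint μs + (A x - A z).adjoint (t • μs + t • (μ - μs))‖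
        ≤ 1 * (K * e * K) + K * (2 * e) * (2 * K) := by
      refine (norm_add_le _ _).trans (add_le_add ?_ ?_)
      · rw [norm_smul, Real.norm_eq_abs, abs_of_pos (by linarith)]
        gcongr
        · linarith
        · exact hadj _ _ _ _ ((hB.deriv_lip x hx zs hzs).trans (by gcongr)) h.multiplier_le
            (by linarith)
      · refine hadj _ _ _ _ ((hB.deriv_lip x hx z hz).trans (by gcongr)) ?_ (by linarith)
        refine (norm_add_le _ _).trans ?_
        rw [norm_smul, norm_smul, Real.norm_eq_abs, abs_of_pos ht0, htμ]
        have : t * ‖μs‖ ≤ 1 * K := by gcongr; exact h.multiplier_le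
        linarith
    have c4 : ‖t • u‖ ≤ 1 * u₀ := by
      rw [norm_smul, Real.norm_eq_abs, abs_of_pos ht0]; gcongr
    rw [hre]
    refine (norm_add_le _ _).trans ((add_le_add ((norm_add_le _ _).trans
      (add_le_add ((norm_add_le _ _).trans (add_le_add c1 c2)) c3)) c4).trans ?_)
    have d1 : K * e ≤ K ^ 2 * e := by gcongr
    have d2 : 1 * e ≤ K * e := by gcongr
    linarith
  have hgx : ‖g x‖ ≤ K * e := (h.norm_image_le hB hx).trans (by gcongr)
  have hKe : K * e ≤ K ^ 2 * e := by gcongr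
  have hpos : 0 ≤ K ^ 2 * e := by positivity
  -- Comparing `(x, ν)` with `(zs, μs)` gives `δ' ≤ L * (‖r‖ + ‖g x‖) < δ'`.
  have hst0 := (h.stable 0 le_rfl hτ₀ x zs ν μs r 0 (hxe.trans_lt heδ) (by rw [hνμ]; exact hδ'δ)
    (by simpa using hδ'.trans hδ'δ) (by simpa using hδ'.trans hδ'δ) hstx h.stationary
    (by linarith) (by simp; linarith) (by simp; linarith)
    (by simp [h.feasible]; linarith)).2
  rw [hνμ] at hst0
  simp only [sub_zero, zero_smul, add_zero, h.feasible] at hst0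
  have : L * (‖r‖ + ‖g x‖) ≤ L * (10 * K ^ 2 * e + u₀) :=
    mul_le_mul_of_nonneg_left (by linarith) hL
  linarith

/-- Multipliers of nearly stationary points near a stable point are close to its multiplier. -/
theorem exists_multiplier_stability (E V : Type) [NormedAddCommGroup E] [InnerProductSpace ℝ E]
    [CompleteSpace E] [NormedAddCommGroup V] [InnerProductSpace ℝ V] [CompleteSpace V]
    {K L δ σ δ' : ℝ} (hK : 1 ≤ K) (hL : 0 < L) (hσ : 0 < σ)
    (hδ' : 0 < δ') (hδ'δ : δ' < δ) :
    ∃ d > 0, ∃ u₀ > 0, ∀ {𝒵 : Set E} {f : E → ℝ} {Gf : E → E} {A : E → E →L[ℝ] V} {η τ₀ : ℝ}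
      {g : E → V} {zs : E} {μs : V}, 0 ≤ τ₀ → ProblemBounds 𝒵 f Gf A K →
      IsStablePoint 𝒵 Gf A K η L δ σ τ₀ g zs μs →
      ∀ {z u : E} {μ : V}, ‖z - zs‖ ≤ d → ‖u‖ ≤ u₀ → IsLagrangeStationary 𝒵 Gf A z μ u →
      ‖μ - μs‖ ≤ δ' := by
  set δ₁ : ℝ := min δ' 1 with hδ₁
  have hδ₁0 : 0 < δ₁ := by positivity
  have hδ₁' : δ₁ ≤ δ' := min_le_left _ _
  -- With `K ^ 2 * e = m / 20` and `u₀ = m / 4`, the quantity `10 * K ^ 2 * e + u₀` equals `3 * m /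
  -- 4`, which is below `σ` and, after multiplication by `L`, below `δ₁`.
  set m : ℝ := min (min 1 δ₁) (min σ (δ₁ / L)) with hm
  have hm0 : 0 < m := by positivity
  have m1 : m ≤ 1 := (min_le_left _ _).trans (min_le_left _ _)
  have m2 : m ≤ δ₁ := (min_le_left _ _).trans (min_le_right _ _)
  have m3 : m ≤ σ := (min_le_right _ _).trans (min_le_left _ _)
  have m4 : m ≤ δ₁ / L := (min_le_right _ _).trans (min_le_right _ _)
  have hK2 : 1 ≤ K ^ 2 := by nlinarith
  set e : ℝ := m / (20 * K ^ 2) with he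
  have he0 : 0 < e := by positivity
  have hKe : K ^ 2 * e = m / 20 := by rw [he]; field_simp
  have hee : e ≤ m / 20 := by rw [← hKe]; nlinarith
  refine ⟨e ^ 2 / (6 * K ^ 2), by positivity, m / 4, by positivity, ?_⟩
  intro 𝒵 f Gf A η τ₀ g zs μs hτ₀ hB h z u μ hz hu hst
  have hdle : e ^ 2 / (6 * K ^ 2) ≤ e ^ 2 := div_le_self (by positivity) (by linarith)
  refine (h.norm_multiplier_sub_le hB hτ₀ hδ₁0 (min_le_right _ _) (by linarith) hL.le
    (d := e ^ 2 / (6 * K ^ 2)) (e := e) (u₀ := m / 4) ?_ ?_ ?_ ?_ ?_ ?_ ?_ hz hu hst).trans hδ₁'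
  · nlinarith
  · nlinarith
  · linarith
  · apply le_of_eq; field_simp
  · linarith
  · nlinarith
  · have : L * m ≤ δ₁ := by rw [le_div_iff₀ hL] at m4; linarith
    have e1 : L * (10 * K ^ 2 * e + m / 4) = L * m * (3 / 4) := by
      rw [mul_assoc 10, hKe]; ring
    rw [e1]; nlinarith

end MultiplierStability

/-! ### Error bound and barrier for the augmented Lagrangian -/

section AugmentedLagrangianFormula

variable {E V : Type} [NormedAddCommGroup V] [InnerProductSpace ℝ V]

/-- The augmented Lagrangian of `f` for the constraint `g = 0`. -/
noncomputable def augmentedLagrangian (f : E → ℝ) (g : E → V) (ρ : ℝ) (μ : V) (z : E) : ℝ :=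
  f z + ⟪μ + (ρ / 2) • g z, g z⟫_ℝ

theorem augmentedLagrangian_eq (f : E → ℝ) (g : E → V) (ρ : ℝ) (μ : V) (z : E) :
    augmentedLagrangian f g ρ μ z = f z + ⟪μ, g z⟫_ℝ + ρ / 2 * ‖g z‖ ^ 2 := by
  rw [augmentedLagrangian, inner_add_left, inner_smul_left, real_inner_self_eq_norm_sq]
  simp only [conj_trivial]
  ring

end AugmentedLagrangianFormula

section AugmentedLagrangian

variable {E V : Type} [NormedAddCommGroup E] [InnerProductSpace ℝ E] [CompleteSpace E]
  [NormedAddCommGroup V] [InnerProductSpace ℝ V] [CompleteSpace V]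

theorem hasGradientAt_augmentedLagrangian {f : E → ℝ} {g : E → V} {ρ : ℝ} {μ : V} {z Gz : E}
    {Az : E →L[ℝ] V} (hf : HasGradientAt f Gz z) (hg : HasFDerivAt g Az z) :
    HasGradientAt (augmentedLagrangian f g ρ μ) (Gz + Az.adjoint (μ + ρ • g z)) z := by
  have h1 : HasFDerivAt (augmentedLagrangian f g ρ μ) _ z :=
    hf.hasFDerivAt.add (((hg.const_smul (ρ / 2)).const_add μ).inner ℝ hg)
  rw [hasGradientAt_iff_hasFDerivAt]
  refine h1.congr_fderiv (ContinuousLinearMap.ext fun v => ?_)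
  simp [InnerProductSpace.toDual_apply_apply, fderivInnerCLM_apply, inner_add_left,
    ContinuousLinearMap.adjoint_inner_left, inner_smul_left, real_inner_comm]
  ring

variable {K η L δ σ τ₀ : ℝ}

/-- The primal distance of nearly stationary points of an augmented Lagrangian to a stationary
point is bounded by the residual. -/
theorem exists_error_bound (E V : Type) [NormedAddCommGroup E] [InnerProductSpace ℝ E]
    [CompleteSpace E] [NormedAddCommGroup V] [InnerProductSpace ℝ V] [CompleteSpace V]
    {K L δ σ : ℝ} (hK : 1 ≤ K) (hL : 0 < L) (hδ : 0 < δ) (hσ : 0 < σ) :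
    ∃ R > 0, ∃ c > 0, ∀ {𝒵 : Set E} {f : E → ℝ} {Gf : E → E} {A : E → E →L[ℝ] V} {η τ₀ : ℝ}
      {g : E → V} {zs : E} {μs : V}, ProblemBounds 𝒵 f Gf A K →
      IsStablePoint 𝒵 Gf A K η L δ σ τ₀ g zs μs →
      ∀ {ρ : ℝ} {μb b μi : V} {zi : E}, 0 < ρ → ρ⁻¹ ≤ τ₀ → ‖ρ⁻¹ • (μb - μs) + b‖ < σ →
      ‖zi - zs‖ < δ → ‖μi - μs‖ < δ → IsLagrangeStationary 𝒵 Gf A zi μi 0 →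
      g zi + b + ρ⁻¹ • (μb - μs) + ρ⁻¹ • (μs - μi) = 0 →
      ∀ {z u : E}, ‖z - zs‖ ≤ R → IsLagrangeStationary 𝒵 Gf A z (μb + ρ • (g z + b)) u →
      ‖z - zi‖ ≤ c * ‖u‖ := by
  obtain ⟨d, hd, u₀, hu₀, H⟩ := exists_multiplier_stability E V (δ := δ) (δ' := δ / 2) hK hL hσ
    (half_pos hδ) (half_lt_self hδ)
  set u₁ : ℝ := min u₀ (σ / 2)
  have hu₁ : 0 < u₁ := by positivity
  refine ⟨min d (δ / 2), by positivity, max L (K / u₁), by positivity, ?_⟩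
  intro 𝒵 f Gf A η τ₀ g zs μs hB h ρ μb b μi zi hρ hρτ hσ' hzi hμi hsti hgi z u hz hst
  have hτ₀ : 0 ≤ τ₀ := (inv_pos.2 hρ).le.trans hρτ
  -- A small residual forces the multiplier of `z` into the region of stability. For a large one the
  -- diameter bound `K ≤ K / u₁ * ‖u‖` is enough.
  by_cases hu : ‖u‖ ≤ u₁
  · have hμ := H hτ₀ hB h (hz.trans (min_le_left _ _)) (hu.trans (min_le_left _ _)) hst
    have hzδ : ‖z - zs‖ < δ := by linarith [hz.trans (min_le_right _ _)]
    -- With `τ = ρ⁻¹` both pairs have the same second component of the right-hand side, so only `u`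
    -- remains in the stability estimate.
    have e1 : g z + ρ⁻¹ • (μs - (μb + ρ • (g z + b))) = -(ρ⁻¹ • (μb - μs) + b) := by
      have : ρ⁻¹ • ρ • (g z + b) = g z + b := by rw [smul_smul, inv_mul_cancel₀ hρ.ne', one_smul]
      rw [smul_sub, smul_add, this]; module
    have e2 : g zi + ρ⁻¹ • (μs - μi) = -(ρ⁻¹ • (μb - μs) + b) := by
      rw [← sub_eq_zero, ← hgi]; abel
    have := (h.stable ρ⁻¹ (inv_pos.2 hρ).le hρτ z zi _ μi u 0 hzδ (by linarith) hzi hμi hst hsti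
      (by linarith [hu.trans (min_le_right _ _)]) (by simpa using hσ)
      (by rw [e1, norm_neg]; exact hσ') (by rw [e2, norm_neg]; exact hσ')).1
    rw [e1, e2, sub_self, norm_zero, add_zero, sub_zero] at this
    exact this.trans (by gcongr; exact le_max_left _ _)
  · push Not at hu
    calc ‖z - zi‖ ≤ K := hB.diam z hst.mem zi hsti.mem
      _ = K / u₁ * u₁ := by field_simp
      _ ≤ max L (K / u₁) * ‖u‖ := by gcongr; exact le_max_right _ _

/-- Feasible points exist near the points of the constraint set that are close to a point at
which the constraint qualification holds. -/
theorem IsStablePoint.exists_feasible {𝒵 : Set E} {f : E → ℝ} {Gf : E → E}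
    {A : E → E →L[ℝ] V} {g : E → V} {zs : E} {μs : V}
    (h : IsStablePoint 𝒵 Gf A K η L δ σ τ₀ g zs μs) (hB : ProblemBounds 𝒵 f Gf A K) (hη : 0 < η)
    {x : E} (hx : x ∈ 𝒵) (hxs : ‖x - zs‖ ≤ η / (16 * K ^ 2 * (1 + 8 * K ^ 2 / η))) :
    ∃ y ∈ 𝒵, g y = 0 ∧ ‖y - x‖ ≤ 8 * K / η * ‖g x‖ := by
  have hK := hB.one_le
  have hgcont : ContinuousOn g 𝒵 := fun z hz =>
    (h.hasFDeriv z hz).continuousAt.continuousWithinAt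
  -- Instead of minimising `‖g‖` alone, the distance to `x` is penalised, in the manner of Ekeland:
  -- the minimiser stays near `x`, and it will be shown to be feasible.
  obtain ⟨y, hy, hmin⟩ := hB.compact.exists_isMinOn ⟨x, hx⟩
    (f := fun y => ‖g y‖ + η / (8 * K) * ‖y - x‖) (by fun_prop)
  have hyx : ‖y - x‖ ≤ 8 * K / η * ‖g x‖ := by
    have := hmin hx
    simp only [Set.mem_ofPred_eq, sub_self, norm_zero, mul_zero, add_zero] at this
    have h2 : η / (8 * K) * ‖y - x‖ ≤ ‖g x‖ := by linarith [norm_nonneg (g y)]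
    rw [div_mul_eq_mul_div, div_le_iff₀ (by positivity)] at h2
    rw [div_mul_eq_mul_div, le_div_iff₀ hη]
    linarith
  refine ⟨y, hy, ?_, hyx⟩
  by_contra hne
  have hgy : 0 < ‖g y‖ := norm_pos_iff.2 hne
  have hKK : K ≤ K ^ 2 := by nlinarith
  set R : ℝ := η / (16 * K ^ 2) with hR
  have hys : ‖y - zs‖ ≤ R := by
    have e1 : y - zs = (y - x) + (x - zs) := by abel
    calc ‖y - zs‖ ≤ ‖y - x‖ + ‖x - zs‖ := by rw [e1]; exact norm_add_le _ _
      _ ≤ 8 * K / η * (K * ‖x - zs‖) + ‖x - zs‖ := by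
          gcongr; exact hyx.trans (by gcongr; exact h.norm_image_le hB hx)
      _ = (1 + 8 * K ^ 2 / η) * ‖x - zs‖ := by ring
      _ ≤ (1 + 8 * K ^ 2 / η) * (η / (16 * K ^ 2 * (1 + 8 * K ^ 2 / η))) := by gcongr
      _ = R := by rw [hR]; field_simp
  have hRη : K ^ 2 * R = η / 16 := by rw [hR]; field_simp
  have hR0 : 0 ≤ R := (norm_nonneg _).trans hys
  -- If `g y ≠ 0`, the qualification supplies a feasible direction whose linearised effect on `g` is
  -- opposite to `g y`, with length `η / 2`.
  obtain ⟨z', hz', hr⟩ := h.qualification (-((η / 2 / ‖g y‖) • g y)) (by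
    rw [norm_neg, norm_smul, Real.norm_of_nonneg (by positivity)]
    field_simp; linarith)
  have hzs := h.mem
  -- A step of length `t` lowers `‖g‖` by `t * η / 2`. The linearisation error, the quadratic
  -- remainder and the distance penalty cost at most `t * η / 8` each, so the objective decreases
  -- strictly. The bound by `‖g y‖ / η` prevents overshooting zero.
  set t : ℝ := min 1 (min (‖g y‖ / η) (η / (8 * K ^ 3))) with ht
  have ht0 : 0 < t := by positivity
  have ht1 : t ≤ 1 := min_le_left _ _
  have ht2 : t * η ≤ ‖g y‖ := by
    rw [← le_div_iff₀ hη]; exact (min_le_right _ _).trans (min_le_left _ _)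
  have ht3 : t * (8 * K ^ 3) ≤ η := by
    rw [← le_div_iff₀ (by positivity)]; exact (min_le_right _ _).trans (min_le_right _ _)
  set w : E := y + t • (z' - y) with hw
  have hwy : w - y = t • (z' - y) := by rw [hw]; abel
  have hw𝒵 : w ∈ 𝒵 := hB.convex.add_smul_sub_mem hy hz' ⟨ht0.le, ht1⟩
  have hwyn : ‖w - y‖ ≤ t * K := by
    rw [hwy, norm_smul, Real.norm_of_nonneg ht0.le]
    gcongr; exact hB.diam _ hz' _ hy
  set err : V := A zs (zs - y) + (A y - A zs) (z' - y) with herr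
  have herrn : ‖err‖ ≤ η / 8 := by
    have a1 : ‖A zs (zs - y)‖ ≤ K * R := by
      refine ((A zs).le_opNorm _).trans ?_
      rw [norm_sub_rev]
      gcongr; exact hB.deriv_le _ hzs
    have a2 : ‖(A y - A zs) (z' - y)‖ ≤ K * R * K := by
      refine ((A y - A zs).le_opNorm _).trans ?_
      gcongr
      · exact (hB.deriv_lip _ hy _ hzs).trans (by gcongr)
      · exact hB.diam _ hz' _ hy
    have a3 : K * R ≤ K ^ 2 * R := by gcongr
    calc ‖err‖ ≤ K * R + K * R * K := (norm_add_le _ _).trans (add_le_add a1 a2)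
      _ ≤ η / 8 := by linarith
  have hAy : A y (z' - y) = -((η / 2 / ‖g y‖) • g y) + err := by
    rw [herr, ← hr]; simp only [map_sub, sub_apply]; abel
  have hrem := norm_image_sub_sub_le_of_hasFDerivAt_lipschitz hB.convex (by linarith)
    h.hasFDeriv hB.deriv_lip hy hw𝒵
  have hgw : g w = (1 - t * (η / 2 / ‖g y‖)) • g y + t • err
      + (g w - g y - A y (w - y)) := by
    rw [hwy, map_smul, hAy]; module
  have hcoef : 0 ≤ 1 - t * (η / 2 / ‖g y‖) := by
    have : t * (η / 2 / ‖g y‖) = t * η / ‖g y‖ / 2 := by ring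
    rw [this]
    have : t * η / ‖g y‖ ≤ 1 := (div_le_one hgy).2 ht2
    linarith
  have hgwn : ‖g w‖ ≤ ‖g y‖ - t * η / 2 + t * (η / 8) + K * (t * K) ^ 2 := by
    rw [hgw]
    refine (norm_add₃_le).trans ?_
    rw [norm_smul, norm_smul, Real.norm_of_nonneg hcoef, Real.norm_of_nonneg ht0.le]
    have e1 : (1 - t * (η / 2 / ‖g y‖)) * ‖g y‖ = ‖g y‖ - t * η / 2 := by field_simp
    rw [e1]
    gcongr
    exact hrem.trans (by gcongr)
  have hwx : ‖w - x‖ ≤ t * K + ‖y - x‖ := by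
    have : w - x = (w - y) + (y - x) := by abel
    rw [this]; exact (norm_add_le _ _).trans (by gcongr)
  have hle := hmin hw𝒵
  simp only [Set.mem_ofPred_eq] at hle
  have h5 : η / (8 * K) * ‖w - x‖ ≤ t * η / 8 + η / (8 * K) * ‖y - x‖ := by
    calc _ ≤ η / (8 * K) * (t * K + ‖y - x‖) := by gcongr
      _ = _ := by field_simp
  have h6 : K * (t * K) ^ 2 ≤ t * η / 8 := by nlinarith
  have h7 : 0 < t * η := by positivity
  linarith

/-- Lower bound of the augmented Lagrangian near a local optimum. -/
theorem exists_penalty_lower_bound (E V : Type) [NormedAddCommGroup E] [InnerProductSpace ℝ E]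
    [CompleteSpace E] [NormedAddCommGroup V] [InnerProductSpace ℝ V] [CompleteSpace V]
    {K η ε : ℝ} (hK : 1 ≤ K) (hη : 0 < η) (hε : 0 < ε) :
    ∃ R > 0, ∃ c > 0, ∀ {𝒵 : Set E} {f : E → ℝ} {Gf : E → E} {A : E → E →L[ℝ] V} {L δ σ τ₀ : ℝ}
      {g : E → V} {zs : E} {μs : V}, ProblemBounds 𝒵 f Gf A K →
      IsStablePoint 𝒵 Gf A K η L δ σ τ₀ g zs μs →
      (∀ z ∈ 𝒵, g z = 0 → dist z zs < ε → f zs ≤ f z) →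
      ∀ {ρ : ℝ}, 0 < ρ → ∀ {x : E}, x ∈ 𝒵 → ‖x - zs‖ ≤ R →
      f zs - c / ρ ≤ augmentedLagrangian f g ρ μs x := by
  set c₁ : ℝ := 8 * K / η with hc₁
  set k : ℝ := K * c₁ + K with hk
  refine ⟨min (η / (16 * K ^ 2 * (1 + 8 * K ^ 2 / η))) (ε / 2 / (1 + c₁ * K)), by positivity,
    k ^ 2 / 2, by positivity, ?_⟩
  intro 𝒵 f Gf A L δ σ τ₀ g zs μs hB h hopt ρ hρ x hx hxs
  obtain ⟨y, hy, hgy, hyx⟩ := h.exists_feasible hB hη hx (hxs.trans (min_le_left _ _))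
  have h1 : ‖y - zs‖ ≤ ε / 2 := by
    have e1 : y - zs = (y - x) + (x - zs) := by abel
    calc ‖y - zs‖ ≤ ‖y - x‖ + ‖x - zs‖ := by rw [e1]; exact norm_add_le _ _
      _ ≤ c₁ * (K * ‖x - zs‖) + ‖x - zs‖ := by
          gcongr; exact hyx.trans (by gcongr; exact h.norm_image_le hB hx)
      _ = (1 + c₁ * K) * ‖x - zs‖ := by ring
      _ ≤ (1 + c₁ * K) * (ε / 2 / (1 + c₁ * K)) := by
          gcongr; exact hxs.trans (min_le_right _ _)
      _ = ε / 2 := mul_div_cancel₀ _ (by positivity)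
  have h2 := hopt y hy hgy (by rw [dist_eq_norm]; linarith)
  have h3 := abs_sub_le_of_gradient_bound hB.convex hB.hasGradient hB.gradient_le hy hx
  have h4 : K * ‖y - x‖ ≤ K * (c₁ * ‖g x‖) := by gcongr
  have h5 : -(K * ‖g x‖) ≤ ⟪μs, g x⟫_ℝ := by
    have := abs_real_inner_le_norm μs (g x)
    have : ‖μs‖ * ‖g x‖ ≤ K * ‖g x‖ := by gcongr; exact h.multiplier_le
    have := neg_abs_le ⟪μs, g x⟫_ℝ
    linarith
  rw [augmentedLagrangian_eq]
  -- Replacing `x` by a nearby feasible point, together with the multiplier term, loses at most `k *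
  -- ‖g x‖`; completing the square recovers this from the quadratic penalty up to a term of order `1
  -- / ρ`.
  have h6 : -(k ^ 2 / 2 / ρ) ≤ ρ / 2 * ‖g x‖ ^ 2 - k * ‖g x‖ := by
    have : 0 ≤ (ρ * ‖g x‖ - k) ^ 2 / (2 * ρ) := by positivity
    have e : (ρ * ‖g x‖ - k) ^ 2 / (2 * ρ) = ρ / 2 * ‖g x‖ ^ 2 - k * ‖g x‖ + k ^ 2 / 2 / ρ := by
      field_simp; ring
    linarith
  have h7 := (abs_le.1 h3).2
  rw [hk] at h6
  rw [hk]
  linarith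

/-- For large penalty parameters the augmented Lagrangian at the multiplier is, on a sphere around
a stable local optimum, uniformly larger than its value at the optimum. -/
theorem exists_barrier (E V : Type) [NormedAddCommGroup E] [InnerProductSpace ℝ E]
    [CompleteSpace E] [NormedAddCommGroup V] [InnerProductSpace ℝ V] [CompleteSpace V]
    {K η L δ σ ε τ₀ R₀ : ℝ} (hK : 1 ≤ K) (hη : 0 < η) (hL : 0 < L) (hδ : 0 < δ) (hσ : 0 < σ)
    (hε : 0 < ε) (hτ₀ : 0 < τ₀) (hR₀ : 0 < R₀) :
    ∃ d > 0, d ≤ R₀ ∧ ∃ γ > 0, ∃ ρ₀ > 0, ∀ {𝒵 : Set E} {f : E → ℝ} {Gf : E → E}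
      {A : E → E →L[ℝ] V} {g : E → V} {zs : E} {μs : V}, ProblemBounds 𝒵 f Gf A K →
      IsStablePoint 𝒵 Gf A K η L δ σ τ₀ g zs μs →
      (∀ z ∈ 𝒵, g z = 0 → dist z zs < ε → f zs ≤ f z) →
      ∀ {ρ : ℝ}, ρ₀ < ρ → ∀ {x : E}, x ∈ 𝒵 → ‖x - zs‖ = d →
      f zs + γ ≤ augmentedLagrangian f g ρ μs x := by
  obtain ⟨R₁, hR₁, c, hc, hEB⟩ := exists_error_bound E V hK hL hδ hσ
  obtain ⟨R₂, hR₂, k, hk, hPB⟩ := exists_penalty_lower_bound E V hK hη hε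
  set R : ℝ := min R₀ (min R₁ R₂) with hR
  have hR0 : 0 < R := by positivity
  set d : ℝ := R / 2 with hd
  have hd0 : 0 < d := by positivity
  -- The weight is such that the error bound, applied to the residual `(2 * a) • (y - x)`, reads `‖y
  -- - zs‖ ≤ ‖y - x‖`.
  set a : ℝ := 1 / (2 * c) with ha
  have ha0 : 0 < a := by positivity
  set γ : ℝ := a * d ^ 2 / 64 with hγ
  have hγ0 : 0 < γ := by positivity
  refine ⟨d, hd0, by linarith [min_le_left R₀ (min R₁ R₂)], γ, hγ0, max τ₀⁻¹ (k / γ),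
    by positivity, ?_⟩
  intro 𝒵 f Gf A g zs μs hB h hopt ρ hρ x hx hxd
  have hρ1 : τ₀⁻¹ < ρ := (le_max_left _ _).trans_lt hρ
  have hρ2 : k / γ < ρ := (le_max_right _ _).trans_lt hρ
  have hρ0 : 0 < ρ := (inv_pos.2 hτ₀).trans hρ1
  have hkρ : k / ρ ≤ γ := by
    rw [div_lt_iff₀ hγ0] at hρ2
    rw [div_le_iff₀ hρ0]; linarith
  -- A low value on the sphere is excluded by an Ekeland-type argument. Minimising the augmented
  -- Lagrangian plus `a * ‖z - x‖ ^ 2` over the ball of radius `R = 2 * d` gives `y` within `d / 4`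
  -- of `x`, hence interior to the ball and nearly stationary. The error bound then puts `y` within
  -- `d / 4` of `zs`, while `‖x - zs‖ = d`.
  by_contra! hcon
  have hgrad : ∀ z ∈ 𝒵, HasGradientAt (augmentedLagrangian f g ρ μs)
      (Gf z + (A z).adjoint (μs + ρ • g z)) z := fun z hz =>
    hasGradientAt_augmentedLagrangian (hB.hasGradient z hz) (h.hasFDeriv z hz)
  have hcont : ContinuousOn (fun z => augmentedLagrangian f g ρ μs z + a * ‖z - x‖ ^ 2)
      (𝒵 ∩ Metric.closedBall zs R) := by
    have : ContinuousOn (augmentedLagrangian f g ρ μs) (𝒵 ∩ Metric.closedBall zs R) :=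
      fun z hz => (hgrad z hz.1).hasFDerivAt.continuousAt.continuousWithinAt
    fun_prop
  have hxR : x ∈ 𝒵 ∩ Metric.closedBall zs R :=
    ⟨hx, mem_closedBall_iff_norm.2 (by linarith)⟩
  obtain ⟨y, hy, hmin⟩ := (hB.compact.inter_right Metric.isClosed_closedBall).exists_isMinOn
    ⟨x, hxR⟩ hcont
  have hyR : ‖y - zs‖ ≤ R := mem_closedBall_iff_norm.1 hy.2
  have hRR₁ : R ≤ R₁ := (min_le_right _ _).trans (min_le_left _ _)
  have hRR₂ : R ≤ R₂ := (min_le_right _ _).trans (min_le_right _ _)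
  have h1 := hmin hxR
  simp only [Set.mem_ofPred_eq, sub_self, norm_zero] at h1
  have h2 := hPB hB h hopt hρ0 hy.1 (hyR.trans hRR₂)
  have hyx : ‖y - x‖ ≤ d / 4 := by
    apply le_of_sq_le_sq _ (by positivity)
    have : a * ‖y - x‖ ^ 2 ≤ a * (d / 4) ^ 2 := by nlinarith
    exact le_of_mul_le_mul_left this ha0
  have hys : ‖y - zs‖ ≤ d / 4 + d := by
    have : y - zs = (y - x) + (x - zs) := by abel
    rw [this]; exact (norm_add_le _ _).trans (by linarith)
  have hys' : d ≤ d / 4 + ‖y - zs‖ := by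
    have : x - zs = (y - zs) - (y - x) := by abel
    rw [← hxd, this]
    refine (norm_sub_le _ _).trans ?_
    rw [← this, hxd]
    linarith
  have hgradφ : HasGradientAt (fun z => augmentedLagrangian f g ρ μs z + a * ‖z - x‖ ^ 2)
      ((Gf y + (A y).adjoint (μs + ρ • g y)) + (2 * a) • (y - x)) y := by
    rw [hasGradientAt_iff_hasFDerivAt]
    have h3 : HasFDerivAt (fun z => a * ‖z - x‖ ^ 2) _ y :=
      (((hasFDerivAt_id y).sub_const x).norm_sq).const_mul a
    refine ((hgrad y hy.1).hasFDerivAt.add h3).congr_fderiv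
      (ContinuousLinearMap.ext fun v => ?_)
    simp [InnerProductSpace.toDual_apply_apply]
    ring
  have hN := neg_gradient_mem_normalCone hB.convex hgradφ hy.1 (by linarith : ‖y - zs‖ < R) hmin
  have hst : IsLagrangeStationary 𝒵 Gf A y (μs + ρ • (g y + 0)) (-((2 * a) • (y - x))) := by
    unfold IsLagrangeStationary
    rw [add_zero]
    convert hN using 1
    abel
  have h4 := hEB hB h (ρ := ρ) (μb := μs) (b := 0) (μi := μs) (zi := zs) hρ0
    (inv_le_of_inv_le₀ hτ₀ hρ1.le) (by simpa using hσ) (by simpa using hδ) (by simpa using hδ)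
    h.stationary (by simp [h.feasible]) (hyR.trans hRR₁) hst
  rw [norm_neg, norm_smul, Real.norm_of_nonneg (by positivity)] at h4
  have h5 : c * (2 * a * ‖y - x‖) = ‖y - x‖ := by rw [ha]; field_simp
  rw [h5] at h4
  linarith

end AugmentedLagrangian

/-! ### Sweeps of proximal block minimisations -/

section Blocks

variable {P : ℕ} {n : Fin P → ℕ}

/-- The point whose blocks of index less than `c` are those of `z'`, the others those of `z`. -/
def hybridPoint (z' z : PrimalSpace n) (c : ℕ) : PrimalSpace n :=
  WithLp.toLp 2 fun j => if (j : ℕ) < c then z' j else z j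

theorem hybridPoint_apply (z' z : PrimalSpace n) (c : ℕ) (j : Fin P) :
    hybridPoint z' z c j = if (j : ℕ) < c then z' j else z j := rfl

theorem hybridPoint_zero (z' z : PrimalSpace n) : hybridPoint z' z 0 = z := by
  ext j : 1
  simp [hybridPoint_apply]

theorem hybridPoint_card (z' z : PrimalSpace n) : hybridPoint z' z P = z' := by
  ext j : 1
  simp [hybridPoint_apply]

theorem gaussSeidelPoint_apply_self (z' z : PrimalSpace n) (i : Fin P)
    (x : EuclideanSpace ℝ (Fin (n i))) : gaussSeidelPoint z' z i x i = x := by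
  simp [gaussSeidelPoint, replaceBlock]

theorem gaussSeidelPoint_apply_of_ne (z' z : PrimalSpace n) {i j : Fin P} (hj : j ≠ i)
    (x : EuclideanSpace ℝ (Fin (n i))) :
    gaussSeidelPoint z' z i x j = if j < i then z' j else z j := by
  simp [gaussSeidelPoint, replaceBlock, hj]

theorem gaussSeidelPoint_old (z' z : PrimalSpace n) (i : Fin P) :
    gaussSeidelPoint z' z i (z i) = hybridPoint z' z i := by
  ext j : 1
  rcases eq_or_ne j i with rfl | hj
  · simp [gaussSeidelPoint_apply_self, hybridPoint_apply]
  · rw [gaussSeidelPoint_apply_of_ne _ _ hj, hybridPoint_apply]; rfl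

theorem gaussSeidelPoint_new (z' z : PrimalSpace n) (i : Fin P) :
    gaussSeidelPoint z' z i (z' i) = hybridPoint z' z (i + 1) := by
  ext j : 1
  rcases eq_or_ne j i with rfl | hj
  · simp [gaussSeidelPoint_apply_self, hybridPoint_apply]
  · rw [gaussSeidelPoint_apply_of_ne _ _ hj, hybridPoint_apply]
    have : j < i ↔ (j : ℕ) < i + 1 := by
      have : (j : ℕ) ≠ i := fun h => hj (Fin.ext h)
      rw [Fin.lt_def]; omega
    simp only [this]

theorem PiLp.norm_le_norm_of_forall_le {x y : PrimalSpace n} (h : ∀ j, ‖x j‖ ≤ ‖y j‖) :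
    ‖x‖ ≤ ‖y‖ := by
  apply le_of_sq_le_sq _ (norm_nonneg y)
  rw [PiLp.norm_sq_eq_of_L2, PiLp.norm_sq_eq_of_L2]
  exact Finset.sum_le_sum fun j _ => pow_le_pow_left₀ (norm_nonneg _) (h j) 2

theorem inner_eq_of_supported (a : PrimalSpace n) {v : PrimalSpace n} {i : Fin P}
    (hv : ∀ j, j ≠ i → v j = 0) : ⟪a, v⟫_ℝ = ⟪a i, v i⟫_ℝ := by
  rw [PiLp.inner_apply]
  exact Finset.sum_eq_single i (fun j _ hj => by rw [hv j hj, inner_zero_right]) (by simp)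

theorem norm_eq_of_supported {v : PrimalSpace n} {i : Fin P}
    (hv : ∀ j, j ≠ i → v j = 0) : ‖v‖ = ‖v i‖ := by
  have := inner_eq_of_supported v hv
  rw [real_inner_self_eq_norm_sq, real_inner_self_eq_norm_sq] at this
  exact (pow_left_inj₀ (norm_nonneg _) (norm_nonneg _) two_ne_zero).1 this

theorem gaussSeidelPoint_sub_apply_of_ne (z' z : PrimalSpace n) {i j : Fin P} (hj : j ≠ i)
    (x y : EuclideanSpace ℝ (Fin (n i))) :
    (gaussSeidelPoint z' z i x - gaussSeidelPoint z' z i y) j = 0 := by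
  rw [PiLp.sub_apply, gaussSeidelPoint_apply_of_ne _ _ hj, gaussSeidelPoint_apply_of_ne _ _ hj,
    sub_self]

theorem inner_gaussSeidelPoint_sub (z' z a : PrimalSpace n) (i : Fin P)
    (x y : EuclideanSpace ℝ (Fin (n i))) :
    ⟪a, gaussSeidelPoint z' z i x - gaussSeidelPoint z' z i y⟫_ℝ = ⟪a i, x - y⟫_ℝ := by
  rw [inner_eq_of_supported a fun j hj => gaussSeidelPoint_sub_apply_of_ne z' z hj x y,
    PiLp.sub_apply, gaussSeidelPoint_apply_self, gaussSeidelPoint_apply_self]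

theorem norm_gaussSeidelPoint_sub (z' z : PrimalSpace n) (i : Fin P)
    (x y : EuclideanSpace ℝ (Fin (n i))) :
    ‖gaussSeidelPoint z' z i x - gaussSeidelPoint z' z i y‖ = ‖x - y‖ := by
  rw [norm_eq_of_supported fun j hj => gaussSeidelPoint_sub_apply_of_ne z' z hj x y,
    PiLp.sub_apply, gaussSeidelPoint_apply_self, gaussSeidelPoint_apply_self]

theorem gaussSeidelPoint_combo (z' z : PrimalSpace n) (i : Fin P)
    (x y : EuclideanSpace ℝ (Fin (n i))) {a b : ℝ} (hab : a + b = 1) :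
    gaussSeidelPoint z' z i (a • x + b • y)
      = a • gaussSeidelPoint z' z i x + b • gaussSeidelPoint z' z i y := by
  ext j : 1
  rw [PiLp.add_apply, PiLp.smul_apply, PiLp.smul_apply]
  rcases eq_or_ne j i with rfl | hj
  · simp [gaussSeidelPoint_apply_self]
  · rw [gaussSeidelPoint_apply_of_ne _ _ hj, gaussSeidelPoint_apply_of_ne _ _ hj,
      gaussSeidelPoint_apply_of_ne _ _ hj, ← add_smul, hab, one_smul]

variable {Z : ∀ i : Fin P, Set (EuclideanSpace ℝ (Fin (n i)))}

theorem convex_productSet (hZ : ∀ i, Convex ℝ (Z i)) : Convex ℝ (productSet Z) := by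
  intro x hx y hy a b ha hb hab i
  exact hZ i (hx i) (hy i) ha hb hab

theorem isCompact_productSet (hZ : ∀ i, IsCompact (Z i)) : IsCompact (productSet Z) := by
  have h : IsCompact (Set.univ.pi Z) := isCompact_univ_pi hZ
  have e : productSet Z = (PiLp.homeomorph 2 (fun i : Fin P => EuclideanSpace ℝ (Fin (n i)))) ⁻¹'
      (Set.univ.pi Z) := by
    ext z
    simp only [productSet, Set.mem_preimage, Set.mem_pi, Set.mem_univ, true_imp_iff]
    rfl
  rw [e]
  exact (Homeomorph.isCompact_preimage _).2 h

theorem gaussSeidelPoint_mem {z' z : PrimalSpace n} (hz' : z' ∈ productSet Z)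
    (hz : z ∈ productSet Z) {i : Fin P} {x : EuclideanSpace ℝ (Fin (n i))} (hx : x ∈ Z i) :
    gaussSeidelPoint z' z i x ∈ productSet Z := by
  intro j
  rcases eq_or_ne j i with rfl | hj
  · rwa [gaussSeidelPoint_apply_self]
  · rw [gaussSeidelPoint_apply_of_ne _ _ hj]
    split_ifs
    exacts [hz' j, hz j]

theorem hybridPoint_mem {z' z : PrimalSpace n} (hz' : z' ∈ productSet Z)
    (hz : z ∈ productSet Z) (c : ℕ) : hybridPoint z' z c ∈ productSet Z := by
  intro j
  rw [hybridPoint_apply]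
  split_ifs
  exacts [hz' j, hz j]

/-- One sweep of proximal alternating minimisations of `L`. -/
def IsSweepOf (L : PrimalSpace n → ℝ) (Z : ∀ i : Fin P, Set (EuclideanSpace ℝ (Fin (n i))))
    (α : Fin P → ℝ) (z z' : PrimalSpace n) : Prop :=
  ∀ i, z' i ∈ Z i ∧
    IsMinOn (fun x => L (gaussSeidelPoint z' z i x) + α i / 2 * ‖x - z i‖ ^ 2) (Z i) (z' i)

variable {L : PrimalSpace n → ℝ} {α : Fin P → ℝ} {z z' : PrimalSpace n}

theorem IsSweepOf.mem (h : IsSweepOf L Z α z z') : z' ∈ productSet Z := fun i => (h i).1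

/-- The old block competes in the block minimisation, with zero proximal cost. -/
theorem IsSweepOf.descent_block (h : IsSweepOf L Z α z z') (hz : z ∈ productSet Z) (i : Fin P) :
    L (hybridPoint z' z (i + 1)) + α i / 2 * ‖z' i - z i‖ ^ 2 ≤ L (hybridPoint z' z i) := by
  have := (h i).2 (hz i)
  simp only [Set.mem_ofPred_eq, gaussSeidelPoint_new, gaussSeidelPoint_old, sub_self,
    norm_zero] at this
  linarith

/-- The optimality condition of a block minimisation. -/
theorem IsSweepOf.inner_nonneg (h : IsSweepOf L Z α z z') (hz : z ∈ productSet Z)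
    (hZ : ∀ i, Convex ℝ (Z i)) {G : PrimalSpace n → PrimalSpace n}
    (hG : ∀ y ∈ productSet Z, HasGradientAt L (G y) y) (i : Fin P)
    {x : EuclideanSpace ℝ (Fin (n i))} (hx : x ∈ Z i) :
    0 ≤ ⟪G (hybridPoint z' z (i + 1)) i + α i • (z' i - z i), x - z' i⟫_ℝ := by
  set y : PrimalSpace n := hybridPoint z' z (i + 1) with hy
  set y₀ : PrimalSpace n := hybridPoint z' z i with hy₀
  have hymem : y ∈ productSet Z := hybridPoint_mem h.mem hz _
  -- The block problem is viewed as a minimisation over a convex slice of the full space, on which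
  -- distances are block distances; the full-space optimality condition then applies.
  set W : Set (PrimalSpace n) := gaussSeidelPoint z' z i '' Z i with hW
  have hWconv : Convex ℝ W := by
    rintro _ ⟨x₁, h₁, rfl⟩ _ ⟨x₂, h₂, rfl⟩ a b ha hb hab
    exact ⟨a • x₁ + b • x₂, hZ i h₁ h₂ ha hb hab, gaussSeidelPoint_combo z' z i x₁ x₂ hab⟩
  have hgrad : HasGradientAt (fun w => L w + α i / 2 * ‖w - y₀‖ ^ 2)
      (G y + (α i) • (y - y₀)) y := by
    rw [hasGradientAt_iff_hasFDerivAt]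
    have h3 : HasFDerivAt (fun w => α i / 2 * ‖w - y₀‖ ^ 2) _ y :=
      (((hasFDerivAt_id y).sub_const y₀).norm_sq).const_mul (α i / 2)
    refine ((hG y hymem).hasFDerivAt.add h3).congr_fderiv
      (ContinuousLinearMap.ext fun v => ?_)
    simp [InnerProductSpace.toDual_apply_apply]
    ring
  have hyW : y ∈ W := ⟨z' i, (h i).1, gaussSeidelPoint_new z' z i⟩
  have hmin : IsMinOn (fun w => L w + α i / 2 * ‖w - y₀‖ ^ 2) (W ∩ Metric.closedBall y 1) y := by
    rintro _ ⟨⟨x, hx, rfl⟩, -⟩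
    have := (h i).2 hx
    simp only [Set.mem_ofPred_eq] at this ⊢
    rw [hy, hy₀, ← gaussSeidelPoint_new, ← gaussSeidelPoint_old, norm_gaussSeidelPoint_sub,
      norm_gaussSeidelPoint_sub]
    exact this
  have hN := neg_gradient_mem_normalCone hWconv hgrad hyW (by simp : ‖y - y‖ < 1) hmin
  have h1 := hN.2 _ ⟨x, hx, rfl⟩
  rw [inner_neg_left, hy, ← gaussSeidelPoint_new, inner_gaussSeidelPoint_sub,
    gaussSeidelPoint_new, ← hy, PiLp.add_apply, PiLp.smul_apply, PiLp.sub_apply, hy, hy₀,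
    hybridPoint_apply, hybridPoint_apply] at h1
  simp only [lt_add_iff_pos_right, zero_lt_one, if_true, lt_self_iff_false, if_false] at h1
  linarith

/-- Distinct blocks are orthogonal, so the proximal decreases of the single blocks add up to that of
the full step. -/
theorem norm_sq_hybridPoint_succ (z' z : PrimalSpace n) (i : Fin P) :
    ‖hybridPoint z' z (i + 1) - z‖ ^ 2 = ‖hybridPoint z' z i - z‖ ^ 2 + ‖z' i - z i‖ ^ 2 := by
  rw [PiLp.norm_sq_eq_of_L2, PiLp.norm_sq_eq_of_L2]
  have : ‖z' i - z i‖ ^ 2 = ∑ j, if j = i then ‖z' j - z j‖ ^ 2 else 0 := by simp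
  rw [this, ← Finset.sum_add_distrib]
  refine Finset.sum_congr rfl fun j _ => ?_
  simp only [PiLp.sub_apply, hybridPoint_apply]
  by_cases hj : j = i
  · subst hj; simp
  · have h1 : (j : ℕ) ≠ i := fun h => hj (Fin.ext h)
    have h2 : (j : ℕ) < i + 1 ↔ (j : ℕ) < i := by omega
    simp [h2, hj]

/-- A sweep decreases `L`, and does not leave a ball whose boundary it cannot cross by
decreasing `L`. -/
theorem IsSweepOf.descent (h : IsSweepOf L Z α z z') (hz : z ∈ productSet Z)
    (hconv : IsMultiConvex L) {a : ℝ} (ha : 0 ≤ a) (hα : ∀ i, a ≤ α i) {zs : PrimalSpace n}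
    {d β : ℝ}
    (hbar : ∀ y ∈ productSet Z, ‖y - zs‖ = d → β ≤ L y) (hZ : ∀ i, Convex ℝ (Z i))
    (hzd : ‖z - zs‖ < d) (hLz : L z < β) :
    L z' + a / 2 * ‖z' - z‖ ^ 2 ≤ L z ∧ ‖z' - zs‖ < d := by
  have key : ∀ c ≤ P, L (hybridPoint z' z c) + a / 2 * ‖hybridPoint z' z c - z‖ ^ 2 ≤ L z ∧
      ‖hybridPoint z' z c - zs‖ < d := by
    intro c
    induction c with
    | zero => intro _; rw [hybridPoint_zero]; simpa using hzd
    | succ c ih =>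
      intro hc
      obtain ⟨h1, h2⟩ := ih (by omega)
      set i : Fin P := ⟨c, by omega⟩ with hi
      have hd := h.descent_block hz i
      have hsq := norm_sq_hybridPoint_succ z' z i
      have hαi : a / 2 * ‖z' i - z i‖ ^ 2 ≤ α i / 2 * ‖z' i - z i‖ ^ 2 := by gcongr; exact hα i
      have hnn : 0 ≤ a / 2 * ‖z' i - z i‖ ^ 2 := by positivity
      have hnn' : 0 ≤ a / 2 * ‖hybridPoint z' z c - z‖ ^ 2 := by positivity
      simp only [hi] at hd hsq hαi hnn
      refine ⟨by rw [hsq]; linarith, ?_⟩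
      -- If block `i` carried the point across the sphere, some point of the segment would lie on
      -- it. Convexity in the block bounds `L` there by the end values, both at most `L z < β`,
      -- against the barrier.
      by_contra! hcon
      set y : PrimalSpace n := hybridPoint z' z c
      set y' : PrimalSpace n := hybridPoint z' z (c + 1)
      have hcont : ContinuousOn (fun t : ℝ => ‖(1 - t) • y + t • y' - zs‖) (Set.Icc 0 1) := by
        fun_prop
      obtain ⟨t, ht, htd⟩ := intermediate_value_Icc zero_le_one hcont
        (show d ∈ Set.Icc _ _ from ⟨by simpa using h2.le, by simpa using hcon⟩)
      have e1 : (1 - t) • y + t • y' = gaussSeidelPoint z' z i ((1 - t) • z i + t • z' i) := by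
        rw [gaussSeidelPoint_combo _ _ _ _ _ (by ring), gaussSeidelPoint_old,
          gaussSeidelPoint_new]
      have hmem : (1 - t) • y + t • y' ∈ productSet Z :=
        convex_productSet hZ (hybridPoint_mem h.mem hz _) (hybridPoint_mem h.mem hz _)
          (by linarith [ht.2]) ht.1 (by ring)
      have h3 := hbar _ hmem htd
      have h4 : L ((1 - t) • y + t • y') ≤ (1 - t) * L y + t * L y' := by
        have := (hconv (WithLp.toLp 2 fun j => if j < i then z' j else z j) i).2
          (Set.mem_univ (z i)) (Set.mem_univ (z' i)) (by linarith [ht.2] : 0 ≤ 1 - t) ht.1 (by ring)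
        change L (gaussSeidelPoint z' z i _) ≤ (1 - t) * L (gaussSeidelPoint z' z i _)
          + t * L (gaussSeidelPoint z' z i _) at this
        rwa [← e1, gaussSeidelPoint_old, gaussSeidelPoint_new] at this
      nlinarith [ht.1, ht.2]
  have := key P le_rfl
  rwa [hybridPoint_card] at this

/-- A sweep produces a sub-gradient that is bounded by the length of the step. -/
theorem IsSweepOf.exists_subgradient (h : IsSweepOf L Z α z z') (hz : z ∈ productSet Z)
    (hZ : ∀ i, Convex ℝ (Z i)) {G : PrimalSpace n → PrimalSpace n} {K : ℝ} (hK : 0 ≤ K)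
    (hα : ∀ i, 0 ≤ α i)
    (hG : ∀ y ∈ productSet Z, HasGradientAt L (G y) y)
    (hGlip : ∀ y ∈ productSet Z, ∀ y' ∈ productSet Z, ‖G y - G y'‖ ≤ K * ‖y - y'‖) :
    ∃ u, u - G z' ∈ normalCone (productSet Z) z' ∧
      ‖u‖ ≤ √(∑ i, (K + α i) ^ 2) * ‖z' - z‖ := by
  -- Block `i` is optimal at the hybrid point, not at `z'`. The entry `u i` is the resulting
  -- gradient mismatch, corrected by the proximal term, so that `u - G z'` is the negative of the
  -- block optimality vectors.
  set u : PrimalSpace n := WithLp.toLp 2 fun i =>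
    G z' i - (G (hybridPoint z' z (i + 1)) i + α i • (z' i - z i)) with hu
  have hui : ∀ i, u i = G z' i - (G (hybridPoint z' z (i + 1)) i + α i • (z' i - z i)) :=
    fun i => rfl
  refine ⟨u, ⟨h.mem, fun y hy => ?_⟩, ?_⟩
  · rw [PiLp.inner_apply]
    refine Finset.sum_nonpos fun i _ => ?_
    have := h.inner_nonneg hz hZ hG i (hy i)
    rw [PiLp.sub_apply, PiLp.sub_apply, hui, sub_sub_cancel_left, inner_neg_left]
    linarith
  · have hblock : ∀ i, ‖u i‖ ≤ (K + α i) * ‖z' - z‖ := by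
      intro i
      have e : u i = (G z' - G (hybridPoint z' z (i + 1))) i - α i • ((z' - z) i) := by
        rw [hui, PiLp.sub_apply, PiLp.sub_apply]; abel
      have h1 : ‖z' - hybridPoint z' z (i + 1)‖ ≤ ‖z' - z‖ := by
        refine PiLp.norm_le_norm_of_forall_le fun j => ?_
        rw [PiLp.sub_apply, PiLp.sub_apply, hybridPoint_apply]
        split_ifs
        · simp
        · exact le_rfl
      rw [e, add_mul]
      refine (norm_sub_le _ _).trans (add_le_add ?_ ?_)
      · exact (PiLp.norm_apply_le _ i).trans
          ((hGlip _ h.mem _ (hybridPoint_mem h.mem hz _)).trans (by gcongr))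
      · rw [norm_smul, Real.norm_of_nonneg (hα i)]
        have := hα i
        gcongr
        exact PiLp.norm_apply_le _ i
    apply le_of_sq_le_sq _ (by positivity)
    rw [mul_pow, Real.sq_sqrt (by positivity), PiLp.norm_sq_eq_of_L2, Finset.sum_mul]
    refine Finset.sum_le_sum fun i _ => ?_
    rw [← mul_pow]
    exact pow_le_pow_left₀ (norm_nonneg _) (hblock i) 2

/-- The gradient inequality for functions that are convex in each block. -/
theorem IsMultiConvex.inner_le (hconv : IsMultiConvex L) (hZ : ∀ i, Convex ℝ (Z i))
    {G : PrimalSpace n → PrimalSpace n} {K : ℝ} (hK : 0 ≤ K)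
    (hG : ∀ y ∈ productSet Z, HasGradientAt L (G y) y)
    (hGlip : ∀ y ∈ productSet Z, ∀ y' ∈ productSet Z, ‖G y - G y'‖ ≤ K * ‖y - y'‖)
    (hz' : z' ∈ productSet Z) (hz : z ∈ productSet Z) {i : Fin P}
    {x y : EuclideanSpace ℝ (Fin (n i))} (hx : x ∈ Z i) (hy : y ∈ Z i) :
    ⟪G (gaussSeidelPoint z' z i x) i, y - x⟫_ℝ
      ≤ L (gaussSeidelPoint z' z i y) - L (gaussSeidelPoint z' z i x) := by
  set w := gaussSeidelPoint z' z i x with hw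
  set w' := gaussSeidelPoint z' z i y with hw'
  have hwm : w ∈ productSet Z := gaussSeidelPoint_mem hz' hz hx
  have hwm' : w' ∈ productSet Z := gaussSeidelPoint_mem hz' hz hy
  rw [← inner_gaussSeidelPoint_sub z' z, ← hw, ← hw']
  set D : ℝ := K * ‖w' - w‖ ^ 2 with hD
  have hD0 : 0 ≤ D := by positivity
  -- Convexity along the segment and the quadratic remainder give the gradient inequality up to `t *
  -- D`; `t` then tends to zero.
  have key : ∀ t : ℝ, 0 < t → t ≤ 1 → ⟪G w, w' - w⟫_ℝ ≤ L w' - L w + t * D := by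
    intro t ht ht1
    have e1 : (1 - t) • w + t • w' = gaussSeidelPoint z' z i ((1 - t) • x + t • y) := by
      rw [gaussSeidelPoint_combo _ _ _ _ _ (by ring)]
    have h4 : L ((1 - t) • w + t • w') ≤ (1 - t) * L w + t * L w' := by
      rw [e1]
      exact (hconv (WithLp.toLp 2 fun j => if j < i then z' j else z j) i).2
        (Set.mem_univ x) (Set.mem_univ y) (by linarith : 0 ≤ 1 - t) ht.le (by ring)
    have h5 := abs_sub_sub_inner_le_of_gradient_lipschitz (convex_productSet hZ) hK hG hGlip hwm
      (convex_productSet hZ hwm hwm' (by linarith : 0 ≤ 1 - t) ht.le (by ring))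
    have e2 : (1 - t) • w + t • w' - w = t • (w' - w) := by module
    rw [e2, inner_smul_right, norm_smul, Real.norm_of_nonneg ht.le, mul_pow] at h5
    have h6 := (abs_le.1 h5).1
    have h7 : t * ⟪G w, w' - w⟫_ℝ ≤ t * (L w' - L w + t * D) := by
      rw [hD]; linarith
    exact le_of_mul_le_mul_left h7 ht
  refine le_of_forall_pos_le_add fun ε hε => ?_
  have ht : 0 < min 1 (ε / (D + 1)) := by positivity
  refine (key _ ht (min_le_left _ _)).trans ?_
  gcongr
  calc min 1 (ε / (D + 1)) * D ≤ ε / (D + 1) * (D + 1) := by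
        gcongr
        · exact min_le_right _ _
        · linarith
    _ = ε := by field_simp

/-- One sweep is Lipschitz at the critical points. -/
theorem IsSweepOf.norm_sub_le (h : IsSweepOf L Z α z z') (hz : z ∈ productSet Z)
    (hZ : ∀ i, Convex ℝ (Z i)) (hconv : IsMultiConvex L)
    {G : PrimalSpace n → PrimalSpace n} {K : ℝ} (hK : 0 ≤ K)
    (hG : ∀ y ∈ productSet Z, HasGradientAt L (G y) y)
    (hGlip : ∀ y ∈ productSet Z, ∀ y' ∈ productSet Z, ‖G y - G y'‖ ≤ K * ‖y - y'‖)
    {a : ℝ} (ha : 0 < a) (hα : ∀ i, a ≤ α i) {zi : PrimalSpace n}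
    (hzi : -G zi ∈ normalCone (productSet Z) zi) :
    ‖z' - zi‖ ≤ (2 + K / a) ^ P * ‖z - zi‖ := by
  have hzim := hzi.1
  have key : ∀ c ≤ P, ‖hybridPoint z' z c - zi‖ ≤ (2 + K / a) ^ c * ‖z - zi‖ := by
    intro c
    induction c with
    | zero => intro _; rw [hybridPoint_zero]; simp
    | succ c ih =>
      intro hc
      have ih := ih (by omega)
      set i : Fin P := ⟨c, by omega⟩ with hi
      have hαi : 0 < α i := ha.trans_le (hα i)
      set y₀ := hybridPoint z' z c with hy₀
      set y := hybridPoint z' z (c + 1) with hy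
      -- The current hybrid point with its block `i` corrected to that of `zi`: the two differ in
      -- the other blocks only, by no more than the error so far.
      set yi := gaussSeidelPoint z' z i (zi i) with hyi
      have hyim : yi ∈ productSet Z := gaussSeidelPoint_mem h.mem hz (hzim i)
      have ey : y = gaussSeidelPoint z' z i (z' i) := by rw [gaussSeidelPoint_new]
      have hyi0 : ‖yi - zi‖ ≤ ‖y₀ - zi‖ := by
        refine PiLp.norm_le_norm_of_forall_le fun j => ?_
        rw [PiLp.sub_apply, PiLp.sub_apply]
        rcases eq_or_ne j i with rfl | hj
        · simp [hyi, gaussSeidelPoint_apply_self]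
        · rw [hyi, gaussSeidelPoint_apply_of_ne _ _ hj, hy₀, hybridPoint_apply]
          exact le_of_eq rfl
      have hzblock : ‖z i - zi i‖ ≤ ‖y₀ - zi‖ := by
        have h0 : y₀ i = z i := by rw [hy₀, hybridPoint_apply]; simp [hi]
        have := PiLp.norm_apply_le (y₀ - zi) i
        rwa [PiLp.sub_apply, h0] at this
      set v := z' i - zi i with hv
      have h1 := h.inner_nonneg hz hZ hG i (hzim i)
      have h2 : 0 ≤ ⟪G zi i, v⟫_ℝ := by
        have := hzi.2 _ (gaussSeidelPoint_mem hzim hzim (h i).1)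
        have e : zi = gaussSeidelPoint zi zi i (zi i) := by
          rw [gaussSeidelPoint_old]; ext j : 1; simp [hybridPoint_apply]
        have e2 : gaussSeidelPoint zi zi i (z' i) - zi
            = gaussSeidelPoint zi zi i (z' i) - gaussSeidelPoint zi zi i (zi i) := by rw [← e]
        rw [e2, inner_gaussSeidelPoint_sub, PiLp.neg_apply, inner_neg_left] at this
        linarith
      -- The two gradient inequalities add up to monotonicity of the block gradient between `y` and
      -- `yi`.
      have h3 := hconv.inner_le hZ hK hG hGlip h.mem hz (h i).1 (hzim i)
      have h4 := hconv.inner_le hZ hK hG hGlip h.mem hz (hzim i) (h i).1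
      rw [← hyi, ← ey] at h3 h4
      rw [← neg_sub (z' i) (zi i), ← hv, inner_neg_right] at h1 h3
      rw [← hv] at h4
      rw [inner_add_left, inner_smul_left] at h1
      simp only [conj_trivial] at h1
      change 0 ≤ -(⟪G y i, v⟫_ℝ + α i * ⟪z' i - z i, v⟫_ℝ) at h1
      have h5 : ⟪G zi i, v⟫_ℝ - ⟪G yi i, v⟫_ℝ ≤ K * ‖y₀ - zi‖ * ‖v‖ := by
        rw [← inner_sub_left]
        refine (real_inner_le_norm _ _).trans ?_
        gcongr
        have := PiLp.norm_apply_le (G zi - G yi) i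
        rw [PiLp.sub_apply] at this
        refine this.trans ((hGlip _ hzim _ hyim).trans ?_)
        rw [norm_sub_rev]; gcongr
      have h6 : ⟪z' i - z i, v⟫_ℝ = ‖v‖ ^ 2 - ⟪z i - zi i, v⟫_ℝ := by
        have : z' i - z i = v - (z i - zi i) := by rw [hv]; abel
        rw [this, inner_sub_left, real_inner_self_eq_norm_sq]
      have h7 : ⟪z i - zi i, v⟫_ℝ ≤ ‖y₀ - zi‖ * ‖v‖ :=
        (real_inner_le_norm _ _).trans (by gcongr)
      have h8 : α i * ‖v‖ ^ 2 ≤ α i * (‖y₀ - zi‖ * ‖v‖) + K * ‖y₀ - zi‖ * ‖v‖ := by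
        have : α i * ⟪z i - zi i, v⟫_ℝ ≤ α i * (‖y₀ - zi‖ * ‖v‖) := by gcongr
        rw [h6] at h1
        linarith
      have h9 : ‖v‖ ≤ (1 + K / a) * ‖y₀ - zi‖ := by
        rcases (norm_nonneg v).eq_or_lt with hv0 | hv0
        · rw [← hv0]; positivity
        have h10 : α i * ‖v‖ ≤ α i * ((1 + K / α i) * ‖y₀ - zi‖) := by
          have e : α i * ((1 + K / α i) * ‖y₀ - zi‖) = α i * ‖y₀ - zi‖ + K * ‖y₀ - zi‖ := by
            field_simp
          rw [e]
          refine le_of_mul_le_mul_right ?_ hv0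
          linarith
        refine (le_of_mul_le_mul_left h10 hαi).trans ?_
        gcongr
        exact hα i
      have h11 : ‖y - yi‖ = ‖v‖ := by rw [ey, hyi, norm_gaussSeidelPoint_sub]
      have e12 : y - zi = (y - yi) + (yi - zi) := by abel
      calc ‖y - zi‖ ≤ ‖v‖ + ‖y₀ - zi‖ := by
            rw [e12, ← h11]; exact (norm_add_le _ _).trans (by gcongr)
        _ ≤ (2 + K / a) * ‖y₀ - zi‖ := by linarith
        _ ≤ (2 + K / a) * ((2 + K / a) ^ c * ‖z - zi‖) := by gcongr
        _ = _ := by ring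
  have := key P le_rfl
  rwa [hybridPoint_card] at this

end Blocks

/-! ### Geometric decay from sufficient decrease -/

section LinearRate

/-- Linear convergence of a descent sequence from sufficient decrease and error bounds. -/
theorem norm_sq_sub_le_of_descent {E : Type} [NormedAddCommGroup E] {z : ℕ → E} {zi : E}
    {V : ℕ → ℝ} {a B c D : ℝ} {M : ℕ} (ha : 0 < a) (hB : 0 < B) (hc : 0 < c) (hD : 0 < D)
    (hdesc : ∀ l < M, V (l + 1) + a / 2 * ‖z (l + 1) - z l‖ ^ 2 ≤ V l)
    (hV : ∀ l ≤ M, 0 ≤ V l) (hVB : ∀ l < M, V (l + 1) ≤ B * ‖z (l + 1) - z l‖ ^ 2)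
    (herr : ∀ l < M, ‖z (l + 1) - zi‖ ≤ c * ‖z (l + 1) - z l‖)
    (hone : 0 < M → ‖z 1 - zi‖ ≤ D * ‖z 0 - zi‖) (hM : 1 ≤ M) :
    ‖z M - zi‖ ^ 2 ≤ (D ^ 2 + c ^ 2 * (2 / a) * B * (1 + D) ^ 2)
        / (2 * B / (a + 2 * B)) ^ 2 * (2 * B / (a + 2 * B)) ^ M * ‖z 0 - zi‖ ^ 2 := by
  set q : ℝ := 2 * B / (a + 2 * B) with hq
  have hq0 : 0 < q := by positivity
  have hq1 : q ≤ 1 := (div_le_one (by positivity)).2 (by linarith)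
  set d₀ : ℝ := ‖z 0 - zi‖ with hd₀
  -- The recursion starts at `V 1`, as no quadratic bound of `V 0` by `d₀` is at hand: at a
  -- constrained critical point the gradient need not vanish, and the initial gap may be linear in
  -- `d₀`.
  have hV1 : V 1 ≤ B * (1 + D) ^ 2 * d₀ ^ 2 := by
    have h1 := hVB 0 (by omega)
    have h2 : ‖z (0 + 1) - z 0‖ ≤ (1 + D) * d₀ := by
      have : z (0 + 1) - z 0 = (z 1 - zi) - (z 0 - zi) := by simp
      rw [this]
      refine (norm_sub_le _ _).trans ?_
      linarith [hone (by omega)]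
    calc V 1 ≤ B * ‖z (0 + 1) - z 0‖ ^ 2 := h1
      _ ≤ B * ((1 + D) * d₀) ^ 2 := by gcongr
      _ = _ := by ring
  have hVl : ∀ l, l < M → V (l + 1) ≤ q ^ l * (B * (1 + D) ^ 2 * d₀ ^ 2) := by
    intro l
    induction l with
    | zero => intro _; simpa using hV1
    | succ l ih =>
      intro hl
      have ih := ih (by omega)
      have h1 := hdesc (l + 1) hl
      have h2 := hVB (l + 1) hl
      -- Eliminating the step length between sufficient decrease and the bound by `B` gives the
      -- ratio `q = 2B / (a + 2B)`.
      have h3 : V (l + 1 + 1) ≤ q * V (l + 1) := by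
        rw [hq, div_mul_eq_mul_div, le_div_iff₀ (by positivity)]
        nlinarith
      calc V (l + 1 + 1) ≤ q * V (l + 1) := h3
        _ ≤ q * (q ^ l * (B * (1 + D) ^ 2 * d₀ ^ 2)) := by gcongr
        _ = _ := by ring
  obtain ⟨N, rfl⟩ : ∃ N, M = N + 1 := ⟨M - 1, by omega⟩
  -- After a single sweep only the Lipschitz bound is available. Later iterates are controlled by
  -- `V` at the previous index, itself counted from index one; these two lost factors explain the
  -- division by `q ^ 2`.
  rcases Nat.eq_zero_or_pos N with rfl | hN
  · have h1 := hone (by omega)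
    have h2 : ‖z 1 - zi‖ ^ 2 ≤ (D * d₀) ^ 2 := by gcongr
    have h3 : D ^ 2 ≤ D ^ 2 + c ^ 2 * (2 / a) * B * (1 + D) ^ 2 := by
      have : 0 ≤ c ^ 2 * (2 / a) * B * (1 + D) ^ 2 := by positivity
      linarith
    have h4 : (D ^ 2 + c ^ 2 * (2 / a) * B * (1 + D) ^ 2)
        ≤ (D ^ 2 + c ^ 2 * (2 / a) * B * (1 + D) ^ 2) / q ^ 2 * q ^ (0 + 1) := by
      rw [div_mul_eq_mul_div, le_div_iff₀ (by positivity)]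
      have : q ^ 2 ≤ q ^ (0 + 1) := pow_le_pow_of_le_one hq0.le hq1 (by omega)
      gcongr
    calc ‖z (0 + 1) - zi‖ ^ 2 ≤ D ^ 2 * d₀ ^ 2 := by rw [← mul_pow]; exact h2
      _ ≤ _ := by gcongr; exact h3.trans h4
  · obtain ⟨l, rfl⟩ : ∃ l, N = l + 1 := ⟨N - 1, by omega⟩
    have h1 := herr (l + 1) (by omega)
    have h2 := hdesc (l + 1) (by omega)
    have h3 := hV (l + 1 + 1) le_rfl
    have h4 := hVl l (by omega)
    have h5 : ‖z (l + 1 + 1) - z (l + 1)‖ ^ 2 ≤ 2 / a * V (l + 1) := by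
      rw [div_mul_eq_mul_div, le_div_iff₀ ha]; linarith
    calc ‖z (l + 1 + 1) - zi‖ ^ 2 ≤ (c * ‖z (l + 1 + 1) - z (l + 1)‖) ^ 2 := by gcongr
      _ = c ^ 2 * ‖z (l + 1 + 1) - z (l + 1)‖ ^ 2 := by ring
      _ ≤ c ^ 2 * (2 / a * (q ^ l * (B * (1 + D) ^ 2 * d₀ ^ 2))) := by
          gcongr; exact h5.trans (by gcongr)
      _ = (c ^ 2 * (2 / a) * B * (1 + D) ^ 2) / q ^ 2 * q ^ (l + 1 + 1) * d₀ ^ 2 := by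
          have : q ^ (l + 1 + 1) = q ^ l * q ^ 2 := by ring
          rw [this]; field_simp
      _ ≤ _ := by gcongr; nlinarith [sq_nonneg D]

/-- Geometric decay dominates polynomial decay. -/
theorem exists_pow_le_mul_rpow_neg {q : ℝ} (hq0 : 0 < q) (hq1 : q < 1) (ψ : ℝ) :
    ∃ C > 0, ∀ M : ℕ, 1 ≤ M → q ^ M ≤ C * ((M : ℝ) ^ (-ψ)) ^ 2 := by
  -- The claim is squared, so an integer power `k ≥ 2 * ψ` is needed; `M ^ k * q ^ M` is bounded.
  obtain ⟨k, hk⟩ := exists_nat_ge (2 * ψ)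
  have h := tendsto_pow_const_mul_const_pow_of_abs_lt_one k
    (by rwa [abs_of_pos hq0] : |q| < 1)
  obtain ⟨C, hC⟩ := h.bddAbove_range
  refine ⟨max C 1, by positivity, fun M hM => ?_⟩
  have hM1 : (1 : ℝ) ≤ M := by exact_mod_cast hM
  have hM0 : (0 : ℝ) < M := by linarith
  have h1 : (M : ℝ) ^ k * q ^ M ≤ max C 1 :=
    (hC ⟨M, rfl⟩).trans (le_max_left _ _)
  have h2 : ((M : ℝ) ^ (-ψ)) ^ 2 = (M : ℝ) ^ (-(2 * ψ)) := by
    rw [← Real.rpow_natCast, ← Real.rpow_mul hM0.le]; congr 1; push_cast; ring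
  have h3 : (M : ℝ) ^ (2 * ψ) ≤ (M : ℝ) ^ k := by
    rw [← Real.rpow_natCast]; exact Real.rpow_le_rpow_of_exponent_le hM1 hk
  rw [h2, Real.rpow_neg hM0.le, ← div_eq_mul_inv, le_div_iff₀ (by positivity)]
  calc q ^ M * (M : ℝ) ^ (2 * ψ) ≤ q ^ M * (M : ℝ) ^ k := by gcongr
    _ ≤ max C 1 := by linarith

end LinearRate

/-! ### Linear convergence of the sweeps below a barrier -/

section Sweeps

variable {P : ℕ} {n : Fin P → ℕ}

set_option maxHeartbeats 800000 in
/-- Linear convergence of proximal alternating minimisations, started below a barrier, to a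
critical point at which an error bound holds. -/
theorem exists_sweep_rate (n : Fin P → ℕ) {α : Fin P → ℝ} (hα : ∀ i, 0 < α i) {K c ψ : ℝ}
    (hK : 0 ≤ K) (hc : 0 < c) :
    ∃ C > 0, ∀ {Z : ∀ i : Fin P, Set (EuclideanSpace ℝ (Fin (n i)))} {L : PrimalSpace n → ℝ}
      {G : PrimalSpace n → PrimalSpace n} {zs zi : PrimalSpace n} {d β : ℝ},
      (∀ i, IsCompact (Z i)) → (∀ i, Convex ℝ (Z i)) → IsMultiConvex L →
      (∀ y ∈ productSet Z, HasGradientAt L (G y) y) →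
      (∀ y ∈ productSet Z, ∀ y' ∈ productSet Z, ‖G y - G y'‖ ≤ K * ‖y - y'‖) →
      (∀ y ∈ productSet Z, ‖y - zs‖ = d → β ≤ L y) →
      -G zi ∈ normalCone (productSet Z) zi →
      (∀ y ∈ productSet Z, ‖y - zs‖ ≤ d → ∀ u, u - G y ∈ normalCone (productSet Z) y →
        ‖y - zi‖ ≤ c * ‖u‖) →
      ∀ {ζ : ℕ → PrimalSpace n} {M : ℕ}, ζ 0 ∈ productSet Z → ‖ζ 0 - zs‖ < d → L (ζ 0) < β →
      (∀ l < M, IsSweepOf L Z α (ζ l) (ζ (l + 1))) → 1 ≤ M →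
      ‖ζ M - zi‖ ≤ C * (M : ℝ) ^ (-ψ) * ‖ζ 0 - zi‖ := by
  -- The smallest proximal weight; without blocks any positive value serves.
  obtain ⟨a, ha, haα⟩ : ∃ a > 0, ∀ i, a ≤ α i := by
    rcases isEmpty_or_nonempty (Fin P) with hP | hP
    · exact ⟨1, one_pos, fun i => isEmptyElim i⟩
    · obtain ⟨i, hi⟩ := Finite.exists_min α
      exact ⟨α i, hα i, hi⟩
  set b : ℝ := √(∑ i, (K + α i) ^ 2) with hb
  have hb0 : 0 ≤ b := Real.sqrt_nonneg _
  set e : ℝ := c * b + 1 with he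
  have he0 : 0 < e := by positivity
  set B : ℝ := b * e + K * e ^ 2 + 1 with hB
  have hB0 : 0 < B := by positivity
  set D : ℝ := (2 + K / a) ^ P with hD
  have hD0 : 0 < D := by positivity
  set q : ℝ := 2 * B / (a + 2 * B) with hq
  have hq0 : 0 < q := by positivity
  have hq1 : q < 1 := (div_lt_one (by positivity)).2 (by linarith)
  obtain ⟨C₁, hC₁, hpow⟩ := exists_pow_le_mul_rpow_neg hq0 hq1 ψ
  set C₀ : ℝ := (D ^ 2 + e ^ 2 * (2 / a) * B * (1 + D) ^ 2) / q ^ 2 with hC₀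
  have hC₀0 : 0 < C₀ := by positivity
  refine ⟨√(C₀ * C₁), by positivity, ?_⟩
  intro Z L G zs zi d β hZc hZ hconv hG hGlip hbar hzi herr ζ M hζ0 hζd hζβ hsw hM
  have h𝒵 := convex_productSet hZ
  -- the iterates stay below the barrier
  have hstay : ∀ l ≤ M, ζ l ∈ productSet Z ∧ ‖ζ l - zs‖ < d ∧ L (ζ l) < β := by
    intro l
    induction l with
    | zero => intro _; exact ⟨hζ0, hζd, hζβ⟩
    | succ l ih =>
      intro hl
      obtain ⟨h1, h2, h3⟩ := ih (by omega)
      have hs := hsw l (by omega)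
      obtain ⟨h4, h5⟩ := hs.descent h1 hconv ha.le haα hbar hZ h2 h3
      have : 0 ≤ a / 2 * ‖ζ (l + 1) - ζ l‖ ^ 2 := by positivity
      exact ⟨hs.mem, h5, by linarith⟩
  -- the critical point minimises `L` below the barrier
  have hmin : ∀ y ∈ productSet Z, ‖y - zs‖ ≤ d → L zi ≤ L y := by
    obtain ⟨x, hx, hxmin⟩ := ((isCompact_productSet hZc).inter_right
      (Metric.isClosed_closedBall (x := zs) (ε := d))).exists_isMinOn
      ⟨ζ 0, hζ0, mem_closedBall_iff_norm.2 hζd.le⟩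
      (fun y hy => (hG y hy.1).hasFDerivAt.continuousAt.continuousWithinAt)
    have hxd : ‖x - zs‖ ≤ d := mem_closedBall_iff_norm.1 hx.2
    have hxβ : L x < β := (hxmin ⟨hζ0, mem_closedBall_iff_norm.2 hζd.le⟩).trans_lt hζβ
    -- The barrier keeps the minimiser off the sphere, so it is critical, and the error bound with
    -- `u = 0` identifies it with `zi`.
    have hxd' : ‖x - zs‖ < d := hxd.lt_of_ne fun h => by linarith [hbar x hx.1 h]
    have hxN := neg_gradient_mem_normalCone h𝒵 (hG x hx.1) hx.1 hxd' hxmin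
    have hxi : x = zi := by
      have := herr x hx.1 hxd 0 (by rwa [zero_sub])
      rw [norm_zero, mul_zero] at this
      exact sub_eq_zero.1 (norm_le_zero_iff.1 this)
    intro y hy hyd
    rw [← hxi]
    exact hxmin ⟨hy, mem_closedBall_iff_norm.2 hyd⟩
  have hstep : ∀ l < M, ‖ζ (l + 1) - zi‖ ≤ e * ‖ζ (l + 1) - ζ l‖ ∧
      L (ζ (l + 1)) - L zi ≤ B * ‖ζ (l + 1) - ζ l‖ ^ 2 := by
    intro l hl
    obtain ⟨h1, h2, -⟩ := hstay (l + 1) hl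
    obtain ⟨u, hu, hun⟩ := (hsw l hl).exists_subgradient (hstay l hl.le).1 hZ hK
      (fun i => (hα i).le) hG hGlip
    rw [← hb] at hun
    set s : ℝ := ‖ζ (l + 1) - ζ l‖
    have hs0 : 0 ≤ s := norm_nonneg _
    have h3 : ‖ζ (l + 1) - zi‖ ≤ e * s := by
      calc ‖ζ (l + 1) - zi‖ ≤ c * ‖u‖ := herr _ h1 h2.le u hu
        _ ≤ c * (b * s) := by gcongr
        _ ≤ e * s := by rw [he]; nlinarith
    refine ⟨h3, ?_⟩
    have h4 := (abs_le.1 (abs_sub_sub_inner_le_of_gradient_lipschitz h𝒵 hK hG hGlip h1 hzi.1)).1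
    have h5 := hu.2 _ hzi.1
    rw [inner_sub_left] at h5
    have h6 : -⟪u, zi - ζ (l + 1)⟫_ℝ ≤ b * s * (e * s) := by
      have := (neg_le_abs _).trans (abs_real_inner_le_norm u (zi - ζ (l + 1)))
      refine this.trans ?_
      rw [norm_sub_rev]; gcongr
    have h7 : K * ‖zi - ζ (l + 1)‖ ^ 2 ≤ K * (e * s) ^ 2 := by
      rw [norm_sub_rev]; gcongr
    rw [hB]
    linarith [sq_nonneg s]
  have hmain := norm_sq_sub_le_of_descent (V := fun l => L (ζ l) - L zi) (zi := zi) (M := M)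
    (z := ζ) ha hB0 he0 hD0
    (fun l hl => by
      obtain ⟨h1, h2, h3⟩ := hstay l hl.le
      have := ((hsw l hl).descent h1 hconv ha.le haα hbar hZ h2 h3).1
      linarith)
    (fun l hl => by
      obtain ⟨h1, h2, -⟩ := hstay l hl
      linarith [hmin _ h1 h2.le])
    (fun l hl => (hstep l hl).2) (fun l hl => (hstep l hl).1)
    (fun h0 => (hsw 0 h0).norm_sub_le hζ0 hZ hconv hK hG hGlip ha haα hzi) hM
  rw [← hq, ← hC₀] at hmain
  apply le_of_sq_le_sq _ (by positivity)
  calc ‖ζ M - zi‖ ^ 2 ≤ C₀ * q ^ M * ‖ζ 0 - zi‖ ^ 2 := hmain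
    _ ≤ C₀ * (C₁ * ((M : ℝ) ^ (-ψ)) ^ 2) * ‖ζ 0 - zi‖ ^ 2 := by gcongr; exact hpow M hM
    _ = (√(C₀ * C₁) * (M : ℝ) ^ (-ψ) * ‖ζ 0 - zi‖) ^ 2 := by
        rw [mul_pow, mul_pow, Real.sq_sqrt (by positivity)]; ring

end Sweeps

/-! ### Smoothness of the problem data -/

section MultiAffine

variable {P m : ℕ} {n : Fin P → ℕ}

theorem AffineMap.apply_eq_sum_coord {k : ℕ} {V : Type} [AddCommGroup V] [Module ℝ V]
    (A : EuclideanSpace ℝ (Fin k) →ᵃ[ℝ] V) (x : EuclideanSpace ℝ (Fin k)) :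
    A x = A 0 + ∑ j, x j • (A (EuclideanSpace.single j 1) - A 0) := by
  have h : ∀ y, A y - A 0 = A.linear y := fun y => by
    rw [A.decomp']; simp
  simp only [h]
  have hx : x = ∑ j, x j • EuclideanSpace.single j (1 : ℝ) := by
    have := (EuclideanSpace.basisFun (Fin k) ℝ).sum_repr x
    simpa using this.symm
  have h2 : ∑ j, x j • A.linear (EuclideanSpace.single j 1) = A.linear x := by
    conv_rhs => rw [hx]
    simp only [map_sum, map_smul]
  rw [h2, ← h]
  abel

/-- Multi-affine maps are smooth. -/
theorem IsMultiAffine.contDiff {g : PrimalSpace n → EuclideanSpace ℝ (Fin m)}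
    (h : IsMultiAffine g) {r : WithTop ℕ∞} : ContDiff ℝ r g := by
  classical
  -- Induction on the set `T` of free blocks, the others being frozen at arbitrary values. Freeing
  -- block `i` writes `g` as a combination, linear in the coordinates of that block, of maps in
  -- which it is frozen at `0` or at a unit vector.
  have key : ∀ (T : Finset (Fin P)) (z₀ : PrimalSpace n),
      ContDiff ℝ r fun z : PrimalSpace n =>
        g (WithLp.toLp 2 fun j => if j ∈ T then z j else z₀ j) := by
    intro T
    induction T using Finset.induction_on with
    | empty => intro z₀; simpa using contDiff_const
    | insert i T hi ih =>
      intro z₀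
      have hpt : ∀ (z : PrimalSpace n) (x : EuclideanSpace ℝ (Fin (n i))),
          replaceBlock (WithLp.toLp 2 fun j => if j ∈ T then z j else z₀ j) i x
            = WithLp.toLp 2 fun j => if j ∈ T then z j else replaceBlock z₀ i x j := by
        intro z x
        ext j : 1
        rcases eq_or_ne j i with rfl | hj
        · simp [replaceBlock, hi]
        · simp [replaceBlock, hj]
      have hins : ∀ z : PrimalSpace n,
          (WithLp.toLp 2 fun j => if j ∈ insert i T then z j else z₀ j : PrimalSpace n)
            = replaceBlock (WithLp.toLp 2 fun j => if j ∈ T then z j else z₀ j) i (z i) := by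
        intro z
        ext j : 1
        rcases eq_or_ne j i with rfl | hj
        · simp [replaceBlock]
        · simp [replaceBlock, hj]
      have hform : ∀ z : PrimalSpace n,
          g (WithLp.toLp 2 fun j => if j ∈ insert i T then z j else z₀ j)
            = g (WithLp.toLp 2 fun j => if j ∈ T then z j else replaceBlock z₀ i 0 j)
              + ∑ k, z i k • (g (WithLp.toLp 2 fun j => if j ∈ T then z j else
                    replaceBlock z₀ i (EuclideanSpace.single k 1) j)
                - g (WithLp.toLp 2 fun j => if j ∈ T then z j else replaceBlock z₀ i 0 j)) := by
        intro z
        obtain ⟨A, hA⟩ := h (WithLp.toLp 2 fun j => if j ∈ T then z j else z₀ j) i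
        rw [hins, hA, A.apply_eq_sum_coord]
        simp only [← hA, hpt]
      simp only [hform]
      refine (ih _).add (ContDiff.sum fun k _ => ContDiff.fun_smul ?_ ((ih _).sub (ih _)))
      fun_prop
  simpa using key Finset.univ 0

end MultiAffine

section Smoothness

variable {E V : Type} [NormedAddCommGroup E] [InnerProductSpace ℝ E] [CompleteSpace E]
  [NormedAddCommGroup V] [InnerProductSpace ℝ V] [CompleteSpace V]

theorem ContDiff.gradient {f : E → ℝ} (hf : ContDiff ℝ 2 f) : ContDiff ℝ 1 (gradient f) :=
  (InnerProductSpace.toDual ℝ E).symm.contDiff.comp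
    (hf.fderiv_right (m := 1) (by norm_num))

/-- The adjoint as a real-linear map. -/
noncomputable def adjointCLM (E V : Type) [NormedAddCommGroup E] [InnerProductSpace ℝ E]
    [CompleteSpace E] [NormedAddCommGroup V] [InnerProductSpace ℝ V] [CompleteSpace V] :
    (E →L[ℝ] V) →L[ℝ] (V →L[ℝ] E) :=
  LinearMap.mkContinuous
    { toFun := fun A => A.adjoint
      map_add' := fun A B => map_add _ A B
      map_smul' := fun c A => by simp } 1
    (fun A => by simp)

/-- The map `(z, μ) ↦ (∇f(z) + ∇g(z)ᵀ μ, g(z))` is continuously differentiable. -/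
theorem contDiff_lagrangeMap {f : E → ℝ} {g : E → V} (hf : ContDiff ℝ 2 f)
    (hg : ContDiff ℝ 2 g) :
    ContDiff ℝ 1 fun w : WithLp 2 (E × V) =>
      (WithLp.toLp 2 (_root_.gradient f w.fst + (fderiv ℝ g w.fst).adjoint w.snd, g w.fst) :
        WithLp 2 (E × V)) := by
  have hfst : ContDiff ℝ 1 fun w : WithLp 2 (E × V) => w.fst :=
    contDiff_fst.comp (WithLp.prodContinuousLinearEquiv 2 ℝ E V).contDiff
  have hsnd : ContDiff ℝ 1 fun w : WithLp 2 (E × V) => w.snd :=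
    contDiff_snd.comp (WithLp.prodContinuousLinearEquiv 2 ℝ E V).contDiff
  have h1 : ContDiff ℝ 1 fun w : WithLp 2 (E × V) => (fderiv ℝ g w.fst).adjoint w.snd :=
    (((adjointCLM E V).contDiff.comp (hg.fderiv_right (m := 1) (by norm_num))).comp
      hfst).clm_apply hsnd
  exact (WithLp.prodContinuousLinearEquiv 2 ℝ E V).symm.contDiff.comp
    (((hf.gradient.comp hfst).add h1).prodMk ((hg.of_le (by norm_num)).comp hfst))

end Smoothness

/-! ### Uniform bounds on compact sets -/

section Bounds

/-- Continuously differentiable maps are bounded and Lipschitz on compact convex sets. -/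
theorem ContDiff.exists_bound_lipschitz {E W : Type} [NormedAddCommGroup E] [NormedSpace ℝ E]
    [NormedAddCommGroup W] [NormedSpace ℝ W]
    {F : E → W} (hF : ContDiff ℝ 1 F) {𝒵 : Set E} (hc : IsCompact 𝒵) (hconv : Convex ℝ 𝒵) :
    ∃ K, (∀ z ∈ 𝒵, ‖F z‖ ≤ K) ∧ ∀ z ∈ 𝒵, ∀ z' ∈ 𝒵, ‖F z - F z'‖ ≤ K * ‖z - z'‖ := by
  obtain ⟨K₁, hK₁⟩ := hc.exists_bound_of_continuousOn hF.continuous.continuousOn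
  obtain ⟨K₂, hK₂⟩ := hc.exists_bound_of_continuousOn
    (hF.continuous_fderiv (by norm_num)).continuousOn
  refine ⟨max K₁ K₂, fun z hz => (hK₁ z hz).trans (le_max_left _ _), fun z hz z' hz' => ?_⟩
  exact norm_image_sub_le_of_hasFDerivAt_bound hconv
    (fun x _ => (hF.differentiable (by norm_num) x).hasFDerivAt)
    (fun x hx => (hK₂ x hx).trans (le_max_right _ _)) hz hz'

variable {E V : Type} [NormedAddCommGroup E] [InnerProductSpace ℝ E] [CompleteSpace E]
  [NormedAddCommGroup V] [InnerProductSpace ℝ V]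

theorem ProblemBounds.mono {𝒵 : Set E} {f : E → ℝ} {Gf : E → E} {A : E → E →L[ℝ] V} {K K' : ℝ}
    (h : ProblemBounds 𝒵 f Gf A K) (hK : K ≤ K') : ProblemBounds 𝒵 f Gf A K' where
  convex := h.convex
  compact := h.compact
  one_le := h.one_le.trans hK
  diam z hz z' hz' := (h.diam z hz z' hz').trans hK
  hasGradient := h.hasGradient
  gradient_le z hz := (h.gradient_le z hz).trans hK
  gradient_lip z hz z' hz' := (h.gradient_lip z hz z' hz').trans (by gcongr)
  deriv_le z hz := (h.deriv_le z hz).trans hK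
  deriv_lip z hz z' hz' := (h.deriv_lip z hz z' hz').trans (by gcongr)

theorem exists_problemBounds {f : E → ℝ} {g : E → V} (hf : ContDiff ℝ 2 f)
    (hg : ContDiff ℝ 2 g) {𝒵 : Set E} (hc : IsCompact 𝒵) (hconv : Convex ℝ 𝒵) :
    ∃ K, ProblemBounds 𝒵 f (_root_.gradient f) (fderiv ℝ g) K := by
  obtain ⟨K₁, h1, h2⟩ := hf.gradient.exists_bound_lipschitz hc hconv
  obtain ⟨K₂, h3, h4⟩ := (hg.fderiv_right (m := 1) (by norm_num)).exists_bound_lipschitz hc hconv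
  obtain ⟨K₃, h5⟩ := Metric.isBounded_iff.1 hc.isBounded
  set K := max (max 1 K₁) (max K₂ K₃)
  have l1 : K₁ ≤ K := (le_max_right _ _).trans (le_max_left _ _)
  have l2 : K₂ ≤ K := (le_max_left _ _).trans (le_max_right _ _)
  have l3 : K₃ ≤ K := (le_max_right _ _).trans (le_max_right _ _)
  exact ⟨K,
    { convex := hconv
      compact := hc
      one_le := (le_max_left _ _).trans (le_max_left _ _)
      diam := fun z hz z' hz' => by rw [← dist_eq_norm]; exact (h5 hz hz').trans l3
      hasGradient := fun z _ => (hf.differentiable (by norm_num) z).hasGradientAt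
      gradient_le := fun z hz => (h1 z hz).trans l1
      gradient_lip := fun z hz z' hz' => (h2 z hz z' hz').trans (by gcongr)
      deriv_le := fun z hz => (h3 z hz).trans l2
      deriv_lip := fun z hz z' hz' => (h4 z hz z' hz').trans (by gcongr) }⟩

/-- The uniform linearisation error of a continuously differentiable map on a bounded set. -/
theorem ContDiff.exists_linearization_error {H : Type} [NormedAddCommGroup H] [NormedSpace ℝ H]
    [ProperSpace H] {F : H → H} (hF : ContDiff ℝ 1 F) (B : ℝ) {ε : ℝ} (hε : 0 < ε) :
    ∃ δ > 0, ∀ x₀, ‖x₀‖ ≤ B → ∀ x x', ‖x - x₀‖ < δ → ‖x' - x₀‖ < δ →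
      ‖F x - F x' - fderiv ℝ F x₀ (x - x')‖ ≤ ε * ‖x - x'‖ := by
  -- Heine–Cantor on a ball enlarged by one, so that it contains the unit balls around all
  -- admissible `x₀`.
  have huc := (isCompact_closedBall (0 : H) (B + 1)).uniformContinuousOn_of_continuous
    (hF.continuous_fderiv (by norm_num)).continuousOn
  obtain ⟨δ, hδ, H1⟩ := Metric.uniformContinuousOn_iff.1 huc ε hε
  refine ⟨min δ 1, by positivity, fun x₀ hx₀ x x' hx hx' => ?_⟩
  refine (convex_ball x₀ (min δ 1)).norm_image_sub_le_of_norm_hasFDerivWithin_le'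
    (f' := fderiv ℝ F) (fun y _ => (hF.differentiable (by norm_num) y).hasFDerivAt.hasFDerivWithinAt)
    (fun y hy => ?_) (mem_ball_iff_norm.2 hx') (mem_ball_iff_norm.2 hx)
  rw [← dist_eq_norm]
  have hy' := mem_ball_iff_norm.1 hy
  refine (H1 y ?_ x₀ ?_ ((Metric.mem_ball.1 hy).trans_le (min_le_left _ _))).le
  · rw [mem_closedBall_zero_iff]
    have : y = (y - x₀) + x₀ := by abel
    rw [this]
    exact (norm_add_le _ _).trans (by linarith [min_le_right δ 1])
  · rw [mem_closedBall_zero_iff]; linarith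

end Bounds

/-! ### Maps differing by a constant; perturbed linearisations -/

section ConstantDifference

/-- Derivatives of maps that differ by a constant on a convex set agree in the feasible
directions. -/
theorem fderiv_apply_sub_eq_of_eqOn_add_const {H W : Type} [NormedAddCommGroup H]
    [NormedSpace ℝ H] [NormedAddCommGroup W] [NormedSpace ℝ W] {F₁ F₂ : H → W} {C : Set H}
    (hC : Convex ℝ C) {x₀ x : H} (hx₀ : x₀ ∈ C) (hx : x ∈ C) (h₁ : DifferentiableAt ℝ F₁ x₀)
    (h₂ : DifferentiableAt ℝ F₂ x₀) {b : W} (hb : ∀ y ∈ C, F₁ y = F₂ y + b) :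
    fderiv ℝ F₁ x₀ (x - x₀) = fderiv ℝ F₂ x₀ (x - x₀) := by
  have e1 : HasFDerivWithinAt F₁ (fderiv ℝ F₁ x₀) C x₀ := h₁.hasFDerivAt.hasFDerivWithinAt
  have e2 : HasFDerivWithinAt F₁ (fderiv ℝ F₂ x₀) C x₀ :=
    (h₂.hasFDerivAt.hasFDerivWithinAt.add_const b).congr hb (hb x₀ hx₀)
  exact e1.unique_on e2 (mem_tangentConeAt_of_segment_subset (hC.segment_subset hx₀ hx))

/-- Linear growth along a line contradicts boundedness. It is applied to the difference of adjoint
derivatives at two parameters. -/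
theorem ContinuousLinearMap.apply_eq_zero_of_forall_smul_le {V W : Type} [NormedAddCommGroup V]
    [NormedSpace ℝ V] [NormedAddCommGroup W] [NormedSpace ℝ W] (B : V →L[ℝ] W) {K : ℝ} {v : V}
    (h : ∀ c : ℝ, ‖B (c • v)‖ ≤ K) : B v = 0 := by
  by_contra hne
  have hpos : 0 < ‖B v‖ := norm_pos_iff.2 hne
  have h1 := h ((|K| + 1) / ‖B v‖)
  rw [map_smul, norm_smul, Real.norm_of_nonneg (by positivity), div_mul_cancel₀ _ hpos.ne'] at h1
  linarith [le_abs_self K]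

end ConstantDifference

section Perturbation

variable {H : Type} [NormedAddCommGroup H] [InnerProductSpace ℝ H] {Φ Ψ Θ : H → H} {C : Set H}
  {x₀ : H} {ε τ δ δ' : ℝ}

theorem isCloseToLinearization_linearization (Φ : H → H) (C : Set H) (x₀ : H) (δ : ℝ) :
    IsCloseToLinearization Φ (linearization Φ x₀) C x₀ 0 δ where
  apply_self := linearization_self Φ x₀
  lipschitz x _ x' _ _ _ := by simp

theorem IsCloseToLinearization.add (h : IsCloseToLinearization Φ Ψ C x₀ ε δ) (hΘ : Θ x₀ = 0)
    (hlip : ∀ x x', ‖Θ x - Θ x'‖ ≤ τ * ‖x - x'‖) :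
    IsCloseToLinearization Φ (fun x => Ψ x + Θ x) C x₀ (ε + τ) δ where
  apply_self := by simp [hΘ, h.apply_self]
  lipschitz x hx x' hx' hxδ hxδ' := by
    have e : (Ψ x + Θ x - linearization Φ x₀ x) - (Ψ x' + Θ x' - linearization Φ x₀ x')
        = ((Ψ x - linearization Φ x₀ x) - (Ψ x' - linearization Φ x₀ x')) + (Θ x - Θ x') := by
      abel
    rw [e, add_mul]
    exact (norm_add_le _ _).trans (add_le_add (h.lipschitz x hx x' hx' hxδ hxδ') (hlip x x'))

theorem IsCloseToLinearization.mono (h : IsCloseToLinearization Φ Ψ C x₀ ε δ) {ε' : ℝ}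
    (hε : ε ≤ ε') (hδ : δ' ≤ δ) : IsCloseToLinearization Φ Ψ C x₀ ε' δ' where
  apply_self := h.apply_self
  lipschitz x hx x' hx' hxδ hxδ' :=
    (h.lipschitz x hx x' hx' (hxδ.trans_le hδ) (hxδ'.trans_le hδ)).trans (by gcongr)

end Perturbation

/-! ### Rigidity in the parameter -/

section ParametricProgram

variable {P m p : ℕ} {n : Fin P → ℕ}

/-- The standing assumptions on the parametric program. -/
structure IsParametricProgram (f : PrimalSpace n → ℝ)
    (g : PrimalSpace n → EuclideanSpace ℝ (Fin p) → EuclideanSpace ℝ (Fin m))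
    (Z : ∀ i : Fin P, Set (EuclideanSpace ℝ (Fin (n i)))) (S : Set (EuclideanSpace ℝ (Fin p)))
    (lamF : ℝ) : Prop where
  contDiff : ContDiff ℝ 2 f
  multiConvex : IsMultiConvex f
  multiAffine : ∀ s ∈ S, IsMultiAffine (fun z => g z s)
  isCompact : ∀ i, IsCompact (Z i)
  convex : ∀ i, Convex ℝ (Z i)
  lipschitz : ∀ w ∈ primalDualSet m Z, ∀ s₁ ∈ S, ∀ s₂ ∈ S,
    ‖kktMap f g s₁ w - kktMap f g s₂ w‖ ≤ lamF * ‖s₁ - s₂‖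

variable {f : PrimalSpace n → ℝ}
  {g : PrimalSpace n → EuclideanSpace ℝ (Fin p) → EuclideanSpace ℝ (Fin m)}
  {Z : ∀ i : Fin P, Set (EuclideanSpace ℝ (Fin (n i)))} {S : Set (EuclideanSpace ℝ (Fin p))}
  {lamF : ℝ}

theorem norm_pdPoint_zero_left (v : EuclideanSpace ℝ (Fin m)) :
    ‖pdPoint (0 : PrimalSpace n) v‖ = ‖v‖ := WithLp.norm_toLp_zero_left v

theorem convex_primalDualSet (hZ : ∀ i, Convex ℝ (Z i)) : Convex ℝ (primalDualSet m Z) := by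
  intro x hx y hy a b ha hb hab
  exact convex_productSet hZ hx hy ha hb hab

theorem isClosed_primalDualSet (hZ : ∀ i, IsCompact (Z i)) : IsClosed (primalDualSet m Z) :=
  (isCompact_productSet hZ).isClosed.preimage
    (continuous_fst.comp (WithLp.prodContinuousLinearEquiv 2 ℝ (PrimalSpace n)
      (EuclideanSpace ℝ (Fin m))).continuous)

namespace IsParametricProgram

variable (h : IsParametricProgram f g Z S lamF)
include h

theorem contDiff_constraint {s : EuclideanSpace ℝ (Fin p)} (hs : s ∈ S) :
    ContDiff ℝ 2 fun z => g z s := (h.multiAffine s hs).contDiff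

theorem contDiff_kktMap {s : EuclideanSpace ℝ (Fin p)} (hs : s ∈ S) :
    ContDiff ℝ 1 (kktMap f g s) :=
  contDiff_lagrangeMap h.contDiff (h.contDiff_constraint hs)

/-- The difference of the KKT maps at `(z, c • μ)` has first component `c • (A₁ᵀ - A₂ᵀ) μ`, bounded
by `lamF * ‖s₁ - s₂‖` for every real `c`; it must vanish. -/
theorem fderiv_eq {s₁ s₂ : EuclideanSpace ℝ (Fin p)} (h₁ : s₁ ∈ S) (h₂ : s₂ ∈ S)
    {z : PrimalSpace n} (hz : z ∈ productSet Z) :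
    fderiv ℝ (fun z => g z s₁) z = fderiv ℝ (fun z => g z s₂) z := by
  set A₁ := fderiv ℝ (fun z => g z s₁) z with hA₁
  set A₂ := fderiv ℝ (fun z => g z s₂) z with hA₂
  have key : ∀ μ, (A₁.adjoint - A₂.adjoint) μ = 0 := by
    intro μ
    refine ContinuousLinearMap.apply_eq_zero_of_forall_smul_le _ (K := lamF * ‖s₁ - s₂‖)
      fun c => ?_
    have h1 := h.lipschitz (pdPoint z (c • μ)) hz s₁ h₁ s₂ h₂
    refine le_trans ?_ ((WithLp.norm_fst_le_norm _).trans h1)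
    apply le_of_eq
    change _ = ‖(gradient f z + A₁.adjoint (c • μ)) - (gradient f z + A₂.adjoint (c • μ))‖
    rw [add_sub_add_left_eq_sub]
    rfl
  have h2 : A₁.adjoint = A₂.adjoint := by
    ext1 μ
    exact sub_eq_zero.1 (key μ)
  exact ContinuousLinearMap.adjoint.injective h2

theorem norm_constraint_sub_le {s₁ s₂ : EuclideanSpace ℝ (Fin p)} (h₁ : s₁ ∈ S) (h₂ : s₂ ∈ S)
    {z : PrimalSpace n} (hz : z ∈ productSet Z) : ‖g z s₁ - g z s₂‖ ≤ lamF * ‖s₁ - s₂‖ :=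
  (WithLp.norm_snd_le_norm (kktMap f g s₁ (pdPoint z 0) - kktMap f g s₂ (pdPoint z 0))).trans
    (h.lipschitz (pdPoint z 0) hz s₁ h₁ s₂ h₂)

/-- The difference has zero derivative on the convex set `𝒵`. -/
theorem constraint_sub_eq {s₁ s₂ : EuclideanSpace ℝ (Fin p)} (h₁ : s₁ ∈ S) (h₂ : s₂ ∈ S)
    {z z' : PrimalSpace n} (hz : z ∈ productSet Z) (hz' : z' ∈ productSet Z) :
    g z s₁ - g z s₂ = g z' s₁ - g z' s₂ := by
  have := norm_image_sub_le_of_hasFDerivAt_bound (convex_productSet h.convex)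
    (F := fun z => g z s₁ - g z s₂) (K := 0)
    (fun z _ => ((h.contDiff_constraint h₁).differentiable (by norm_num) z).hasFDerivAt.sub
      ((h.contDiff_constraint h₂).differentiable (by norm_num) z).hasFDerivAt)
    (fun z hz => by rw [h.fderiv_eq h₁ h₂ hz, sub_self, norm_zero]) hz hz'
  rw [zero_mul] at this
  exact sub_eq_zero.1 (norm_le_zero_iff.1 this)

/-- The parameter acts on the KKT map by a constant shift of the second component. The base point
`z` is free; it is taken at the tracked solution later. -/
theorem kktMap_eq {s₁ s₂ : EuclideanSpace ℝ (Fin p)} (h₁ : s₁ ∈ S) (h₂ : s₂ ∈ S)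
    {w : PrimalDualSpace n m} (hw : w ∈ primalDualSet m Z) {z : PrimalSpace n}
    (hz : z ∈ productSet Z) :
    kktMap f g s₁ w = kktMap f g s₂ w + pdPoint 0 (g z s₁ - g z s₂) := by
  rw [← h.constraint_sub_eq h₁ h₂ (show w.fst ∈ productSet Z from hw) hz]
  unfold kktMap
  rw [h.fderiv_eq h₁ h₂ (show w.fst ∈ productSet Z from hw)]
  apply (WithLp.equiv 2 _).injective
  refine Prod.ext ?_ ?_
  · change _ = _ + (0 : PrimalSpace n)
    rw [add_zero]; rfl
  · change g w.fst s₁ = g w.fst s₂ + (g w.fst s₁ - g w.fst s₂)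
    abel

/-- The linearisation error of the KKT map is uniformly small near bounded sets. -/
theorem exists_isCloseToLinearization {s₀ : EuclideanSpace ℝ (Fin p)} (hs₀ : s₀ ∈ S) (B : ℝ)
    {ε : ℝ} (hε : 0 < ε) : ∃ δ > 0, ∀ s ∈ S, ∀ w₀ ∈ primalDualSet m Z, ‖w₀‖ ≤ B →
      IsCloseToLinearization (kktMap f g s) (kktMap f g s) (primalDualSet m Z) w₀ ε δ := by
  obtain ⟨δ, hδ, H⟩ := (h.contDiff_kktMap hs₀).exists_linearization_error B hε
  refine ⟨δ, hδ, fun s hs w₀ hw₀ hw₀B => ⟨rfl, fun x hx x' hx' hxδ hxδ' => ?_⟩⟩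
  refine le_trans (le_of_eq ?_) (H w₀ hw₀B x x' hxδ hxδ')
  -- The radius comes from the single map at `s₀`. The maps at `s` and `s₀` differ by a constant on
  -- `𝒵 × ℝ^m` only, which may have empty interior, so their derivatives are compared in feasible
  -- directions.
  have hd : ∀ y ∈ primalDualSet m Z,
      fderiv ℝ (kktMap f g s) w₀ (y - w₀) = fderiv ℝ (kktMap f g s₀) w₀ (y - w₀) :=
    fun y hy => fderiv_apply_sub_eq_of_eqOn_add_const (convex_primalDualSet h.convex) hw₀ hy
      ((h.contDiff_kktMap hs).differentiable (by norm_num) w₀)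
      ((h.contDiff_kktMap hs₀).differentiable (by norm_num) w₀)
      (fun y hy => h.kktMap_eq hs hs₀ hy hw₀)
  congr 1
  unfold linearization
  rw [hd x hx, hd x' hx', h.kktMap_eq hs hs₀ hx hw₀, h.kktMap_eq hs hs₀ hx' hw₀,
    h.kktMap_eq hs hs₀ hw₀ hw₀]
  have : fderiv ℝ (kktMap f g s₀) w₀ (x - x')
      = fderiv ℝ (kktMap f g s₀) w₀ (x - w₀) - fderiv ℝ (kktMap f g s₀) w₀ (x' - w₀) := by
    rw [← map_sub, sub_sub_sub_cancel_right]
  rw [this]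
  generalize fderiv ℝ (kktMap f g s₀) w₀ (x - w₀) = a
  generalize fderiv ℝ (kktMap f g s₀) w₀ (x' - w₀) = b
  abel

end IsParametricProgram

/-- The KKT map with a proximal term of weight `τ` on the multiplier. -/
noncomputable def regKKTMap (f : PrimalSpace n → ℝ)
    (g : PrimalSpace n → EuclideanSpace ℝ (Fin p) → EuclideanSpace ℝ (Fin m)) (τ : ℝ)
    (μs : EuclideanSpace ℝ (Fin m)) (s : EuclideanSpace ℝ (Fin p)) (w : PrimalDualSpace n m) :
    PrimalDualSpace n m :=
  kktMap f g s w + pdPoint 0 (τ • (μs - w.snd))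

theorem norm_prox_sub_le {τ : ℝ} (hτ : 0 ≤ τ) (μs : EuclideanSpace ℝ (Fin m))
    (w w' : PrimalDualSpace n m) :
    ‖pdPoint (0 : PrimalSpace n) (τ • (μs - w.snd)) - pdPoint 0 (τ • (μs - w'.snd))‖
      ≤ τ * ‖w - w'‖ := by
  have e : pdPoint (0 : PrimalSpace n) (τ • (μs - w.snd)) - pdPoint 0 (τ • (μs - w'.snd))
      = pdPoint 0 (-(τ • (w - w').snd)) := by
    apply (WithLp.equiv 2 _).injective
    refine Prod.ext (sub_self (0 : PrimalSpace n)) ?_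
    change τ • (μs - w.snd) - τ • (μs - w'.snd) = -(τ • (w.snd - w'.snd))
    module
  rw [e, norm_pdPoint_zero_left, norm_neg, norm_smul, Real.norm_of_nonneg hτ]
  gcongr
  exact WithLp.norm_snd_le_norm _

theorem pdPoint_prox_self (τ : ℝ) (w : PrimalDualSpace n m) :
    pdPoint (0 : PrimalSpace n) (τ • (w.snd - w.snd)) = 0 := by
  rw [sub_self, smul_zero]; rfl

/-- Separates the proximal term, which perturbs the map, from `d`, which only shifts the right-hand
side. -/
theorem auxMap_eq (ρ : ℝ) (μs d : EuclideanSpace ℝ (Fin m)) (s : EuclideanSpace ℝ (Fin p))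
    (w : PrimalDualSpace n m) :
    auxMap f g ρ μs d s w = regKKTMap f g ρ⁻¹ μs s w + pdPoint 0 d := by
  apply (WithLp.equiv 2 _).injective
  refine Prod.ext ?_ ?_
  · change _ = gradient f w.fst + (fderiv ℝ (fun z => g z s) w.fst).adjoint w.snd + 0 + 0
    rw [add_zero, add_zero]; rfl
  · change g w.fst s + d + ρ⁻¹ • (μs - w.snd) = g w.fst s + ρ⁻¹ • (μs - w.snd) + d
    abel

theorem solvesGE_regKKTMap_iff {τ : ℝ} {μs μ : EuclideanSpace ℝ (Fin m)}
    {s : EuclideanSpace ℝ (Fin p)} {z u : PrimalSpace n} {v : EuclideanSpace ℝ (Fin m)} :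
    SolvesGE (regKKTMap f g τ μs s) (primalDualSet m Z) (pdPoint u v) (pdPoint z μ) ↔
      IsLagrangeStationary (productSet Z) (gradient f) (fderiv ℝ fun z => g z s) z μ u ∧
        g z s + τ • (μs - μ) = v := by
  unfold SolvesGE IsLagrangeStationary
  refine mem_normalCone_prod_iff.trans (and_congr ?_ ?_)
  · change u - (_ + 0) ∈ normalCone (productSet Z) z ↔ _
    rw [add_zero]; rfl
  · change v - (g z s + τ • (μs - μ)) = 0 ↔ _
    rw [sub_eq_zero, eq_comm]

end ParametricProgram

/-! ### Uniform stability of the regularised KKT system -/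

section ParametricProgramStability

variable {P m p : ℕ} {n : Fin P → ℕ} {f : PrimalSpace n → ℝ}
  {g : PrimalSpace n → EuclideanSpace ℝ (Fin p) → EuclideanSpace ℝ (Fin m)}
  {Z : ∀ i : Fin P, Set (EuclideanSpace ℝ (Fin (n i)))} {S : Set (EuclideanSpace ℝ (Fin p))}
  {lamF : ℝ}

theorem regKKTMap_zero (μs : EuclideanSpace ℝ (Fin m)) (s : EuclideanSpace ℝ (Fin p))
    (w : PrimalDualSpace n m) : regKKTMap f g 0 μs s w = kktMap f g s w := by
  unfold regKKTMap
  rw [zero_smul]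
  exact add_zero _

theorem pdPoint_zero_add (v v' : EuclideanSpace ℝ (Fin m)) :
    pdPoint (0 : PrimalSpace n) (v + v') = pdPoint 0 v + pdPoint 0 v' := by
  apply (WithLp.equiv 2 _).injective
  exact Prod.ext (add_zero (0 : PrimalSpace n)).symm rfl

theorem pdPoint_zero_neg (v : EuclideanSpace ℝ (Fin m)) :
    pdPoint (0 : PrimalSpace n) (-v) = -pdPoint 0 v := by
  apply (WithLp.equiv 2 _).injective
  exact Prod.ext (neg_zero (G := PrimalSpace n)).symm rfl

theorem pdPoint_zero_sub (v v' : EuclideanSpace ℝ (Fin m)) :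
    pdPoint (0 : PrimalSpace n) (v - v') = pdPoint 0 v - pdPoint 0 v' := by
  rw [sub_eq_add_neg, pdPoint_zero_add, pdPoint_zero_neg, ← sub_eq_add_neg]

theorem isKKT_iff {s : EuclideanSpace ℝ (Fin p)} {w : PrimalDualSpace n m} :
    IsKKT f g Z s w ↔
      IsLagrangeStationary (productSet Z) (gradient f) (fderiv ℝ fun z => g z s) w.fst w.snd 0 ∧
        g w.fst s = 0 := by
  have h := solvesGE_regKKTMap_iff (f := f) (g := g) (Z := Z) (τ := 0) (μs := w.snd) (s := s)
    (z := w.fst) (μ := w.snd) (u := 0) (v := 0)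
  rw [zero_smul, add_zero] at h
  rw [← h]
  unfold IsKKT SolvesGE
  rw [regKKTMap_zero]
  rfl

theorem solvesAux_iff {ρ : ℝ} {μs d : EuclideanSpace ℝ (Fin m)}
    {s : EuclideanSpace ℝ (Fin p)} {w : PrimalDualSpace n m} :
    SolvesAux f g Z ρ μs d s w ↔
      IsLagrangeStationary (productSet Z) (gradient f) (fderiv ℝ fun z => g z s) w.fst w.snd 0 ∧
        g w.fst s + d + ρ⁻¹ • (μs - w.snd) = 0 := by
  have h := solvesGE_regKKTMap_iff (f := f) (g := g) (Z := Z) (τ := ρ⁻¹) (μs := μs) (s := s)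
    (z := w.fst) (μ := w.snd) (u := 0) (v := -d)
  have e : g w.fst s + d + ρ⁻¹ • (μs - w.snd) = 0 ↔ g w.fst s + ρ⁻¹ • (μs - w.snd) = -d := by
    rw [add_right_comm, add_eq_zero_iff_eq_neg]
  rw [e, ← h]
  unfold SolvesAux SolvesGE
  rw [auxMap_eq, pdPoint_zero_neg, zero_sub, neg_add_rev, ← sub_eq_add_neg]
  rfl

/-- The prox term as a linear map. -/
noncomputable def proxCLM (n : Fin P → ℕ) (m : ℕ) (τ : ℝ) :
    PrimalDualSpace n m →L[ℝ] PrimalDualSpace n m :=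
  (-τ) • ((WithLp.prodContinuousLinearEquiv 2 ℝ (PrimalSpace n)
    (EuclideanSpace ℝ (Fin m))).symm.toContinuousLinearMap.comp
      ((ContinuousLinearMap.inr ℝ (PrimalSpace n) (EuclideanSpace ℝ (Fin m))).comp
        ((ContinuousLinearMap.snd ℝ (PrimalSpace n) (EuclideanSpace ℝ (Fin m))).comp
          (WithLp.prodContinuousLinearEquiv 2 ℝ (PrimalSpace n)
            (EuclideanSpace ℝ (Fin m))).toContinuousLinearMap)))

theorem proxCLM_apply (τ : ℝ) (w w₀ : PrimalDualSpace n m) :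
    proxCLM n m τ (w - w₀) = pdPoint 0 (τ • (w₀.snd - w.snd)) := by
  apply (WithLp.equiv 2 _).injective
  refine Prod.ext ?_ ?_
  · change (-τ) • (0 : PrimalSpace n) = 0
    rw [smul_zero]
  · change (-τ) • (w.snd - w₀.snd) = τ • (w₀.snd - w.snd)
    module

namespace IsParametricProgram

variable (h : IsParametricProgram f g Z S lamF)
include h

theorem snd_fderiv_kktMap {s : EuclideanSpace ℝ (Fin p)} (hs : s ∈ S)
    (w v : PrimalDualSpace n m) :
    (fderiv ℝ (kktMap f g s) w v).snd = fderiv ℝ (fun z => g z s) w.fst v.fst := by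
  set e := WithLp.prodContinuousLinearEquiv 2 ℝ (PrimalSpace n) (EuclideanSpace ℝ (Fin m))
  have h1 : HasFDerivAt (fun w => (kktMap f g s w).snd)
      (((ContinuousLinearMap.snd ℝ _ _).comp e.toContinuousLinearMap).comp
        (fderiv ℝ (kktMap f g s) w)) w :=
    ((ContinuousLinearMap.snd ℝ _ _).comp e.toContinuousLinearMap).hasFDerivAt.comp w
      ((h.contDiff_kktMap hs).differentiable (by norm_num) w).hasFDerivAt
  have h2 : HasFDerivAt (fun w : PrimalDualSpace n m => g w.fst s)
      ((fderiv ℝ (fun z => g z s) w.fst).comp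
        ((ContinuousLinearMap.fst ℝ _ _).comp e.toContinuousLinearMap)) w :=
    HasFDerivAt.comp (g := fun z => g z s) w
      ((h.contDiff_constraint hs).differentiable (by norm_num) w.fst).hasFDerivAt
      ((ContinuousLinearMap.fst ℝ _ _).comp e.toContinuousLinearMap).hasFDerivAt
  exact congrArg (fun A => A v) (h1.unique h2)

/-- Strong regularity implies a constraint qualification. -/
theorem qualification {s : EuclideanSpace ℝ (Fin p)} (hs : s ∈ S) {w : PrimalDualSpace n m}
    {η κ l : ℝ} (hreg : IsStronglyRegularWith (kktMap f g s) (primalDualSet m Z) w η κ l)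
    {r : EuclideanSpace ℝ (Fin m)} (hr : ‖r‖ < η) :
    ∃ z ∈ productSet Z, fderiv ℝ (fun z => g z s) w.fst (z - w.fst) = r := by
  -- The linearised equation is solved for the right-hand side `(0, r)`; as the multiplier is free,
  -- its second component holds with equality.
  obtain ⟨x, ⟨-, hx⟩, -⟩ := hreg.existsUnique (pdPoint 0 r) (by rwa [norm_pdPoint_zero_left])
  refine ⟨x.fst, hx.mem, ?_⟩
  have h1 := (mem_normalCone_prod_iff.1 hx).2
  have h2 : g w.fst s = 0 := (isKKT_iff.1 hreg.solves).2
  change r - (g w.fst s + (fderiv ℝ (kktMap f g s) w (x - w)).snd) = 0 at h1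
  rw [h2, zero_add, h.snd_fderiv_kktMap hs, sub_eq_zero] at h1
  exact h1.symm

/-- The qualification yields `z ∈ 𝒵` whose linearised constraint value is `-(η / 2) μ / ‖μ‖`.
Testing stationarity at `z` bounds `(η / 2) * ‖μ‖` by `⟪∇f, z - z*⟫ ≤ K ^ 2`. -/
theorem norm_multiplier_le {s₀ s : EuclideanSpace ℝ (Fin p)} (hs : s ∈ S)
    {K : ℝ} (hB : ProblemBounds (productSet Z) f (gradient f) (fderiv ℝ fun z => g z s₀) K)
    {w : PrimalDualSpace n m} {η κ l : ℝ} (hη : 0 < η)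
    (hreg : IsStronglyRegularWith (kktMap f g s) (primalDualSet m Z) w η κ l) :
    ‖w.snd‖ ≤ 2 * K ^ 2 / η := by
  have hK := hB.one_le
  rcases (norm_nonneg w.snd).eq_or_lt with h0 | h0
  · rw [← h0]; positivity
  obtain ⟨z, hz, hzr⟩ := h.qualification hs hreg (r := -((η / 2 / ‖w.snd‖) • w.snd)) (by
    rw [norm_neg, norm_smul, Real.norm_of_nonneg (by positivity)]
    field_simp; linarith)
  have hw : w.fst ∈ productSet Z := hreg.solves.mem
  have h1 := (isKKT_iff.1 hreg.solves).1.2 z hz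
  rw [zero_sub, inner_neg_left, inner_add_left, ContinuousLinearMap.adjoint_inner_left, hzr,
    inner_neg_right, inner_smul_right, real_inner_self_eq_norm_sq] at h1
  have h2 : ⟪gradient f w.fst, z - w.fst⟫_ℝ ≤ K * K :=
    (real_inner_le_norm _ _).trans (by
      gcongr
      exacts [hB.gradient_le _ hw, hB.diam _ hz _ hw])
  have h3 : η / 2 / ‖w.snd‖ * ‖w.snd‖ ^ 2 = η / 2 * ‖w.snd‖ := by field_simp
  rw [le_div_iff₀ hη]
  linarith

/-- Stability of the regularised KKT system, uniformly over bounded families of strongly regular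
KKT points and small regularisation parameters. -/
theorem exists_uniform_stability {s : ℕ → EuclideanSpace ℝ (Fin p)} (hs : ∀ k, s k ∈ S)
    {wstar : ℕ → PrimalDualSpace n m} {η κ l B : ℝ} (hη : 0 < η) (hκ : 0 < κ)
    (hreg : ∀ k, IsStronglyRegularWith (kktMap f g (s k)) (primalDualSet m Z) (wstar k) η κ l)
    (hB : ∀ k, ‖wstar k‖ ≤ B) :
    ∃ δ > 0, ∃ σ > 0, ∃ L > 0, ∃ τ₀ > 0, ∀ k τ, 0 ≤ τ → τ ≤ τ₀ →
      (∀ r : PrimalDualSpace n m, ‖r‖ < σ → ∃! x, x ∈ Metric.ball (wstar k) δ ∧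
        SolvesGE (regKKTMap f g τ (wstar k).snd (s k)) (primalDualSet m Z) r x) ∧
      (∀ r r' x x' : PrimalDualSpace n m, ‖r‖ < σ → ‖r'‖ < σ → ‖x - wstar k‖ < δ →
        ‖x' - wstar k‖ < δ →
        SolvesGE (regKKTMap f g τ (wstar k).snd (s k)) (primalDualSet m Z) r x →
        SolvesGE (regKKTMap f g τ (wstar k).snd (s k)) (primalDualSet m Z) r' x' →
        ‖x - x'‖ ≤ L * ‖r - r'‖) ∧
      IsStronglyRegular (regKKTMap f g τ (wstar k).snd (s k)) (primalDualSet m Z) (wstar k) := by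
  -- `l` need not be positive. The admissible Lipschitz error `1 / (2 * L₀)` is split equally
  -- between the linearisation and the proximal term, which fixes `τ₀`.
  set L₀ : ℝ := max l 1 with hL₀
  have hL₀0 : 0 < L₀ := by positivity
  obtain ⟨δ₁, hδ₁, hclose⟩ := h.exists_isCloseToLinearization (hs 0) B
    (ε := 1 / (4 * L₀)) (by positivity)
  set δ : ℝ := min δ₁ (min κ (η * L₀)) with hδdef
  have hδ : 0 < δ := by positivity
  have hδκ : δ ≤ κ := (min_le_right _ _).trans (min_le_left _ _)
  have hδη : δ ≤ η * L₀ := (min_le_right _ _).trans (min_le_right _ _)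
  set σ : ℝ := min (η / 2) (δ / (4 * L₀)) with hσdef
  have hσ : 0 < σ := by positivity
  have hLσ : L₀ * σ ≤ δ / 4 := by
    calc L₀ * σ ≤ L₀ * (δ / (4 * L₀)) := by gcongr; exact min_le_right _ _
      _ = δ / 4 := by field_simp
  have hεδ : 1 / (2 * L₀) * δ + σ ≤ η := by
    have h1 : 1 / (2 * L₀) * δ ≤ 1 / (2 * L₀) * (η * L₀) := by gcongr
    have h2 : 1 / (2 * L₀) * (η * L₀) = η / 2 := by field_simp
    linarith [min_le_left (η / 2) (δ / (4 * L₀))]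
  have hLε : L₀ * (1 / (2 * L₀)) ≤ 1 / 2 := le_of_eq (by field_simp)
  have hsum : 1 / (4 * L₀) + 1 / (4 * L₀) = 1 / (2 * L₀) := by field_simp; norm_num
  have hC : IsClosed (primalDualSet m Z) := isClosed_primalDualSet h.isCompact
  refine ⟨δ, hδ, σ, hσ, 2 * L₀, by positivity, 1 / (4 * L₀), by positivity, ?_⟩
  intro k τ hτ hτ₀
  have hprox := pdPoint_prox_self (n := n) τ (wstar k)
  have hΨ : IsCloseToLinearization (kktMap f g (s k))
      (regKKTMap f g τ (wstar k).snd (s k)) (primalDualSet m Z) (wstar k) (1 / (2 * L₀)) δ :=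
    ((hclose (s k) (hs k) (wstar k) (hreg k).solves.mem (hB k)).add hprox
      (norm_prox_sub_le hτ (wstar k).snd)).mono (by linarith) (min_le_left _ _)
  have hlL : l ≤ L₀ := le_max_left _ _
  have hε0 : 0 ≤ 1 / (2 * L₀) := by positivity
  refine ⟨fun r hr => (hreg k).existsUnique_of_close hC hΨ hL₀0 hlL hε0 hLε hδ hδκ hεδ hLσ hr,
    fun r r' x x' hr hr' hx hx' hs hs' => (hreg k).lipschitz_of_close hΨ hL₀0 hlL hε0 hLε hδ hδκ
      hεδ hr hr' hx hx' hs hs', ?_⟩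
  -- The proximal term is affine, so it reappears unchanged in the linearisation of the regularised
  -- map, and strong regularity follows from the same perturbation argument.
  have hlin : linearization (regKKTMap f g τ (wstar k).snd (s k)) (wstar k)
      = fun w => linearization (kktMap f g (s k)) (wstar k) w
        + pdPoint 0 (τ • ((wstar k).snd - w.snd)) := by
    have hd : HasFDerivAt (fun w : PrimalDualSpace n m =>
        pdPoint (0 : PrimalSpace n) (τ • ((wstar k).snd - w.snd))) (proxCLM n m τ) (wstar k) := by
      have := (proxCLM n m τ).hasFDerivAt.comp (wstar k)
        ((hasFDerivAt_id (wstar k)).sub_const (wstar k))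
      refine HasFDerivAt.congr_of_eventuallyEq this (Filter.Eventually.of_forall fun w => ?_)
      exact (proxCLM_apply τ w (wstar k)).symm
    have hfd : fderiv ℝ (regKKTMap f g τ (wstar k).snd (s k)) (wstar k)
        = fderiv ℝ (kktMap f g (s k)) (wstar k) + proxCLM n m τ :=
      (((h.contDiff_kktMap (hs k)).differentiable (by norm_num) (wstar k)).hasFDerivAt.add
        hd).fderiv
    funext w
    unfold linearization
    rw [hfd, add_apply, proxCLM_apply]
    unfold regKKTMap
    rw [hprox, add_zero, add_assoc]
  have hΨ' : IsCloseToLinearization (kktMap f g (s k))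
      (linearization (regKKTMap f g τ (wstar k).snd (s k)) (wstar k)) (primalDualSet m Z)
      (wstar k) (1 / (2 * L₀)) δ := by
    rw [hlin]
    exact ((isCloseToLinearization_linearization (kktMap f g (s k)) (primalDualSet m Z) (wstar k)
      δ).add hprox (norm_prox_sub_le hτ (wstar k).snd)).mono
      (by linarith [show 0 ≤ 1 / (4 * L₀) by positivity]) le_rfl
  refine ⟨σ, hσ, δ, hδ, 2 * L₀, ⟨?_, fun r hr => ?_, ?_⟩⟩
  · have := (hreg k).solves
    unfold SolvesGE at *
    rwa [hΨ.apply_self]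
  · exact (hreg k).existsUnique_of_close hC hΨ' hL₀0 hlL hε0 hLε hδ hδκ hεδ hLσ hr
  · intro r r' x x' hr hr' hx hx' hs hs'
    exact (hreg k).lipschitz_of_close hΨ' hL₀0 hlL hε0 hLε hδ hδκ hεδ hr hr'
      (mem_ball_iff_norm.1 hx) (mem_ball_iff_norm.1 hx') hs hs'

/-- Allows one derivative, taken at a reference parameter, to serve all time instants. -/
theorem isLagrangeStationary_iff {s₁ s₂ : EuclideanSpace ℝ (Fin p)} (h₁ : s₁ ∈ S) (h₂ : s₂ ∈ S)
    {z u : PrimalSpace n} {μ : EuclideanSpace ℝ (Fin m)} :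
    IsLagrangeStationary (productSet Z) (gradient f) (fderiv ℝ fun z => g z s₁) z μ u ↔
      IsLagrangeStationary (productSet Z) (gradient f) (fderiv ℝ fun z => g z s₂) z μ u := by
  constructor
  · intro H
    have := H
    unfold IsLagrangeStationary at H ⊢
    rwa [h.fderiv_eq h₂ h₁ this.mem]
  · intro H
    have := H
    unfold IsLagrangeStationary at H ⊢
    rwa [h.fderiv_eq h₁ h₂ this.mem]

/-- The radii are halved because the norm of a pair is bounded by the sum of the norms of its
components. -/
theorem isStablePoint {s₀ s : EuclideanSpace ℝ (Fin p)} (hs₀ : s₀ ∈ S) (hs : s ∈ S)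
    {w : PrimalDualSpace n m} {η κ l K δ σ L τ₀ : ℝ}
    (hreg : IsStronglyRegularWith (kktMap f g s) (primalDualSet m Z) w η κ l)
    (hK : ‖w.snd‖ ≤ K) (hL : 0 ≤ L)
    (hstab : ∀ τ, 0 ≤ τ → τ ≤ τ₀ → ∀ r r' x x' : PrimalDualSpace n m, ‖r‖ < σ → ‖r'‖ < σ →
        ‖x - w‖ < δ → ‖x' - w‖ < δ →
        SolvesGE (regKKTMap f g τ w.snd s) (primalDualSet m Z) r x →
        SolvesGE (regKKTMap f g τ w.snd s) (primalDualSet m Z) r' x' →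
        ‖x - x'‖ ≤ L * ‖r - r'‖) :
    IsStablePoint (productSet Z) (gradient f) (fderiv ℝ fun z => g z s₀) K η L (δ / 2) (σ / 2) τ₀
      (fun z => g z s) w.fst w.snd where
  hasFDeriv z hz := by
    rw [h.fderiv_eq hs₀ hs hz]
    exact ((h.contDiff_constraint hs).differentiable (by norm_num) z).hasFDerivAt
  feasible := (isKKT_iff.1 hreg.solves).2
  stationary := (h.isLagrangeStationary_iff hs hs₀).1 (isKKT_iff.1 hreg.solves).1
  multiplier_le := hK
  qualification r hr := by
    rw [h.fderiv_eq hs₀ hs (show w.fst ∈ productSet Z from hreg.solves.mem)]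
    exact h.qualification hs hreg hr
  stable := by
    intro τ hτ hτ₀ z z' μ μ' u u' hz hμ hz' hμ' hst hst' hu hu' hv hv'
    have hnorm : ∀ (a : PrimalSpace n) (b : EuclideanSpace ℝ (Fin m)),
        ‖pdPoint a b‖ ≤ ‖a‖ + ‖b‖ := fun a b => WithLp.norm_le_norm_fst_add_norm_snd (pdPoint a b)
    have hsub : ∀ (a a' : PrimalSpace n) (b b' : EuclideanSpace ℝ (Fin m)),
        ‖pdPoint a b - pdPoint a' b'‖ ≤ ‖a - a'‖ + ‖b - b'‖ := fun a a' b b' =>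
      WithLp.norm_le_norm_fst_add_norm_snd (pdPoint a b - pdPoint a' b')
    have key := hstab τ hτ hτ₀ _ _ _ _ ((hnorm _ _).trans_lt (by linarith))
      ((hnorm _ _).trans_lt (by linarith)) ((hsub z w.fst μ w.snd).trans_lt (by linarith))
      ((hsub z' w.fst μ' w.snd).trans_lt (by linarith))
      (solvesGE_regKKTMap_iff.2 ⟨(h.isLagrangeStationary_iff hs₀ hs).1 hst, rfl⟩)
      (solvesGE_regKKTMap_iff.2 ⟨(h.isLagrangeStationary_iff hs₀ hs).1 hst', rfl⟩)
    have key2 := key.trans (mul_le_mul_of_nonneg_left (hsub u u' _ _) hL)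
    exact ⟨(WithLp.norm_fst_le_norm _).trans key2, (WithLp.norm_snd_le_norm _).trans key2⟩

/-- The generalised equation at the parameter `s₁` as a perturbation of that at `s₂`. -/
theorem solvesGE_shift_iff {τ : ℝ} {μs d : EuclideanSpace ℝ (Fin m)}
    {s₁ s₂ : EuclideanSpace ℝ (Fin p)} (h₁ : s₁ ∈ S) (h₂ : s₂ ∈ S) {z : PrimalSpace n}
    (hz : z ∈ productSet Z) {w : PrimalDualSpace n m} :
    SolvesGE (fun w => regKKTMap f g τ μs s₁ w + pdPoint 0 d) (primalDualSet m Z) 0 w ↔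
      SolvesGE (regKKTMap f g τ μs s₂) (primalDualSet m Z)
        (pdPoint 0 (-(d + (g z s₁ - g z s₂)))) w := by
  have key : w ∈ primalDualSet m Z →
      (0 : PrimalDualSpace n m) - (regKKTMap f g τ μs s₁ w + pdPoint 0 d)
        = pdPoint 0 (-(d + (g z s₁ - g z s₂))) - regKKTMap f g τ μs s₂ w := by
    intro hw
    unfold regKKTMap
    rw [h.kktMap_eq h₁ h₂ hw hz, pdPoint_zero_neg, pdPoint_zero_add]
    abel
  constructor
  · intro H
    have := H.mem
    unfold SolvesGE at *
    rwa [← key this]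
  · intro H
    have := H.mem
    unfold SolvesGE at *
    rwa [key this]

/-- Identifies the difference of right-hand sides in the stability estimate with the difference of
maps that (A) and (B) ask for. -/
theorem norm_regKKTMap_sub {τ : ℝ} {μs d₁ d₂ : EuclideanSpace ℝ (Fin m)}
    {s₁ s₂ s : EuclideanSpace ℝ (Fin p)} (h₁ : s₁ ∈ S) (h₂ : s₂ ∈ S) (hs : s ∈ S)
    {z : PrimalSpace n} (hz : z ∈ productSet Z) {w : PrimalDualSpace n m}
    (hw : w ∈ primalDualSet m Z) :
    ‖(regKKTMap f g τ μs s₁ w + pdPoint 0 d₁) - (regKKTMap f g τ μs s₂ w + pdPoint 0 d₂)‖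
      = ‖(d₁ + (g z s₁ - g z s)) - (d₂ + (g z s₂ - g z s))‖ := by
  rw [← norm_pdPoint_zero_left (n := n)]
  congr 1
  unfold regKKTMap
  rw [h.kktMap_eq h₁ hs hw hz, h.kktMap_eq h₂ hs hw hz]
  simp only [pdPoint_zero_sub, pdPoint_zero_add]
  abel

end IsParametricProgram

end ParametricProgramStability

/-! ### Estimates for the augmented Lagrangian -/

section Estimates

variable {E V : Type} [NormedAddCommGroup E] [InnerProductSpace ℝ E] [CompleteSpace E]
  [NormedAddCommGroup V] [InnerProductSpace ℝ V] [CompleteSpace V]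

theorem norm_adjoint_apply_le (B : E →L[ℝ] V) (ν : V) : ‖B.adjoint ν‖ ≤ ‖B‖ * ‖ν‖ := by
  calc ‖B.adjoint ν‖ ≤ ‖B.adjoint‖ * ‖ν‖ := B.adjoint.le_opNorm ν
    _ = ‖B‖ * ‖ν‖ := by rw [LinearIsometryEquiv.norm_map]

variable {𝒵 : Set E} {f : E → ℝ} {Gf : E → E} {A : E → E →L[ℝ] V} {K : ℝ} {g : E → V}

/-- The gradient of the augmented Lagrangian is Lipschitz, uniformly in bounded multipliers. -/
theorem ProblemBounds.gradient_augmentedLagrangian_lipschitz (hB : ProblemBounds 𝒵 f Gf A K)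
    (hg : ∀ z ∈ 𝒵, HasFDerivAt g (A z) z) {ρ B : ℝ} (hρ : 0 ≤ ρ) {μ : V} (hμ : ‖μ‖ ≤ B)
    (hgB : ∀ z ∈ 𝒵, ‖g z‖ ≤ B) {z z' : E} (hz : z ∈ 𝒵) (hz' : z' ∈ 𝒵) :
    ‖(Gf z + (A z).adjoint (μ + ρ • g z)) - (Gf z' + (A z').adjoint (μ + ρ • g z'))‖
      ≤ (K + K * (B + ρ * B) + K * (ρ * K)) * ‖z - z'‖ := by
  have hK := hB.one_le
  have e : (Gf z + (A z).adjoint (μ + ρ • g z)) - (Gf z' + (A z').adjoint (μ + ρ • g z'))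
      = (Gf z - Gf z') + (A z - A z').adjoint (μ + ρ • g z) + (A z').adjoint (ρ • (g z - g z')) := by
    simp only [map_sub, map_add, map_smul, sub_apply, smul_sub]
    abel
  have h1 : ‖μ + ρ • g z‖ ≤ B + ρ * B := by
    refine (norm_add_le _ _).trans (add_le_add hμ ?_)
    rw [norm_smul, Real.norm_of_nonneg hρ]
    gcongr
    exact hgB z hz
  have h2 : ‖ρ • (g z - g z')‖ ≤ ρ * (K * ‖z - z'‖) := by
    rw [norm_smul, Real.norm_of_nonneg hρ]
    gcongr
    exact norm_image_sub_le_of_hasFDerivAt_bound hB.convex hg hB.deriv_le hz hz'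
  have h3 : ‖(A z - A z').adjoint (μ + ρ • g z)‖ ≤ K * ‖z - z'‖ * (B + ρ * B) := by
    refine (norm_adjoint_apply_le _ _).trans ?_
    gcongr
    exact hB.deriv_lip z hz z' hz'
  have h4 : ‖(A z').adjoint (ρ • (g z - g z'))‖ ≤ K * (ρ * (K * ‖z - z'‖)) := by
    refine (norm_adjoint_apply_le _ _).trans ?_
    gcongr
    exact hB.deriv_le z' hz'
  rw [e]
  refine norm_add₃_le.trans ((add_le_add (add_le_add (hB.gradient_lip z hz z' hz') h3) h4).trans
    (le_of_eq ?_))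
  ring

theorem ProblemBounds.norm_gradient_augmentedLagrangian_le (hB : ProblemBounds 𝒵 f Gf A K)
    {ρ B : ℝ} (hρ : 0 ≤ ρ) {μ : V} (hμ : ‖μ‖ ≤ B)
    (hgB : ∀ z ∈ 𝒵, ‖g z‖ ≤ B) {z : E} (hz : z ∈ 𝒵) :
    ‖Gf z + (A z).adjoint (μ + ρ • g z)‖ ≤ K + K * (B + ρ * B) := by
  have hK := hB.one_le
  refine (norm_add_le _ _).trans (add_le_add (hB.gradient_le z hz) ?_)
  refine (norm_adjoint_apply_le _ _).trans ?_
  gcongr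
  · exact hB.deriv_le z hz
  · refine (norm_add_le _ _).trans (add_le_add hμ ?_)
    rw [norm_smul, Real.norm_of_nonneg hρ]
    gcongr
    exact hgB z hz

omit [NormedAddCommGroup E] [InnerProductSpace ℝ E] [CompleteSpace E] [CompleteSpace V] in
/-- Dependence of the augmented Lagrangian on the multiplier and on shifts of the constraint. -/
theorem abs_augmentedLagrangian_sub_le {g' : E → V} {ρ B e : ℝ} (hρ : 0 ≤ ρ) (he : 0 ≤ e)
    {μ μ' : V} {z : E} (hμ : ‖μ‖ ≤ B) (hg : ‖g z‖ ≤ B) (hg' : ‖g' z‖ ≤ B)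
    (hμe : ‖μ' - μ‖ ≤ e) (hge : ‖g' z - g z‖ ≤ e) :
    |augmentedLagrangian f g' ρ μ' z - augmentedLagrangian f g ρ μ z|
      ≤ e * (2 * B + ρ * B) := by
  have hB : 0 ≤ B := (norm_nonneg _).trans hμ
  rw [augmentedLagrangian_eq, augmentedLagrangian_eq]
  have e1 : f z + ⟪μ', g' z⟫_ℝ + ρ / 2 * ‖g' z‖ ^ 2 - (f z + ⟪μ, g z⟫_ℝ + ρ / 2 * ‖g z‖ ^ 2)
      = ⟪μ' - μ, g' z⟫_ℝ + ⟪μ, g' z - g z⟫_ℝ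
        + ρ / 2 * ((‖g' z‖ - ‖g z‖) * (‖g' z‖ + ‖g z‖)) := by
    rw [inner_sub_left, inner_sub_right]; ring
  have h1 : |⟪μ' - μ, g' z⟫_ℝ| ≤ e * B := (abs_real_inner_le_norm _ _).trans (by gcongr)
  have h2 : |⟪μ, g' z - g z⟫_ℝ| ≤ B * e := (abs_real_inner_le_norm _ _).trans (by gcongr)
  have h3 : |ρ / 2 * ((‖g' z‖ - ‖g z‖) * (‖g' z‖ + ‖g z‖))| ≤ ρ / 2 * (e * (B + B)) := by
    rw [abs_mul, abs_mul, abs_of_nonneg (by positivity : 0 ≤ ρ / 2),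
      abs_of_nonneg (by positivity : 0 ≤ ‖g' z‖ + ‖g z‖)]
    gcongr
    exact (abs_norm_sub_norm_le _ _).trans hge
  rw [e1]
  refine (abs_add_three _ _ _).trans ((add_le_add (add_le_add h1 h2) h3).trans (le_of_eq ?_))
  ring

end Estimates

/-! ### Block convexity and assembly of the rates -/

section BlockConvexity

variable {P m p : ℕ} {n : Fin P → ℕ}

theorem isMultiConvex_augmentedLagrangian {f : PrimalSpace n → ℝ}
    {g : PrimalSpace n → EuclideanSpace ℝ (Fin m)} (hf : IsMultiConvex f) (hg : IsMultiAffine g)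
    {ρ : ℝ} (hρ : 0 ≤ ρ) (μ : EuclideanSpace ℝ (Fin m)) :
    IsMultiConvex (augmentedLagrangian f g ρ μ) := by
  intro z i
  obtain ⟨A, hA⟩ := hg z i
  simp only [augmentedLagrangian_eq, hA]
  have h1 : ConvexOn ℝ Set.univ fun x => ⟪μ, A x⟫_ℝ :=
    ((innerₛₗ ℝ μ).convexOn convex_univ).comp_affineMap A
  have h2 : ConvexOn ℝ Set.univ fun x => ρ / 2 * ‖A x‖ ^ 2 :=
    ((((convexOn_norm (E := EuclideanSpace ℝ (Fin m)) convex_univ).pow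
      (fun _ _ => norm_nonneg _) 2).comp_affineMap A).smul (by positivity : 0 ≤ ρ / 2))
  exact ((hf z i).add h1).add h2

theorem one_le_lamG {lamF : ℝ} (h : 0 < lamF) : 1 ≤ lamG lamF :=
  Real.le_sqrt_of_sq_le (by linarith [le_max_right (lamF ^ 2) 1])

theorem le_lamG {lamF : ℝ} (h : 0 < lamF) : lamF ≤ lamG lamF :=
  Real.le_sqrt_of_sq_le (by linarith [le_max_left (lamF ^ 2) 1])

/-- The triangle inequalities that combine the convergence of the inner iteration with the
sensitivity of the auxiliary generalised equation. -/
theorem tracking_error_le {C ψ lamA lamB lamF lamg lG ρ θhat E Δ x y e z₁ z₀ : ℝ} {M : ℕ}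
    (hψ : ψ = rateExponent θhat) (hlG : lG = lamG lamF) (hC : 0 ≤ C) (hg : 0 ≤ lamg)
    (hρ : 0 ≤ ρ)
    (he : e ≤ x + y) (hx : x ≤ (1 + ρ * lamg) * z₁)
    (hz₁ : z₁ ≤ C * (M : ℝ) ^ (-ψ) * z₀)
    (hz₀ : z₀ ≤ E + lamB * lG * (E / ρ + Δ))
    (hy : y ≤ lamB * lG / ρ * (E + lamA * lamF * Δ)) :
    e ≤ betaW C lamg lamB lamF θhat ρ M * E + betaS C lamg lamA lamB lamF θhat ρ M * Δ := by
  have hM : 0 ≤ (M : ℝ) ^ (-ψ) := Real.rpow_nonneg (Nat.cast_nonneg M) _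
  have h1 : x ≤ (1 + ρ * lamg) * (C * (M : ℝ) ^ (-ψ) * (E + lamB * lG * (E / ρ + Δ))) :=
    hx.trans (by gcongr; exact hz₁.trans (by gcongr))
  refine he.trans ((add_le_add h1 hy).trans (le_of_eq ?_))
  rw [betaW, betaS, ← hψ, ← hlG]
  ring

end BlockConvexity

/-! ### Uniform rate of the inner iteration -/

section InnerIteration

variable {P m p : ℕ} {n : Fin P → ℕ} {f : PrimalSpace n → ℝ}
  {g : PrimalSpace n → EuclideanSpace ℝ (Fin p) → EuclideanSpace ℝ (Fin m)}
  {Z : ∀ i : Fin P, Set (EuclideanSpace ℝ (Fin (n i)))} {S : Set (EuclideanSpace ℝ (Fin p))}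
  {lamF : ℝ}

set_option maxHeartbeats 800000 in
/-- Uniform rate of convergence of the inner iteration to the tracked stationary point of the
augmented Lagrangian. -/
theorem IsParametricProgram.exists_inner_rate (h : IsParametricProgram f g Z S lamF)
    {s₀ : EuclideanSpace ℝ (Fin p)} (hs₀ : s₀ ∈ S)
    {s : ℕ → EuclideanSpace ℝ (Fin p)} (hs : ∀ k, s k ∈ S) {wstar : ℕ → PrimalDualSpace n m}
    {K η L δ σ τ₀ ε : ℝ} (hη : 0 < η) (hL : 0 < L) (hδ : 0 < δ) (hσ : 0 < σ) (hτ₀ : 0 < τ₀)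
    (hε : 0 < ε)
    (hB : ProblemBounds (productSet Z) f (gradient f) (fderiv ℝ fun z => g z s₀) K)
    (hstab : ∀ k, IsStablePoint (productSet Z) (gradient f) (fderiv ℝ fun z => g z s₀) K η L δ σ τ₀
      (fun z => g z (s k)) (wstar k).fst (wstar k).snd)
    (hopt : ∀ k, IsOptimalWithin f g Z (s k) ε (wstar k).fst) :
    ∃ ρ₀ > 0, ∀ ρ > ρ₀, ∃ e > 0, ∀ α : Fin P → ℝ, (∀ i, 0 < α i) → ∀ ψ : ℝ, ∃ C > 0,
      ∀ k, ∀ s₁ ∈ S, ∀ {z₀ zi : PrimalSpace n} {μ μi : EuclideanSpace ℝ (Fin m)},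
      z₀ ∈ productSet Z → ‖z₀ - (wstar k).fst‖ ≤ e → ‖μ - (wstar k).snd‖ ≤ e →
      ‖g (wstar k).fst s₁ - g (wstar k).fst (s k)‖ ≤ e →
      ‖zi - (wstar k).fst‖ < δ → ‖μi - (wstar k).snd‖ < δ →
      IsLagrangeStationary (productSet Z) (gradient f) (fderiv ℝ fun z => g z s₀) zi μi 0 →
      μi = μ + ρ • g zi s₁ →
      ∀ {ζ : ℕ → PrimalSpace n} {M : ℕ}, 1 ≤ M → ζ 0 = z₀ →
      (∀ l < M, IsProxSweep f g Z α ρ μ s₁ (ζ l) (ζ (l + 1))) →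
      ‖ζ M - zi‖ ≤ C * (M : ℝ) ^ (-ψ) * ‖z₀ - zi‖ := by
  have hK := hB.one_le
  obtain ⟨R, hR, c, hc, hEB⟩ := exists_error_bound (PrimalSpace n) (EuclideanSpace ℝ (Fin m))
    hK hL hδ hσ
  obtain ⟨d, hd, hdR, γ, hγ, ρ₁, hρ₁, hbar⟩ := exists_barrier (PrimalSpace n)
    (EuclideanSpace ℝ (Fin m)) hK hη hL hδ hσ hε hτ₀ hR
  refine ⟨max ρ₁ τ₀⁻¹, by positivity, fun ρ hρ => ?_⟩
  have hρ1 : ρ₁ < ρ := (le_max_left _ _).trans_lt hρ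
  have hρ2 : τ₀⁻¹ < ρ := (le_max_right _ _).trans_lt hρ
  have hρ0 : 0 < ρ := hρ₁.trans hρ1
  -- Bounds the multipliers and constraint values, including shifts of size at most `e ≤ 1`.
  set B : ℝ := K ^ 2 + K + 1 with hBdef
  have hB0 : 0 < B := by positivity
  set G₁ : ℝ := K + K * (B + ρ * B) with hG₁
  have hG₁0 : 0 < G₁ := by positivity
  set G₂ : ℝ := 2 * B + ρ * B with hG₂
  have hG₂0 : 0 < G₂ := by positivity
  -- The four bounds keep the shifts below one, put the start inside the sphere, make the start
  -- value and the change of multiplier and parameter cost at most `γ / 4` together, and meet the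
  -- smallness condition of the error bound.
  set e : ℝ := min (min 1 (d / 2)) (min (γ / (4 * (G₁ + G₂))) (σ / (2 * (ρ⁻¹ + 1)))) with he
  have he0 : 0 < e := by positivity
  have e1 : e ≤ 1 := (min_le_left _ _).trans (min_le_left _ _)
  have e2 : e ≤ d / 2 := (min_le_left _ _).trans (min_le_right _ _)
  have e3 : e * (G₁ + G₂) ≤ γ / 4 := by
    have : e ≤ γ / (4 * (G₁ + G₂)) := (min_le_right _ _).trans (min_le_left _ _)
    rw [le_div_iff₀ (by positivity)] at this
    linarith
  have e4 : e * (ρ⁻¹ + 1) ≤ σ / 2 := by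
    have : e ≤ σ / (2 * (ρ⁻¹ + 1)) := (min_le_right _ _).trans (min_le_right _ _)
    rw [le_div_iff₀ (by positivity)] at this
    linarith
  refine ⟨e, he0, fun α hα ψ => ?_⟩
  obtain ⟨C, hC, H⟩ := exists_sweep_rate n (ψ := ψ) hα (K := K + K * (B + ρ * B) + K * (ρ * K))
    (c := c) (by positivity) hc
  refine ⟨C, hC, ?_⟩
  intro k s₁ hs₁ z₀ zi μ μi hz₀ hz₀e hμe hbe hzi hμi hst hμi' ζ M hM hζ0 hsw
  have hst_k := hstab k
  set zs := (wstar k).fst with hzs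
  set μs := (wstar k).snd with hμs
  set b : EuclideanSpace ℝ (Fin m) := g zs s₁ - g zs (s k) with hb
  have hzsm : zs ∈ productSet Z := hst_k.mem
  have hgb : ∀ z ∈ productSet Z, g z s₁ = g z (s k) + b := fun z hz => by
    rw [hb, ← h.constraint_sub_eq hs₁ (hs k) hz hzsm]; abel
  have hgk : ∀ z ∈ productSet Z, ‖g z (s k)‖ ≤ K ^ 2 := fun z hz =>
    (hst_k.norm_image_le hB hz).trans (by rw [pow_two]; gcongr; exact hB.diam z hz zs hzsm)
  have hgkB : ∀ z ∈ productSet Z, ‖g z (s k)‖ ≤ B := fun z hz => (hgk z hz).trans (by linarith)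
  have hg₁B : ∀ z ∈ productSet Z, ‖g z s₁‖ ≤ B := fun z hz => by
    rw [hgb z hz]
    exact (norm_add_le _ _).trans (by linarith [hgk z hz])
  have hμsB : ‖μs‖ ≤ B := hst_k.multiplier_le.trans (by linarith [sq_nonneg K])
  have hμB : ‖μ‖ ≤ B := by
    have : μ = μs + (μ - μs) := by abel
    rw [this]
    exact (norm_add_le _ _).trans (by linarith [hst_k.multiplier_le, sq_nonneg K])
  have hder : ∀ z ∈ productSet Z,
      HasFDerivAt (fun z => g z s₁) (fderiv ℝ (fun z => g z s₀) z) z := fun z hz => by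
    rw [h.fderiv_eq hs₀ hs₁ hz]
    exact ((h.contDiff_constraint hs₁).differentiable (by norm_num) z).hasFDerivAt
  have hcomp : ∀ z ∈ productSet Z,
      |augmentedLagrangian f (fun z => g z s₁) ρ μ z
        - augmentedLagrangian f (fun z => g z (s k)) ρ μs z| ≤ e * G₂ := fun z hz =>
    abs_augmentedLagrangian_sub_le hρ0.le he0.le hμsB (hgkB z hz) (hg₁B z hz) hμe
      (by rw [hgb z hz, add_sub_cancel_left]; exact hbe)
  have heG : 0 ≤ e * G₁ := by positivity
  have hstart : augmentedLagrangian f (fun z => g z (s k)) ρ μs z₀ ≤ f zs + e * G₁ := by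
    have h1 := abs_sub_le_of_gradient_bound hB.convex
      (f := augmentedLagrangian f (fun z => g z (s k)) ρ μs)
      (fun z hz => hasGradientAt_augmentedLagrangian (hB.hasGradient z hz)
        (hst_k.hasFDeriv z hz))
      (fun z hz => hB.norm_gradient_augmentedLagrangian_le hρ0.le hμsB hgkB hz) hz₀ hzsm
    have h2 : augmentedLagrangian f (fun z => g z (s k)) ρ μs zs = f zs := by
      rw [augmentedLagrangian_eq, hst_k.feasible]; simp
    rw [h2] at h1
    have h3 : G₁ * ‖z₀ - zs‖ ≤ G₁ * e := by gcongr
    linarith [(abs_le.1 h1).2]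
  -- The level `f zs + 3 * γ / 4` separates the start, at most `f zs + γ / 4`, from the sphere,
  -- where the perturbation leaves at least `f zs + γ - γ / 4`.
  have hres := H (Z := Z) (L := augmentedLagrangian f (fun z => g z s₁) ρ μ)
    (G := fun z => gradient f z + (fderiv ℝ (fun z => g z s₀) z).adjoint (μ + ρ • g z s₁))
    (zs := zs) (zi := zi) (d := d) (β := f zs + 3 * γ / 4) h.isCompact h.convex
    (isMultiConvex_augmentedLagrangian h.multiConvex (h.multiAffine s₁ hs₁) hρ0.le μ)
    (fun y hy => hasGradientAt_augmentedLagrangian (hB.hasGradient y hy) (hder y hy))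
    (fun y hy y' hy' =>
      hB.gradient_augmentedLagrangian_lipschitz hder hρ0.le hμB hg₁B hy hy')
    (fun y hy hyd => by
      have h1 := hbar hB hst_k (hopt k) hρ1 hy hyd
      have h2 := (abs_le.1 (hcomp y hy)).1
      linarith)
    (by
      have := hst
      unfold IsLagrangeStationary at this
      rwa [zero_sub, hμi'] at this)
    (fun y hy hyd u hu => by
      refine hEB hB hst_k (ρ := ρ) (μb := μ) (b := b) (μi := μi) hρ0
        (inv_le_of_inv_le₀ hτ₀ hρ2.le) ?_ hzi hμi hst ?_ (hyd.trans hdR) ?_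
      · have h1 : ‖ρ⁻¹ • (μ - μs)‖ ≤ ρ⁻¹ * e := by
          rw [norm_smul, Real.norm_of_nonneg (by positivity)]; gcongr
        exact (norm_add_le _ _).trans_lt (by linarith)
      · rw [← hgb zi hst.mem, hμi', add_assoc, ← smul_add, sub_add_sub_cancel,
          sub_add_cancel_left, smul_neg, smul_smul, inv_mul_cancel₀ hρ0.ne', one_smul,
          add_neg_cancel]
      · unfold IsLagrangeStationary
        rw [← hgb y hy]
        exact hu)
    (ζ := ζ) (M := M) (by rw [hζ0]; exact hz₀) (by rw [hζ0]; linarith)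
    (by
      rw [hζ0]
      have := (abs_le.1 (hcomp z₀ hz₀)).2
      linarith)
    hsw hM
  rwa [hζ0] at hres

end InnerIteration

/-! ### The contraction theorem -/

section Contraction

variable {P m p : ℕ} {n : Fin P → ℕ} {f : PrimalSpace n → ℝ}
  {g : PrimalSpace n → EuclideanSpace ℝ (Fin p) → EuclideanSpace ℝ (Fin m)}
  {Z : ∀ i : Fin P, Set (EuclideanSpace ℝ (Fin (n i)))} {S : Set (EuclideanSpace ℝ (Fin p))}
  {lamF : ℝ}

theorem isKKT_iff_solvesGE {s : EuclideanSpace ℝ (Fin p)} {μs : EuclideanSpace ℝ (Fin m)}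
    {w : PrimalDualSpace n m} :
    IsKKT f g Z s w ↔
      SolvesGE (fun w => regKKTMap f g 0 μs s w + pdPoint 0 0) (primalDualSet m Z) 0 w := by
  unfold IsKKT SolvesGE
  simp only [regKKTMap_zero]
  rw [show kktMap f g s w + pdPoint 0 0 = kktMap f g s w from add_zero _]

theorem solvesAux_iff_solvesGE {ρ : ℝ} {s : EuclideanSpace ℝ (Fin p)}
    {μs d : EuclideanSpace ℝ (Fin m)} {w : PrimalDualSpace n m} :
    SolvesAux f g Z ρ μs d s w ↔
      SolvesGE (fun w => regKKTMap f g ρ⁻¹ μs s w + pdPoint 0 d) (primalDualSet m Z) 0 w := by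
  unfold SolvesAux SolvesGE
  simp only [auxMap_eq]

/-- A KKT point solves the auxiliary generalised equation for the matching shift. -/
theorem IsKKT.solvesAux {s : EuclideanSpace ℝ (Fin p)} {w : PrimalDualSpace n m}
    (h : IsKKT f g Z s w) (ρ : ℝ) (μs : EuclideanSpace ℝ (Fin m)) :
    SolvesAux f g Z ρ μs (ρ⁻¹ • (w.snd - μs)) s w := by
  obtain ⟨h1, h2⟩ := isKKT_iff.1 h
  refine solvesAux_iff.2 ⟨h1, ?_⟩
  rw [h2, zero_add, ← smul_add]
  simp

theorem norm_auxMap_sub_le (h : IsParametricProgram f g Z S lamF) {ρ : ℝ}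
    {μs d₁ d₂ : EuclideanSpace ℝ (Fin m)} {s₁ s₂ : EuclideanSpace ℝ (Fin p)} (h₁ : s₁ ∈ S)
    (h₂ : s₂ ∈ S) {w : PrimalDualSpace n m} (hw : w ∈ primalDualSet m Z) :
    ‖auxMap f g ρ μs d₁ s₁ w - auxMap f g ρ μs d₂ s₂ w‖ ≤ ‖d₁ - d₂‖ + lamF * ‖s₁ - s₂‖ := by
  rw [auxMap_eq, auxMap_eq, h.norm_regKKTMap_sub h₁ h₂ h₂ hw hw, sub_self, add_zero,
    add_sub_right_comm]
  exact (norm_add_le _ _).trans (by gcongr; exact h.norm_constraint_sub_le h₁ h₂ hw)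

/-- Uniform boundedness of the tracked points and of the problem data. -/
theorem IsParametricProgram.exists_bounds (h : IsParametricProgram f g Z S lamF)
    {s : ℕ → EuclideanSpace ℝ (Fin p)} (hs : ∀ k, s k ∈ S)
    {wstar : ℕ → PrimalDualSpace n m} {η κ l : ℝ} (hη : 0 < η)
    (hreg : ∀ k, IsStronglyRegularWith (kktMap f g (s k)) (primalDualSet m Z) (wstar k) η κ l) :
    ∃ K, ProblemBounds (productSet Z) f (gradient f) (fderiv ℝ fun z => g z (s 0)) K ∧
      (∀ k, ‖(wstar k).snd‖ ≤ K) ∧ ∃ B, ∀ k, ‖wstar k‖ ≤ B := by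
  obtain ⟨K₁, hB₁⟩ := exists_problemBounds h.contDiff (h.contDiff_constraint (hs 0))
    (isCompact_productSet h.isCompact) (convex_productSet h.convex)
  have hμ : ∀ k, ‖(wstar k).snd‖ ≤ 2 * K₁ ^ 2 / η := fun k =>
    h.norm_multiplier_le (hs k) hB₁ hη (hreg k)
  obtain ⟨B, hB⟩ := (isCompact_productSet h.isCompact).isBounded.exists_norm_le
  refine ⟨max K₁ (2 * K₁ ^ 2 / η), hB₁.mono (le_max_left _ _),
    fun k => (hμ k).trans (le_max_right _ _), B + 2 * K₁ ^ 2 / η, fun k => ?_⟩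
  exact (WithLp.norm_le_norm_fst_add_norm_snd _).trans
    (add_le_add (hB _ (hreg k).solves.mem) (hμ k))

/-- Solvability and Lipschitz stability of the shifted generalised equations. -/
theorem IsParametricProgram.shifted_stability (h : IsParametricProgram f g Z S lamF) {δ σ L τ : ℝ}
    {μs : EuclideanSpace ℝ (Fin m)} {s : EuclideanSpace ℝ (Fin p)} (hs : s ∈ S)
    {w₀ : PrimalDualSpace n m} (hw₀ : w₀ ∈ primalDualSet m Z)
    (hexists : ∀ r : PrimalDualSpace n m, ‖r‖ < σ → ∃! x, x ∈ Metric.ball w₀ δ ∧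
        SolvesGE (regKKTMap f g τ μs s) (primalDualSet m Z) r x)
    (hlip : ∀ r r' x x' : PrimalDualSpace n m, ‖r‖ < σ → ‖r'‖ < σ → ‖x - w₀‖ < δ →
        ‖x' - w₀‖ < δ →
        SolvesGE (regKKTMap f g τ μs s) (primalDualSet m Z) r x →
        SolvesGE (regKKTMap f g τ μs s) (primalDualSet m Z) r' x' →
        ‖x - x'‖ ≤ L * ‖r - r'‖) :
    (∀ d, ∀ s₁ ∈ S, ‖d‖ + lamF * ‖s₁ - s‖ < σ → ∃! w, w ∈ Metric.ball w₀ δ ∧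
      SolvesGE (fun w => regKKTMap f g τ μs s₁ w + pdPoint 0 d) (primalDualSet m Z) 0 w) ∧
    (∀ d₁ d₂, ∀ s₁ ∈ S, ∀ s₂ ∈ S, ‖d₁‖ + lamF * ‖s₁ - s‖ < σ → ‖d₂‖ + lamF * ‖s₂ - s‖ < σ →
      ∀ w₁ ∈ Metric.ball w₀ δ, ∀ w₂ ∈ Metric.ball w₀ δ,
      SolvesGE (fun w => regKKTMap f g τ μs s₁ w + pdPoint 0 d₁) (primalDualSet m Z) 0 w₁ →
      SolvesGE (fun w => regKKTMap f g τ μs s₂ w + pdPoint 0 d₂) (primalDualSet m Z) 0 w₂ →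
      ‖w₁ - w₂‖ ≤ L * ‖(regKKTMap f g τ μs s₁ w₂ + pdPoint 0 d₁)
        - (regKKTMap f g τ μs s₂ w₂ + pdPoint 0 d₂)‖) := by
  have hnorm : ∀ d, ∀ s₁ ∈ S, ‖d‖ + lamF * ‖s₁ - s‖ < σ →
      ‖pdPoint (0 : PrimalSpace n) (-(d + (g w₀.fst s₁ - g w₀.fst s)))‖ < σ := by
    intro d s₁ hs₁ hd
    rw [norm_pdPoint_zero_left, norm_neg]
    refine (norm_add_le _ _).trans_lt (lt_of_le_of_lt ?_ hd)
    gcongr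
    exact h.norm_constraint_sub_le hs₁ hs hw₀
  constructor
  · intro d s₁ hs₁ hd
    simp only [h.solvesGE_shift_iff hs₁ hs hw₀]
    exact hexists _ (hnorm d s₁ hs₁ hd)
  · intro d₁ d₂ s₁ hs₁ s₂ hs₂ hd₁ hd₂ w₁ hw₁ w₂ hw₂ h₁ h₂
    have hw₂' : w₂ ∈ primalDualSet m Z := h₂.mem
    rw [h.norm_regKKTMap_sub hs₁ hs₂ hs hw₀ hw₂']
    rw [h.solvesGE_shift_iff hs₁ hs hw₀] at h₁
    rw [h.solvesGE_shift_iff hs₂ hs hw₀] at h₂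
    have := hlip _ _ _ _ (hnorm _ _ hs₁ hd₁) (hnorm _ _ hs₂ hd₂) (mem_ball_iff_norm.1 hw₁)
      (mem_ball_iff_norm.1 hw₂) h₁ h₂
    rw [← pdPoint_zero_sub, norm_pdPoint_zero_left, neg_sub_neg] at this
    rwa [norm_sub_rev (d₁ + _)]

end Contraction

set_option maxHeartbeats 800000 in
theorem mainTheorem1 {P m p : ℕ} {n : Fin P → ℕ}
    -- the program
    (f : PrimalSpace n → ℝ)
    (g : PrimalSpace n → EuclideanSpace ℝ (Fin p) → EuclideanSpace ℝ (Fin m))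
    (Z : ∀ i : Fin P, Set (EuclideanSpace ℝ (Fin (n i))))
    (S : Set (EuclideanSpace ℝ (Fin p)))
    (hfC2 : ContDiff ℝ 2 f) (hfsa : IsSemialgebraicFun f) (hfconv : IsMultiConvex f)
    (hg : ∀ s ∈ S, IsMultiAffine (fun z => g z s))
    (hZcomp : ∀ i, IsCompact (Z i)) (hZconv : ∀ i, Convex ℝ (Z i))
    -- the parameters and the tracked solutions, strongly regular local optima,
    -- with radii and Lipschitz constant independent of the time instant
    (s : ℕ → EuclideanSpace ℝ (Fin p)) (hs : ∀ k, s k ∈ S)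
    (wstar : ℕ → PrimalDualSpace n m)
    (hreg : ∃ η > 0, ∃ κ > 0, ∃ l : ℝ, ∀ k,
      IsStronglyRegularWith (kktMap f g (s k)) (primalDualSet m Z) (wstar k) η κ l)
    (hopt : ∃ ε > 0, ∀ k, IsOptimalWithin f g Z (s k) ε (wstar k).fst)
    -- Lipschitz dependence on the parameter, Lipschitz constant of the constraint map
    (lamF : ℝ) (hlamF : 0 < lamF)
    (hF : ∀ w ∈ primalDualSet m Z, ∀ s₁ ∈ S, ∀ s₂ ∈ S,
      ‖kktMap f g s₁ w - kktMap f g s₂ w‖ ≤ lamF * ‖s₁ - s₂‖)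
    (lamg : ℝ) (hlamg : 0 < lamg)
    (hgLip : ∀ s₁ ∈ S, ∀ z ∈ productSet Z, ∀ z' ∈ productSet Z,
      ‖g z s₁ - g z' s₁‖ ≤ lamg * ‖z - z'‖) :
    ∃ δA > 0, ∃ rA > 0,
      KKTUnique f g Z S s wstar δA rA ∧
      (∃ lamA > 0, KKTLipschitz f g Z S s wstar δA rA lamA) ∧
      ∃ ρtilde > 0, ∀ ρ > ρtilde,
        (∀ k, IsStronglyRegular (auxMap f g ρ (wstar k).snd 0 (s k)) (primalDualSet m Z)
          (wstar k)) ∧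
        ∃ δB > 0, ∃ rB > 0, ∃ qB > 0,
          AuxUnique f g Z S s wstar ρ δB rB qB ∧
          (∃ lamB > 0, AuxLipschitz f g Z S s wstar ρ δB rB qB lamB) ∧
          ∀ α : Fin P → ℝ, (∀ i, 0 < α i) →
          ∀ δ > 0, ∀ θhat : ℝ, 1 / 2 < θhat → θhat < 1 → UniformKL f g Z S ρ δ θhat →
          ∃ C > 0,
            ∀ lamA > 0, KKTLipschitz f g Z S s wstar δA rA lamA →
            ∀ lamB > 0, AuxLipschitz f g Z S s wstar ρ δB rB qB lamB →
            ∀ M : ℕ, 1 ≤ M → ∀ k : ℕ,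
            -- the critical point at time `k + 1`
            ∀ wnext ∈ Metric.ball (wstar k) δA, IsKKT f g Z (s (k + 1)) wnext →
            -- the iterates at time `k` and at time `k + 1`
            ∀ (z z' : PrimalSpace n) (μ μ' : EuclideanSpace ℝ (Fin m)),
              z ∈ productSet Z →
              IsAlgorithmStep f g Z α ρ M (s (k + 1)) z μ z' μ' →
              ‖s (k + 1) - s k‖ < min rA (min rB (qB * ρ / (lamA * lamF))) →
              ‖pdPoint z μ - wstar k‖ < qB * ρ →
              (1 + lamG lamF * lamB / ρ) * ‖pdPoint z μ - wstar k‖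
                + lamG lamF * lamB * ‖s (k + 1) - s k‖ < δ →
              ‖pdPoint z' μ' - wnext‖
                ≤ betaW C lamg lamB lamF θhat ρ M * ‖pdPoint z μ - wstar k‖
                  + betaS C lamg lamA lamB lamF θhat ρ M * ‖s (k + 1) - s k‖ := by

  have h : IsParametricProgram f g Z S lamF := ⟨hfC2, hfconv, hg, hZcomp, hZconv, hF⟩
  obtain ⟨η, hη, κ, hκ, l, hreg⟩ := hreg
  obtain ⟨ε, hε, hopt⟩ := hopt
  obtain ⟨K, hB, hμK, B, hwB⟩ := h.exists_bounds hs hη hreg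
  obtain ⟨δ, hδ, σ, hσ, L, hL, τ₀, hτ₀, hstab⟩ := h.exists_uniform_stability hs hη hκ hreg hwB
  have hmem : ∀ k, wstar k ∈ primalDualSet m Z := fun k => (hreg k).solves.mem
  have hshift := fun k τ h0 h1 => h.shifted_stability (τ := τ) (hs k) (hmem k)
    (hstab k τ h0 h1).1 (hstab k τ h0 h1).2.1
  have hpoint := fun k => h.isStablePoint (τ₀ := τ₀) (hs 0) (hs k) (hreg k) (hμK k) hL.le
    fun τ h0 h1 => (hstab k τ h0 h1).2.1
  obtain ⟨ρ₀, hρ₀, hinner⟩ := h.exists_inner_rate (hs 0) hs hη hL (half_pos hδ) (half_pos hσ) hτ₀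
    hε hB hpoint hopt
  have hsmall : ∀ k, ∀ s₁ : EuclideanSpace ℝ (Fin p), dist s₁ (s k) < σ / lamF →
      ‖(0 : EuclideanSpace ℝ (Fin m))‖ + lamF * ‖s₁ - s k‖ < σ := fun k s₁ hd => by
    rw [dist_eq_norm, lt_div_iff₀ hlamF] at hd
    rw [norm_zero, zero_add]; linarith
  refine ⟨δ, hδ, σ / lamF, by positivity, ?_, ⟨L, hL, ?_⟩, max ρ₀ τ₀⁻¹, by positivity, ?_⟩
  · intro k s₁ hs₁ hd
    simp only [isKKT_iff_solvesGE (μs := (wstar k).snd)]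
    exact (hshift k 0 le_rfl hτ₀.le).1 0 s₁ hs₁ (hsmall k s₁ hd)
  · intro k s₁ hs₁ s₂ hs₂ hd₁ hd₂ w₁ hw₁ w₂ hw₂ h₁ h₂
    rw [isKKT_iff_solvesGE (μs := (wstar k).snd)] at h₁ h₂
    have := (hshift k 0 le_rfl hτ₀.le).2 0 0 s₁ hs₁ s₂ hs₂ (hsmall k s₁ hd₁) (hsmall k s₂ hd₂)
      w₁ hw₁ w₂ hw₂ h₁ h₂
    rwa [add_sub_add_right_eq_sub, regKKTMap_zero, regKKTMap_zero] at this
  intro ρ hρ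
  have hρ1 : ρ₀ < ρ := (le_max_left _ _).trans_lt hρ
  have hρ2 : τ₀⁻¹ < ρ := (le_max_right _ _).trans_lt hρ
  have hρ0 : 0 < ρ := hρ₀.trans hρ1
  have hρτ : ρ⁻¹ ≤ τ₀ := inv_le_of_inv_le₀ hτ₀ hρ2.le
  have hρi : 0 ≤ ρ⁻¹ := (inv_pos.2 hρ0).le
  obtain ⟨e, he, hrate⟩ := hinner ρ hρ1
  -- the radii of the auxiliary problem
  set q : ℝ := min (min (e / ρ) (δ / ρ)) (min (σ / 2) (δ / (4 * L))) with hq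
  have hq0 : 0 < q := by positivity
  have hqe : q * ρ ≤ e := by
    rw [← le_div_iff₀ hρ0]; exact (min_le_left _ _).trans (min_le_left _ _)
  have hqδ : q * ρ ≤ δ := by
    rw [← le_div_iff₀ hρ0]; exact (min_le_left _ _).trans (min_le_right _ _)
  have hqσ : q ≤ σ / 2 := (min_le_right _ _).trans (min_le_left _ _)
  have hqL : L * q ≤ δ / 4 := by
    have : q ≤ δ / (4 * L) := (min_le_right _ _).trans (min_le_right _ _)
    rw [le_div_iff₀ (by positivity)] at this
    linarith
  -- Bounds the constraint shift caused by the parameter. As `L * q` and `L * t` are at most `δ /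
  -- 4`, the tracked solution lies within `δ / 2` of `w_k*`, where the inner rate is valid.
  set t : ℝ := min e (min (σ / 2) (δ / (4 * L))) with ht
  have ht0 : 0 < t := by positivity
  have htL : L * t ≤ δ / 4 := by
    have : t ≤ δ / (4 * L) := (min_le_right _ _).trans (min_le_right _ _)
    rw [le_div_iff₀ (by positivity)] at this
    linarith
  have htσ : t ≤ σ / 2 := (min_le_right _ _).trans (min_le_left _ _)
  have hdist : ∀ {s₁ s₂ : EuclideanSpace ℝ (Fin p)}, dist s₁ s₂ < t / lamF →
      lamF * ‖s₁ - s₂‖ < t := fun {s₁ s₂} hd => by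
    rw [dist_eq_norm, lt_div_iff₀ hlamF] at hd; linarith
  have hauxU : AuxUnique f g Z S s wstar ρ δ (t / lamF) q := by
    intro k d hd s₁ hs₁ hds
    simp only [solvesAux_iff_solvesGE]
    exact (hshift k ρ⁻¹ hρi hρτ).1 d s₁ hs₁ (by linarith [hdist hds])
  have hauxL : AuxLipschitz f g Z S s wstar ρ δ (t / lamF) q L := by
    intro k d₁ d₂ hd₁ hd₂ s₁ hs₁ s₂ hs₂ hds₁ hds₂ w₁ hw₁ w₂ hw₂ h₁ h₂
    rw [solvesAux_iff_solvesGE] at h₁ h₂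
    rw [auxMap_eq, auxMap_eq]
    exact (hshift k ρ⁻¹ hρi hρτ).2 d₁ d₂ s₁ hs₁ s₂ hs₂ (by linarith [hdist hds₁])
      (by linarith [hdist hds₂]) w₁ hw₁ w₂ hw₂ h₁ h₂
  have hself : ∀ k, SolvesAux f g Z ρ (wstar k).snd 0 (s k) (wstar k) := fun k => by
    have := IsKKT.solvesAux (hreg k).solves ρ (wstar k).snd
    rwa [sub_self, smul_zero] at this
  refine ⟨fun k => ?_, δ, hδ, t / lamF, by positivity, q, hq0, hauxU, ⟨L, hL, hauxL⟩, ?_⟩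
  · have e1 : auxMap f g ρ (wstar k).snd 0 (s k) = regKKTMap f g ρ⁻¹ (wstar k).snd (s k) := by
      funext w
      rw [auxMap_eq]
      exact add_zero _
    rw [e1]
    exact (hstab k ρ⁻¹ hρi hρτ).2.2
  intro α hα δKL _ θhat _ _ _
  -- The constant is fixed before `lamA`, `lamB`, `M` and `k` are given.
  obtain ⟨C, hC, hrate⟩ := hrate α hα (rateExponent θhat)
  refine ⟨C, hC, ?_⟩
  intro lamA hlamA hA lamB hlamB hBL M hM k wnext hwnext hKKT z z' μ μ' hz hstep hΔ hE _
  obtain ⟨ζ, hζ0, hsw, hζM, hμ'⟩ := hstep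
  set E : ℝ := ‖pdPoint z μ - wstar k‖ with hEdef
  set Δ : ℝ := ‖s (k + 1) - s k‖ with hΔdef
  have hΔ1 : Δ < σ / lamF := hΔ.trans_le (min_le_left _ _)
  have hΔ2 : Δ < t / lamF := hΔ.trans_le ((min_le_right _ _).trans (min_le_left _ _))
  have hΔ3 : Δ < q * ρ / (lamA * lamF) := hΔ.trans_le ((min_le_right _ _).trans (min_le_right _ _))
  have hself_dist : ∀ {r : ℝ}, 0 < r → dist (s k) (s k) < r := fun hr => by rwa [dist_self]
  have hd₁ : dist (s (k + 1)) (s k) < σ / lamF := by rwa [dist_eq_norm]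
  have hd₂ : dist (s (k + 1)) (s k) < t / lamF := by rwa [dist_eq_norm]
  have hlG1 : 1 ≤ lamG lamF := one_le_lamG hlamF
  have hlG2 : lamF ≤ lamG lamF := le_lamG hlamF
  have hEz : ‖z - (wstar k).fst‖ ≤ E := WithLp.norm_fst_le_norm (pdPoint z μ - wstar k)
  have hEμ : ‖μ - (wstar k).snd‖ ≤ E := WithLp.norm_snd_le_norm (pdPoint z μ - wstar k)
  -- the next KKT point
  have hnext : ‖wnext - wstar k‖ ≤ lamA * lamF * Δ := by
    have h1 := hA k (s (k + 1)) (hs _) (s k) (hs k) hd₁ (hself_dist (by positivity)) wnext hwnext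
      (wstar k) (Metric.mem_ball_self hδ) hKKT (hreg k).solves
    rw [mul_assoc]
    exact h1.trans (by gcongr; exact hF _ (hmem k) _ (hs _) _ (hs k))
  have hnextq : ‖wnext - wstar k‖ < q * ρ := by
    rw [lt_div_iff₀ (by positivity)] at hΔ3
    linarith
  -- the solution tracked by the inner iteration
  set d : EuclideanSpace ℝ (Fin m) := ρ⁻¹ • (μ - (wstar k).snd) with hd
  set d' : EuclideanSpace ℝ (Fin m) := ρ⁻¹ • (wnext.snd - (wstar k).snd) with hd'
  have hscale : ∀ v : EuclideanSpace ℝ (Fin m), ‖ρ⁻¹ • v‖ = ‖v‖ / ρ := fun v => by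
    rw [norm_smul, Real.norm_of_nonneg hρi, inv_mul_eq_div]
  have hdE : ‖d‖ ≤ E / ρ := by rw [hd, hscale]; gcongr
  have hdq : ‖d‖ < q := hdE.trans_lt (by rwa [div_lt_iff₀ hρ0])
  have hdq' : ‖d'‖ < q := by
    rw [hd', hscale, div_lt_iff₀ hρ0]
    exact (WithLp.norm_snd_le_norm (wnext - wstar k)).trans_lt hnextq
  obtain ⟨wi, ⟨hwi, hwiS⟩, -⟩ := hauxU k d hdq (s (k + 1)) (hs _) hd₂
  have hpert : ‖auxMap f g ρ (wstar k).snd d (s (k + 1)) (wstar k)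
      - auxMap f g ρ (wstar k).snd 0 (s k) (wstar k)‖ ≤ ‖d‖ + lamF * Δ := by
    have := norm_auxMap_sub_le h (ρ := ρ) (μs := (wstar k).snd) (d₁ := d) (d₂ := 0) (hs (k + 1))
      (hs k) (hmem k)
    rwa [sub_zero] at this
  -- Needed twice: with the constructed constant `L` to locate `wi`, and with the given `lamB` in
  -- the final estimate.
  have hwi_of : ∀ {lam : ℝ}, 0 < lam → AuxLipschitz f g Z S s wstar ρ δ (t / lamF) q lam →
      ‖wi - wstar k‖ ≤ lam * (‖d‖ + lamF * Δ) := fun {lam} hlam hlip =>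
    (hlip k d 0 hdq (by rwa [norm_zero]) _ (hs _) _ (hs k) hd₂ (hself_dist (by positivity)) wi hwi
      (wstar k) (Metric.mem_ball_self hδ) hwiS (hself k)).trans (by gcongr)
  have hwi_near : ‖wi - wstar k‖ < δ / 2 := by
    have h1 := hwi_of hL hauxL
    have h2 : L * (‖d‖ + lamF * Δ) < L * (q + t) := by
      gcongr
      exact hdist hd₂
    linarith
  obtain ⟨hwiL, hwiG⟩ := solvesAux_iff.1 hwiS
  -- The choice of `d` cancels the reference multiplier, so `wi.snd` is the dual update at `wi.fst`,
  -- which is therefore critical for the augmented Lagrangian of the sweeps.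
  have hμi : wi.snd = μ + ρ • g wi.fst (s (k + 1)) := by
    rw [hd, add_assoc, ← smul_add, sub_add_sub_cancel] at hwiG
    have : ρ • (g wi.fst (s (k + 1)) + ρ⁻¹ • (μ - wi.snd)) = 0 := by rw [hwiG, smul_zero]
    rw [smul_add, smul_smul, mul_inv_cancel₀ hρ0.ne', one_smul] at this
    rw [← sub_eq_zero, ← neg_eq_zero, ← this]
    abel
  have hEe : E ≤ e := hE.le.trans hqe
  have hz' : ‖z' - wi.fst‖ ≤ C * (M : ℝ) ^ (-rateExponent θhat) * ‖z - wi.fst‖ := by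
    rw [hζM]
    exact hrate k (s (k + 1)) (hs _) hz (hEz.trans hEe) (hEμ.trans hEe)
      ((h.norm_constraint_sub_le (hs _) (hs k) (hmem k)).trans
        ((hdist hd₂).le.trans (min_le_left _ _)))
      ((WithLp.norm_fst_le_norm (wi - wstar k)).trans_lt hwi_near)
      ((WithLp.norm_snd_le_norm (wi - wstar k)).trans_lt hwi_near)
      ((h.isLagrangeStationary_iff (hs _) (hs 0)).1 hwiL) hμi hM hζ0 hsw
  have hz'mem : z' ∈ productSet Z := by
    obtain ⟨N, rfl⟩ : ∃ N, M = N + 1 := ⟨M - 1, by omega⟩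
    rw [hζM]
    exact fun i => (hsw N (Nat.lt_succ_self N) i).1
  -- the final estimate
  refine tracking_error_le (lG := lamG lamF) (ψ := rateExponent θhat)
    (x := ‖pdPoint z' μ' - wi‖) (y := ‖wi - wnext‖) (z₁ := ‖z' - wi.fst‖)
    (z₀ := ‖z - wi.fst‖) rfl rfl hC.le hlamg.le hρ0.le ?_ ?_ hz' ?_ ?_
  · exact norm_sub_le_norm_sub_add_norm_sub _ _ _
  · have h1 : ‖pdPoint z' μ' - wi‖ ≤ ‖z' - wi.fst‖ + ‖μ' - wi.snd‖ :=
      WithLp.norm_le_norm_fst_add_norm_snd (pdPoint z' μ' - wi)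
    have h2 : μ' - wi.snd = ρ • (g z' (s (k + 1)) - g wi.fst (s (k + 1))) := by
      rw [hμ', hμi, smul_sub]; abel
    have h3 : ‖μ' - wi.snd‖ ≤ ρ * (lamg * ‖z' - wi.fst‖) := by
      rw [h2, norm_smul, Real.norm_of_nonneg hρ0.le]
      gcongr
      exact hgLip _ (hs _) _ hz'mem _ hwiL.mem
    linarith
  · have h1 : ‖z - wi.fst‖ ≤ ‖z - (wstar k).fst‖ + ‖(wstar k).fst - wi.fst‖ :=
      norm_sub_le_norm_sub_add_norm_sub _ _ _
    have h2 : ‖(wstar k).fst - wi.fst‖ ≤ ‖wi - wstar k‖ := by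
      rw [norm_sub_rev]; exact WithLp.norm_fst_le_norm (wi - wstar k)
    have h3 : ‖d‖ + lamF * Δ ≤ lamG lamF * (E / ρ + Δ) := by
      have : 1 * (E / ρ) ≤ lamG lamF * (E / ρ) := by gcongr
      have : lamF * Δ ≤ lamG lamF * Δ := by gcongr
      linarith
    have h4 : lamB * (‖d‖ + lamF * Δ) ≤ lamB * (lamG lamF * (E / ρ + Δ)) := by gcongr
    linarith [hwi_of hlamB hBL]
  -- `wnext` solves the auxiliary equation with shift `d'` at the same parameter, so only `d - d' =
  -- (μ - wnext.snd) / ρ` enters.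
  · have h1 := hBL k d d' hdq hdq' _ (hs _) _ (hs _) hd₂ hd₂ wi hwi wnext hwnext hwiS
      (IsKKT.solvesAux hKKT ρ (wstar k).snd)
    have h2 := norm_auxMap_sub_le h (ρ := ρ) (μs := (wstar k).snd) (d₁ := d) (d₂ := d')
      (hs (k + 1)) (hs (k + 1)) (w := wnext) hKKT.mem
    rw [sub_self, norm_zero, mul_zero, add_zero] at h2
    have h3 : ‖d - d'‖ ≤ (E + lamA * lamF * Δ) / ρ := by
      rw [hd, hd', ← smul_sub, sub_sub_sub_cancel_right, hscale]
      gcongr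
      have e1 : μ - wnext.snd = (μ - (wstar k).snd) - (wnext - wstar k).snd := by
        change _ = (μ - (wstar k).snd) - (wnext.snd - (wstar k).snd)
        abel
      rw [e1]
      exact (norm_sub_le _ _).trans
        (add_le_add hEμ ((WithLp.norm_snd_le_norm _).trans hnext))
    have h4 : 0 ≤ (E + lamA * lamF * Δ) / ρ := by positivity
    calc ‖wi - wnext‖ ≤ lamB * ((E + lamA * lamF * Δ) / ρ) := h1.trans (by gcongr; exact h2.trans h3)
      _ ≤ lamB * (lamG lamF * ((E + lamA * lamF * Δ) / ρ)) := by
          gcongr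
          exact le_mul_of_one_le_left h4 hlG1
      _ = lamB * lamG lamF / ρ * (E + lamA * lamF * Δ) := by ring
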